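/- Let $n\ge 1$. **(i) Discrete probability.** Let $z,\alpha,t>0$, $t\neq 1$, with $z^2t^{i+j-2}<1$ for $1\le i<j\le n$ and $\alpha z t^{i-1}<1$ for $1\le i\le n$. Let $[x_{i,j}]_{i,j=1}^n$ be a random symmetric matrix with non-negative integer entries, $x_{i,j}=x_{j,i}$, whose entries with $i\le j$ are independent, with $$\Pr(x_{i,j}=k)=(1-z^2t^{i+j-2})(z^2t^{i+j-2})^k\ (i<j),\qquad \Pr(x_{i,i}=k)=(1-\alpha zt^{i-1})(\alpha zt^{i-1})^k,\qquad k=0,1,2,\dots$$ Then for every partition $\mu=(\mu_1\ge\cdots\ge\mu_n\ge0)$ the probability that the tableau associated to $[x_{i,j}]$ by the Robinson–Schensted–Knuth correspondence has shape $\mu$ equals $$c_n(z,\alpha,t)\, z^{\sum_{j=1}^n h_j}\,\alpha^{\sum_{j=1}^n(-1)^{j-1}h_j}\prod_{1\le i<j\le n}(t^{h_j}-t^{h_i}),\qquad h_j:=\mu_j+n-j,\tag{1}$$ $$c_n(z,\alpha,t)=z^{-\sum_{j=1}^n(n-j)}\alpha^{-\lfloor n/2\rfloor}\frac{t^{-\sum_{j=1}^n(j-1)(n-j)}}{\prod_{l=1}^{n-1}(t;t)_l}\prod_{i=1}^n(1-\alpha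 zt^{i-1})\prod_{1\le i<j\le n}(1-z^2t^{i+j-2}),$$ where $(t;t)_l=(1-t)(1-t^2)\cdots(1-t^l)$. **(ii) Jacobi limit.** Let $a,a_1\in\mathbb R$ with $a+a_1>0$ and, if $n\ge2$, $2a+1>0$. Put $t=e^{-1/L}$, $z=e^{-a/L}$, $\alpha=e^{-a_1/L}$ and let $L\to\infty$. Then the rescaled matrix $[x_{i,j}/L]$ converges in distribution to the random symmetric matrix whose entries with $i\le j$ are independent exponential variables, of rate $i+j-2+2a$ for $i<j$ and of rate $i-1+a+a_1$ for $i=j$. If $x_1>\cdots>x_n>0$ and the non-negative integers $h_j=h_j(L)$ satisfy $h_j/L\to x_j$ for each $j$, then $L^n$ times (1) tends to $$\tilde c_n(a,a_1)\,e^{-a\sum_{j=1}^nx_j}\,e^{-a_1\sum_{j=1}^n(-1)^{j-1}x_j}\prod_{1\le i<j\le n}(e^{-x_j}-e^{-x_i}),\tag{2}$$ $$\tilde c_n(a,a_1)=\frac{\Gamma(a+a_1+n)}{\Gamma(a+a_1)}\,\frac1{\prod_{l=1}^{n-1}l!}\prod_{i=1}^{n-1}\frac{\Gamma(2a+i+n-1)}{\Gamma(2a+2i-1)}.$$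 The function (2) is positive on $\{x_1>x_2>\cdots>x_n>0\}$ and is a probability density there. It is the density of the continuous RSK shape $(\lambda_1(n,n),\dots,\lambda_n(n,n))$ of the exponential matrix $[y_{i,j}]$ above, where $\lambda_l(0,j)=\lambda_l(i,0)=0$, $\lambda_1(i,j)=\max(\lambda_1(i,j-1),\lambda_1(i-1,j))+y_{i,j}$, and, for $l>1$, $$\lambda_l(i,j)=\max(\lambda_l(i,j-1),\lambda_l(i-1,j))+\min(\lambda_{l-1}(i,j-1),\lambda_{l-1}(i-1,j))-\lambda_{l-1}(i-1,j-1).$$ **(iii) Equivalence.** Let $a>-2$ and $A<a+1$. If $(x_1,\dots,x_{2n})$ has the density (2) with $n,a,a_1$ replaced by $2n,(a+1)/2,-A/2$, then $(e^{-x_{2n}},e^{-x_{2n-1}},\dots,e^{-x_1})$ has, on $1>y_1>y_2>\cdots>y_{2n}>0$, the probability density $$\frac1C\prod_{j=1}^{2n}y_j^{(a-1)/2}\prod_{l=1}^n\Big(\frac{y_{2l}}{y_{2l-1}}\Big)^{-A/2}\prod_{1\le j<k\le2n}(y_j-y_k)$$ for some normalization constant $C>0$. -/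

import Mathlib

open MeasureTheory ProbabilityTheory Filter
open scoped Topology

namespace JacobiRSK

/-! ## The Robinson-Schensted-Knuth correspondence -/

/-- Row insertion of the letter `x` into a weakly increasing row: `x` replaces the leftmost entry
that is strictly larger than `x` (this entry is bumped), or is appended if there is none. -/
def rowInsert {β : Type*} [LinearOrder β] : List β → β → List β × Option β
  | [], x => ([x], none)
  | y :: ys, x =>
    if x < y then (x :: ys, some y)
    else (y :: (rowInsert ys x).1, (rowInsert ys x).2)

/-- Schensted insertion of a letter into a tableau (a list of rows): insert into the first row,
and insert the bumped letter, if any, into the tableau formed by the remaining rows. -/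
def tableauInsert {β : Type*} [LinearOrder β] : List (List β) → β → List (List β)
  | [], x => [[x]]
  | r :: rs, x =>
    match rowInsert r x with
    | (r', none) => r' :: rs
    | (r', some y) => r' :: tableauInsert rs y

/-- The bottom line of the generalized permutation (two-line array) of a non-negative integer
matrix: the pairs `(i, j)`, each repeated `X i j` times, are listed in lexicographic order, and
the letters `j` are recorded. -/
def rskWord {n : ℕ} (X : Fin n → Fin n → ℕ) : List (Fin n) :=
  (List.finRange n).flatMap fun i =>
    (List.finRange n).flatMap fun j => List.replicate (X i j) j

/-- The insertion tableau that RSK assigns to a non-negative integer matrix. For a symmetric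
matrix it is also the recording tableau. -/
def rskTableau {n : ℕ} (X : Fin n → Fin n → ℕ) : List (List (Fin n)) :=
  (rskWord X).foldl tableauInsert []

/-- Length of the `k`-th row (`k = 0, 1, …`) of the RSK tableau, zero beyond the last row. -/
def rskShape {n : ℕ} (X : Fin n → Fin n → ℕ) (k : ℕ) : ℕ :=
  ((rskTableau X).getD k []).length

/-- The RSK tableau of `X` has shape `μ = (μ_0, …, μ_{n-1})`, with all further rows empty. -/
def HasRSKShape {n : ℕ} (X : Fin n → Fin n → ℕ) (μ : Fin n → ℕ) : Prop :=
  ∀ k : ℕ, rskShape X k = if hk : k < n then μ ⟨k, hk⟩ else 0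

/-- The continuous RSK growth process. For a real array `X` (row and column indices from `0`),
`growth X i j l` is the maximal displacement of the path at level `l + 1` produced by the first `i`
rows and first `j` columns. -/
noncomputable def growth (X : ℕ → ℕ → ℝ) : ℕ → ℕ → ℕ → ℝ
  | 0, _, _ => 0
  | _ + 1, 0, _ => 0
  | i + 1, j + 1, 0 => max (growth X i (j + 1) 0) (growth X (i + 1) j 0) + X i j
  | i + 1, j + 1, l + 1 =>
      max (growth X i (j + 1) (l + 1)) (growth X (i + 1) j (l + 1))
        + min (growth X i (j + 1) l) (growth X (i + 1) j l) - growth X i j l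
  termination_by i j => (i, j)

/-- The continuous RSK shape `(x_1, …, x_n)` of an `n × n` real matrix. -/
noncomputable def continuousShape {n : ℕ} (X : Fin n → Fin n → ℝ) : Fin n → ℝ := fun l =>
  growth (fun i j => if h : i < n ∧ j < n then X ⟨i, h.1⟩ ⟨j, h.2⟩ else 0) n n l

/-! ## Random symmetric matrices -/

/-- A random symmetric matrix whose entries on and above the diagonal are independent and
geometric, with parameter `z² t^{i+j}` off the diagonal and `α z t^i` on it
(indices `i, j = 0, …, n-1`). -/
structure IsSymmGeometric {Ω : Type*} [MeasurableSpace Ω] (P : Measure Ω) {n : ℕ}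
    (z α t : ℝ) (X : Fin n → Fin n → Ω → ℕ) : Prop where
  measurable : ∀ i j, Measurable (X i j)
  symm : ∀ i j ω, X i j ω = X j i ω
  indep : iIndepFun (fun p : {p : Fin n × Fin n // p.1 ≤ p.2} => X p.1.1 p.1.2) P
  offDiag : ∀ i j, i < j → ∀ k : ℕ, P.real {ω | X i j ω = k}
    = (1 - z ^ 2 * t ^ ((i : ℕ) + (j : ℕ))) * (z ^ 2 * t ^ ((i : ℕ) + (j : ℕ))) ^ k
  diag : ∀ i, ∀ k : ℕ, P.real {ω | X i i ω = k}
    = (1 - α * z * t ^ (i : ℕ)) * (α * z * t ^ (i : ℕ)) ^ k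

/-- A random symmetric matrix whose entries on and above the diagonal are independent and
exponential, with rate `i + j + 2a` off the diagonal and `i + a + a₁` on it
(indices `i, j = 0, …, n-1`). -/
structure IsSymmExponential {Ω : Type*} [MeasurableSpace Ω] (P : Measure Ω) {n : ℕ}
    (a a₁ : ℝ) (Y : Fin n → Fin n → Ω → ℝ) : Prop where
  measurable : ∀ i j, Measurable (Y i j)
  symm : ∀ i j ω, Y i j ω = Y j i ω
  indep : iIndepFun (fun p : {p : Fin n × Fin n // p.1 ≤ p.2} => Y p.1.1 p.1.2) P
  offDiag : ∀ i j, i < j → P.map (Y i j) = expMeasure ((i : ℕ) + (j : ℕ) + 2 * a)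
  diag : ∀ i, P.map (Y i i) = expMeasure ((i : ℕ) + a + a₁)

/-! ## The discrete probability -/

/-- `(t;t)_l = (1 - t)(1 - t²) ⋯ (1 - t^l)`. -/
noncomputable def qPoch (t : ℝ) (l : ℕ) : ℝ := ∏ m ∈ Finset.Icc 1 l, (1 - t ^ m)

/-- The normalization `c_n(z, α, t)`. -/
noncomputable def discreteConst (n : ℕ) (z α t : ℝ) : ℝ :=
  (z ^ (∑ j ∈ Finset.Icc 1 n, (n - j)))⁻¹ * (α ^ (n / 2))⁻¹
    * ((t ^ (∑ j ∈ Finset.Icc 1 n, (j - 1) * (n - j)))⁻¹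
        / ∏ l ∈ Finset.Icc 1 (n - 1), qPoch t l)
    * (∏ i ∈ Finset.Icc 1 n, (1 - α * z * t ^ (i - 1)))
    * ∏ i ∈ Finset.Icc 1 n, ∏ j ∈ Finset.Icc (i + 1) n, (1 - z ^ 2 * t ^ (i + j - 2))

/-- The explicit discrete probability, as a function of `h_1, …, h_n`. -/
noncomputable def discreteProb (n : ℕ) (z α t : ℝ) (h : Fin n → ℕ) : ℝ :=
  discreteConst n z α t * z ^ (∑ j, h j) * α ^ (∑ j : Fin n, (-1 : ℤ) ^ (j : ℕ) * (h j : ℤ))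
    * ∏ i : Fin n, ∏ j ∈ Finset.Ioi i, (t ^ h j - t ^ h i)

/-! ## The limiting density -/

/-- The normalization `c̃_n(a, a₁)`. -/
noncomputable def limitConst (n : ℕ) (a a₁ : ℝ) : ℝ :=
  Real.Gamma (a + a₁ + n) / Real.Gamma (a + a₁)
    * (1 / ∏ l ∈ Finset.Icc 1 (n - 1), (l.factorial : ℝ))
    * ∏ i ∈ Finset.Icc 1 (n - 1),
        Real.Gamma (2 * a + i + n - 1) / Real.Gamma (2 * a + 2 * i - 1)

/-- The limiting density, on the chamber `x_1 > ⋯ > x_n > 0`. -/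
noncomputable def limitDensity (n : ℕ) (a a₁ : ℝ) (x : Fin n → ℝ) : ℝ :=
  limitConst n a a₁ * Real.exp (-a * ∑ j, x j)
    * Real.exp (-a₁ * ∑ j : Fin n, (-1 : ℝ) ^ (j : ℕ) * x j)
    * ∏ i : Fin n, ∏ j ∈ Finset.Ioi i, (Real.exp (-x j) - Real.exp (-x i))

/-- The chamber `x_1 > x_2 > ⋯ > x_n > 0`. -/
def chamber (n : ℕ) : Set (Fin n → ℝ) := {x | StrictAnti x ∧ ∀ j, 0 < x j}

/-- The measure on `ℝⁿ` with density `limitDensity` on the chamber and `0` elsewhere. -/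
noncomputable def limitMeasure (n : ℕ) (a a₁ : ℝ) : Measure (Fin n → ℝ) :=
  volume.withDensity ((chamber n).indicator fun x => ENNReal.ofReal (limitDensity n a a₁ x))

/-- The unnormalized parameter-dependent Jacobi weight
`∏_{j=1}^{2n} x_j^{(a-1)/2} ∏_{l=1}^n (x_{2l}/x_{2l-1})^{-A/2} ∏_{1 ≤ j < k ≤ 2n} (x_j - x_k)`. -/
noncomputable def jacobiWeight (n : ℕ) (a A : ℝ) (x : Fin (2 * n) → ℝ) : ℝ :=
  (∏ j, x j ^ ((a - 1) / 2))
    * (∏ l : Fin n, (x ⟨2 * l + 1, by omega⟩ / x ⟨2 * l, by omega⟩) ^ (-A / 2))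
    * ∏ j : Fin (2 * n), ∏ k ∈ Finset.Ioi j, (x j - x k)

/-- The chamber `1 > x_1 > x_2 > ⋯ > x_N > 0`. -/
def unitChamber (N : ℕ) : Set (Fin N → ℝ) := {x | StrictAnti x ∧ ∀ j, 0 < x j ∧ x j < 1}

/-- The measure on `ℝ^{2n}` with density `C⁻¹ * jacobiWeight` on `1 > x_1 > ⋯ > x_{2n} > 0`. -/
noncomputable def jacobiMeasure (n : ℕ) (a A C : ℝ) : Measure (Fin (2 * n) → ℝ) :=
  volume.withDensity ((unitChamber (2 * n)).indicator fun x =>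
    ENNReal.ofReal (C⁻¹ * jacobiWeight n a A x))

end JacobiRSK

namespace JacobiRSK

/-! ## Row insertion of words -/

/-- Number of letters smaller than `k` in a word. -/
def cnt {n : ℕ} (k : ℕ) (r : List (Fin n)) : ℕ := r.countP fun y : Fin n => decide ((y : ℕ) < k)

@[simp] lemma cnt_nil {n : ℕ} (k : ℕ) : cnt k ([] : List (Fin n)) = 0 := rfl

lemma cnt_cons {n : ℕ} (k : ℕ) (x : Fin n) (r : List (Fin n)) :
    cnt k (x :: r) = cnt k r + if (x : ℕ) < k then 1 else 0 := by
  simp [cnt, List.countP_cons]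

lemma cnt_append {n : ℕ} (k : ℕ) (r s : List (Fin n)) : cnt k (r ++ s) = cnt k r + cnt k s := by
  simp [cnt]

lemma cnt_zero {n : ℕ} (r : List (Fin n)) : cnt 0 r = 0 := by
  simp [cnt]

lemma cnt_mono {n : ℕ} (r : List (Fin n)) : Monotone fun k => cnt k r := by
  intro k m h
  exact List.countP_mono_left fun x _ hx => by
    simp only [decide_eq_true_eq] at *
    omega

lemma cnt_eq_length {n : ℕ} (r : List (Fin n)) : cnt n r = r.length := by
  simp [cnt]

lemma cnt_congr {n : ℕ} {r : List (Fin n)} {k m : ℕ} (h : ∀ z ∈ r, (z : ℕ) < k ↔ (z : ℕ) < m) :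
    cnt k r = cnt m r :=
  List.countP_congr fun x hx => by simpa using h x hx

lemma cnt_eq_zero {n : ℕ} {r : List (Fin n)} {k : ℕ} (h : ∀ z ∈ r, k ≤ (z : ℕ)) :
    cnt k r = 0 := by
  simpa [cnt, List.countP_eq_zero] using h

lemma rowInsert_spec {n : ℕ} (r : List (Fin n)) (x : Fin n) (hr : r.Pairwise (· ≤ ·)) :
    (rowInsert r x).1.Pairwise (· ≤ ·) ∧
    (∀ z ∈ (rowInsert r x).1, z = x ∨ z ∈ r) ∧
    (∀ k, cnt k (rowInsert r x).1 + cnt k (rowInsert r x).2.toList = cnt k r + cnt k [x]) ∧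
    (∀ y ∈ (rowInsert r x).2, y ∈ r ∧ x < y ∧ ∀ z ∈ r, x < z → y ≤ z) ∧
    ((rowInsert r x).2 = none → ∀ z ∈ r, z ≤ x) := by
  induction r with
  | nil => simp [rowInsert]
  | cons y ys ih =>
    rw [List.pairwise_cons] at hr
    obtain ⟨h1, h2, h3, h4, h5⟩ := ih hr.2
    by_cases hxy : x < y
    · simp only [rowInsert, hxy, if_true]
      refine ⟨List.pairwise_cons.2 ⟨fun z hz => hxy.le.trans (hr.1 z hz), hr.2⟩, ?_, ?_, ?_, by simp⟩
      · intro z hz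
        simp only [List.mem_cons] at hz ⊢
        tauto
      · intro k
        simp only [cnt_cons, Option.toList, cnt_nil]
        omega
      · intro z hz
        simp only [Option.mem_def, Option.some.injEq] at hz
        subst hz
        refine ⟨by simp, hxy, fun z hz _ => ?_⟩
        rcases List.mem_cons.1 hz with rfl | hz
        · exact le_rfl
        · exact hr.1 z hz
    · simp only [rowInsert, hxy, if_false]
      refine ⟨List.pairwise_cons.2 ⟨fun z hz => ?_, h1⟩, ?_, ?_, ?_, fun hn z hz => ?_⟩
      · rcases h2 z hz with rfl | hz
        · exact not_lt.1 hxy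
        · exact hr.1 z hz
      · intro z hz
        rcases List.mem_cons.1 hz with rfl | hz
        · simp
        · rcases h2 z hz with rfl | hz <;> simp [*]
      · intro k
        have := h3 k
        simp only [cnt_cons, cnt_nil] at this ⊢
        omega
      · intro z hz
        obtain ⟨g1, g2, g3⟩ := h4 z hz
        refine ⟨by simp [g1], g2, fun w hw hxw => ?_⟩
        rcases List.mem_cons.1 hw with rfl | hw
        · exact absurd hxw hxy
        · exact g3 w hw hxw
      · rcases List.mem_cons.1 hz with rfl | hz
        · exact not_lt.1 hxy
        · exact h5 hn z hz

/-- Insert the letters of a word one after the other into a row; returns the new row and the word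
of bumped letters. -/
def rowInsertWord {β : Type*} [LinearOrder β] : List β → List β → List β × List β
  | r, [] => (r, [])
  | r, x :: w =>
    ((rowInsertWord (rowInsert r x).1 w).1,
      (rowInsert r x).2.toList ++ (rowInsertWord (rowInsert r x).1 w).2)

lemma le_of_mem_rowInsertWord_snd {n : ℕ} (w : List (Fin n)) :
    ∀ (r : List (Fin n)) (x y : Fin n), r.Pairwise (· ≤ ·) → (x :: w).Pairwise (· ≤ ·) →
    (∀ z ∈ r, x < z → y ≤ z) → ∀ z ∈ (rowInsertWord r w).2, y ≤ z := by
  induction w with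
  | nil => simp [rowInsertWord]
  | cons x' w ih =>
    intro r x y hr hw h z hz
    obtain ⟨h1, h2, -, h4, -⟩ := rowInsert_spec r x' hr
    rw [List.pairwise_cons] at hw
    have hxx' : x ≤ x' := hw.1 x' (by simp)
    simp only [rowInsertWord, List.mem_append, Option.mem_toList] at hz
    rcases hz with hz | hz
    · obtain ⟨g1, g2, -⟩ := h4 z hz
      exact h z g1 (hxx'.trans_lt g2)
    · refine ih _ x' y h1 hw.2 (fun v hv hxv => ?_) z hz
      rcases h2 v hv with rfl | hv
      · exact absurd hxv (lt_irrefl _)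
      · exact h v hv (hxx'.trans_lt hxv)

lemma rowInsertWord_spec {n : ℕ} (w : List (Fin n)) :
    ∀ r : List (Fin n), r.Pairwise (· ≤ ·) → w.Pairwise (· ≤ ·) →
    (rowInsertWord r w).1.Pairwise (· ≤ ·) ∧ (rowInsertWord r w).2.Pairwise (· ≤ ·) ∧
    (∀ k, cnt k (rowInsertWord r w).1 + cnt k (rowInsertWord r w).2 = cnt k r + cnt k w) ∧
    (∀ k, cnt (k + 1) (rowInsertWord r w).1 + cnt k w
      = max (cnt k (rowInsertWord r w).1) (cnt (k + 1) r) + cnt (k + 1) w) := by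
  induction w with
  | nil =>
    intro r hr _
    refine ⟨hr, by simp [rowInsertWord], by simp [rowInsertWord], fun k => ?_⟩
    have := cnt_mono r (Nat.le_succ k)
    simp only [rowInsertWord, cnt_nil] at this ⊢
    simp only [Nat.succ_eq_add_one] at this
    omega
  | cons x w ih =>
    intro r hr hw
    obtain ⟨h1, h2, h3, h4, h5⟩ := rowInsert_spec r x hr
    have hw' := List.pairwise_cons.1 hw
    obtain ⟨g1, g2, g3, g4⟩ := ih (rowInsert r x).1 h1 hw'.2
    simp only [rowInsertWord]
    refine ⟨g1, ?_, ?_, ?_⟩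
    · cases hp : (rowInsert r x).2 with
      | none => simpa using g2
      | some y =>
        simp only [Option.toList, List.singleton_append, List.pairwise_cons]
        refine ⟨?_, g2⟩
        obtain ⟨-, f2, f3⟩ := h4 y (by simp [hp])
        refine le_of_mem_rowInsertWord_snd w _ x y h1 hw (fun v hv hxv => ?_)
        rcases h2 v hv with rfl | hv
        · exact absurd hxv (lt_irrefl _)
        · exact f3 v hv hxv
    · intro k
      have e1 := h3 k
      have e2 := g3 k
      simp only [cnt_append, cnt_cons, cnt_nil] at e1 e2 ⊢
      omega
    · have hsmall : ∀ k : ℕ, k ≤ x → cnt k (rowInsertWord (rowInsert r x).1 w).1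
          = cnt k (rowInsert r x).1 := by
        intro k
        induction k with
        | zero => simp [cnt_zero]
        | succ k ihk =>
          intro hk
          have e1 := ihk (by omega)
          have e2 := g4 k
          have e3 := cnt_mono (rowInsert r x).1 (Nat.le_succ k)
          have e4 : cnt k w = 0 := cnt_eq_zero fun z hz => by
            have := hw'.1 z hz
            simp only [Fin.le_def] at this
            omega
          have e5 : cnt (k + 1) w = 0 := cnt_eq_zero fun z hz => by
            have := hw'.1 z hz
            simp only [Fin.le_def] at this
            omega
          simp only [Nat.succ_eq_add_one] at e3
          omega
      intro k
      have c1 := h3 k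
      have c2 := h3 (k + 1)
      have c3 := g4 k
      have m1 := cnt_mono r (Nat.le_succ k)
      have cx := h3 (x + 1)
      have bx := h3 x
      simp only [Nat.succ_eq_add_one] at m1
      cases hp : (rowInsert r x).2 with
      | none =>
        simp only [hp, Option.toList, cnt_nil, cnt_cons] at c1 c2 cx bx ⊢
        rcases lt_trichotomy k x with hk | hk | hk
        · have := hsmall k hk.le
          split_ifs at * <;> omega
        · have := hsmall k hk.le
          subst hk
          split_ifs at * <;> omega
        · have d1 := g4 x
          have d2 := cnt_mono (rowInsertWord (rowInsert r x).1 w).1 (show (x : ℕ) + 1 ≤ k from hk)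
          have d3 : cnt (k + 1) r = cnt (x + 1) r := cnt_congr fun z hz => by
            have := h5 hp z hz
            simp only [Fin.le_def] at this
            omega
          have d4 := cnt_mono w (Nat.le_succ x)
          simp only [Nat.succ_eq_add_one] at d2 d4
          split_ifs at * <;> omega
      | some y =>
        obtain ⟨f1, f2, f3⟩ := h4 y (by simp [hp])
        have f2' : (x : ℕ) < y := f2
        simp only [hp, Option.toList, cnt_nil, cnt_cons] at c1 c2 cx bx ⊢
        rcases lt_trichotomy k x with hk | hk | hk
        · have := hsmall k hk.le
          split_ifs at * <;> omega
        · have := hsmall k hk.le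
          subst hk
          split_ifs at * <;> omega
        · have d1 := g4 x
          have d2 := cnt_mono (rowInsertWord (rowInsert r x).1 w).1 (show (x : ℕ) + 1 ≤ k from hk)
          have d4 := cnt_mono w (Nat.le_succ x)
          have d3 : k + 1 ≤ y → cnt (k + 1) r = cnt (x + 1) r := fun hky =>
            cnt_congr fun z hz => by
              constructor
              · intro h
                by_contra h'
                have := f3 z hz (by simp only [Fin.lt_def]; omega)
                simp only [Fin.le_def] at this
                omega
              · intro h; omega
          simp only [Nat.succ_eq_add_one] at d2 d4
          have a1 : (x : ℕ) < k + 1 := by omega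
          simp only [hk, a1, lt_irrefl, if_true, if_false, if_pos (Nat.lt_succ_self (x : ℕ)),
            if_neg (show ¬ (y : ℕ) < x by omega), if_neg (show ¬ (y : ℕ) < x + 1 by omega)]
            at c1 c2 cx bx ⊢
          by_cases hky : k + 1 ≤ y
          · rw [if_neg (by omega)] at c2
            have := d3 hky
            omega
          · rw [if_pos (by omega)] at c2
            omega

/-! ## Insertion of words into tableaux -/

/-- Row `k` of a tableau, empty beyond the last row. -/
def tabRow {β : Type*} (T : List (List β)) (k : ℕ) : List β := T.getD k []

lemma tabRow_tail {β : Type*} (T : List (List β)) (k : ℕ) : tabRow T.tail k = tabRow T (k + 1) := by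
  cases T <;> simp [tabRow]

lemma tabRow_tableauInsert_zero {β : Type*} [LinearOrder β] (T : List (List β)) (x : β) :
    tabRow (tableauInsert T x) 0 = (rowInsert (tabRow T 0) x).1 := by
  cases T with
  | nil => simp [tabRow, tableauInsert, rowInsert]
  | cons r rs =>
    rcases h : rowInsert r x with ⟨r', _ | y⟩ <;> simp [tabRow, tableauInsert, h]

lemma tail_tableauInsert {β : Type*} [LinearOrder β] (T : List (List β)) (x : β) :
    (tableauInsert T x).tail = (rowInsert (tabRow T 0) x).2.toList.foldl tableauInsert T.tail := by
  cases T with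
  | nil => simp [tabRow, tableauInsert, rowInsert]
  | cons r rs =>
    rcases h : rowInsert r x with ⟨r', _ | y⟩ <;> simp [tabRow, tableauInsert, h]

lemma tabRow_foldl_zero {β : Type*} [LinearOrder β] (w : List β) :
    ∀ T : List (List β), tabRow (w.foldl tableauInsert T) 0 = (rowInsertWord (tabRow T 0) w).1 := by
  induction w with
  | nil => simp [rowInsertWord]
  | cons x w ih =>
    intro T
    rw [List.foldl_cons, ih, tabRow_tableauInsert_zero]
    rfl

lemma tail_foldl {β : Type*} [LinearOrder β] (w : List β) :
    ∀ T : List (List β), (w.foldl tableauInsert T).tail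
      = (rowInsertWord (tabRow T 0) w).2.foldl tableauInsert T.tail := by
  induction w with
  | nil => simp [rowInsertWord]
  | cons x w ih =>
    intro T
    rw [List.foldl_cons, ih, tabRow_tableauInsert_zero, tail_tableauInsert, ← List.foldl_append]
    rfl

lemma tabRow_foldl_spec {n : ℕ} (l : ℕ) :
    ∀ (T : List (List (Fin n))) (w : List (Fin n)), (∀ l, (tabRow T l).Pairwise (· ≤ ·)) →
    w.Pairwise (· ≤ ·) →
    (tabRow (w.foldl tableauInsert T) l).Pairwise (· ≤ ·) ∧
    (∀ k, cnt (k + 1) (tabRow (w.foldl tableauInsert T) 0) + cnt k w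
      = max (cnt k (tabRow (w.foldl tableauInsert T) 0)) (cnt (k + 1) (tabRow T 0))
        + cnt (k + 1) w) ∧
    (∀ k, cnt (k + 1) (tabRow (w.foldl tableauInsert T) (l + 1)) + cnt k (tabRow T l)
      = max (cnt k (tabRow (w.foldl tableauInsert T) (l + 1))) (cnt (k + 1) (tabRow T (l + 1)))
        + min (cnt k (tabRow (w.foldl tableauInsert T) l)) (cnt (k + 1) (tabRow T l))) := by
  induction l with
  | zero =>
    intro T w hT hw
    obtain ⟨h1, h2, h3, h4⟩ := rowInsertWord_spec w (tabRow T 0) (hT 0) hw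
    obtain ⟨-, -, -, g4⟩ := rowInsertWord_spec _ (tabRow T 1) (hT 1) h2
    refine ⟨by rwa [tabRow_foldl_zero], by rwa [tabRow_foldl_zero], fun k => ?_⟩
    rw [← tabRow_tail, tail_foldl, tabRow_foldl_zero, tabRow_foldl_zero, tabRow_tail]
    have e1 := h3 k
    have e2 := h3 (k + 1)
    have e3 := h4 k
    have e4 := g4 k
    rw [zero_add]
    omega
  | succ l ih =>
    intro T w hT hw
    obtain ⟨h1, h2, h3, h4⟩ := rowInsertWord_spec w (tabRow T 0) (hT 0) hw
    obtain ⟨g1, -, g3⟩ := ih T.tail _ (fun l => by rw [tabRow_tail]; exact hT _) h2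
    simp only [← tail_foldl, tabRow_tail] at g1 g3
    exact ⟨g1, by rwa [tabRow_foldl_zero], g3⟩

/-! ## The integer growth process -/

/-- The local rule of the growth process. -/
def localRule (ρ σ κ : ℕ → ℤ) (x : ℤ) : ℕ → ℤ
  | 0 => max (ρ 0) (σ 0) + x
  | l + 1 => max (ρ (l + 1)) (σ (l + 1)) + min (ρ l) (σ l) - κ l

/-- The growth process of an array of integers. -/
def growthZ (X : ℕ → ℕ → ℤ) : ℕ → ℕ → ℕ → ℤ
  | 0, _ => 0
  | _ + 1, 0 => 0
  | i + 1, j + 1 =>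
    localRule (growthZ X i (j + 1)) (growthZ X (i + 1) j) (growthZ X i j) (X i j)
  termination_by i j => (i, j)

@[simp] lemma growthZ_zero_left (X : ℕ → ℕ → ℤ) (j : ℕ) : growthZ X 0 j = 0 := by
  simp [growthZ]

@[simp] lemma growthZ_zero_right (X : ℕ → ℕ → ℤ) (i : ℕ) : growthZ X i 0 = 0 := by
  cases i <;> simp [growthZ]

lemma growthZ_succ (X : ℕ → ℕ → ℤ) (i j : ℕ) : growthZ X (i + 1) (j + 1)
    = localRule (growthZ X i (j + 1)) (growthZ X (i + 1) j) (growthZ X i j) (X i j) := by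
  rw [growthZ]

@[simp] lemma growth_zero_left (X : ℕ → ℕ → ℝ) (j l : ℕ) : growth X 0 j l = 0 := by
  simp [growth]

@[simp] lemma growth_zero_right (X : ℕ → ℕ → ℝ) (i l : ℕ) : growth X i 0 l = 0 := by
  cases i <;> simp [growth]

lemma growth_intCast (X : ℕ → ℕ → ℤ) (i j l : ℕ) :
    growth (fun i j => (X i j : ℝ)) i j l = (growthZ X i j l : ℝ) := by
  induction i generalizing j l with
  | zero => simp
  | succ i ihi =>
    induction j generalizing l with
    | zero => simp
    | succ j ihj =>
      rw [growthZ_succ]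
      cases l with
      | zero => simp [growth, localRule, ihi, ihj]
      | succ l => simp [growth, localRule, ihi, ihj]

/-- Extension by zero of a square array of natural numbers. -/
def extendZ {n : ℕ} (X : Fin n → Fin n → ℕ) (i j : ℕ) : ℤ :=
  if h : i < n ∧ j < n then (X ⟨i, h.1⟩ ⟨j, h.2⟩ : ℤ) else 0

lemma continuousShape_natCast {n : ℕ} (X : Fin n → Fin n → ℕ) (l : Fin n) :
    continuousShape (fun i j => (X i j : ℝ)) l = (growthZ (extendZ X) n n l : ℝ) := by
  rw [← growth_intCast, continuousShape]
  congr 1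
  funext i j
  unfold extendZ
  split_ifs <;> simp

/-- The letters contributed to `rskWord` by one row of the matrix. -/
def rowWord {n : ℕ} (v : Fin n → ℕ) : List (Fin n) :=
  (List.finRange n).flatMap fun j => List.replicate (v j) j

lemma pairwise_rowWord {n : ℕ} (v : Fin n → ℕ) : (rowWord v).Pairwise (· ≤ ·) := by
  unfold rowWord
  rw [List.pairwise_flatMap]
  refine ⟨fun j _ => by simp [List.pairwise_replicate], ?_⟩
  refine (List.pairwise_lt_finRange n).imp fun {a b} hab x hx y hy => ?_
  rw [List.mem_replicate] at hx hy
  rw [hx.2, hy.2]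
  exact hab.le

lemma cnt_rowWord {n : ℕ} (v : Fin n → ℕ) (k : ℕ) :
    cnt k (rowWord v) = ∑ j : Fin n, if (j : ℕ) < k then v j else 0 := by
  have : ∀ l : List (Fin n), cnt k (l.flatMap fun j => List.replicate (v j) j)
      = (l.map fun j : Fin n => if (j : ℕ) < k then v j else 0).sum := by
    intro l
    induction l with
    | nil => rfl
    | cons x l ih =>
      rw [List.flatMap_cons, cnt_append, ih, List.map_cons, List.sum_cons]
      congr 1
      simp [cnt, List.countP_replicate]
  rw [rowWord, this, Fin.sum_univ_def]

lemma cnt_rowWord_succ {n : ℕ} (X : Fin n → Fin n → ℕ) (i : Fin n) (k : ℕ) :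
    (cnt (k + 1) (rowWord (X i)) : ℤ) = cnt k (rowWord (X i)) + extendZ X i k := by
  rw [cnt_rowWord, cnt_rowWord, extendZ]
  split_ifs with h
  · push_cast
    rw [← sub_eq_iff_eq_add', ← Finset.sum_sub_distrib, Finset.sum_eq_single ⟨k, h.2⟩]
    · simp
    · intro b _ hb
      have : (b : ℕ) ≠ k := fun h => hb (Fin.ext h)
      split_ifs <;> omega
    · simp
  · have hk : n ≤ k := by
      by_contra hk
      exact h ⟨i.2, by omega⟩
    rw [add_zero]
    congr 1
    refine Finset.sum_congr rfl fun j _ => ?_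
    rw [if_pos (by omega), if_pos (by omega)]

/-- The tableau after the insertion of the first `i` rows of the matrix. -/
def partialTableau {n : ℕ} (X : Fin n → Fin n → ℕ) (i : ℕ) : List (List (Fin n)) :=
  (((List.finRange n).take i).flatMap fun i => rowWord (X i)).foldl tableauInsert []

lemma partialTableau_succ {n : ℕ} (X : Fin n → Fin n → ℕ) (i : Fin n) :
    partialTableau X (i + 1) = (rowWord (X i)).foldl tableauInsert (partialTableau X i) := by
  unfold partialTableau
  rw [List.take_add_one]
  simp [List.flatMap_append, List.foldl_append]

lemma pairwise_tabRow_partialTableau {n : ℕ} (X : Fin n → Fin n → ℕ) (i : ℕ) (hi : i ≤ n) (l : ℕ) :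
    (tabRow (partialTableau X i) l).Pairwise (· ≤ ·) := by
  induction i generalizing l with
  | zero => simp [partialTableau, tabRow]
  | succ i ih =>
    rw [partialTableau_succ X ⟨i, hi⟩]
    exact (tabRow_foldl_spec l _ _ (ih (by omega)) (pairwise_rowWord _)).1

lemma cnt_tabRow_partialTableau {n : ℕ} (X : Fin n → Fin n → ℕ) (i : ℕ) (hi : i ≤ n) (k l : ℕ) :
    (cnt k (tabRow (partialTableau X i) l) : ℤ) = growthZ (extendZ X) i k l := by
  induction i generalizing k l with
  | zero => simp [partialTableau, tabRow]
  | succ i ihi =>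
    have hT := pairwise_tabRow_partialTableau X i (by omega)
    induction k generalizing l with
    | zero => simp [cnt_zero]
    | succ k ihk =>
      have e := partialTableau_succ X ⟨i, hi⟩
      simp only at e
      rw [growthZ_succ]
      cases l with
      | zero =>
        have h := (tabRow_foldl_spec 0 _ _ hT (pairwise_rowWord (X ⟨i, hi⟩))).2.1 k
        have h' := cnt_rowWord_succ X ⟨i, hi⟩ k
        rw [← e] at h
        simp only [localRule, ← ihk, ← ihi (by omega)]
        simp only at h'
        omega
      | succ l =>
        have h := (tabRow_foldl_spec l _ _ hT (pairwise_rowWord (X ⟨i, hi⟩))).2.2 k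
        rw [← e] at h
        simp only [localRule, ← ihk, ← ihi (by omega)]
        omega

/-- The row lengths of the RSK tableau are given by the growth process. -/
theorem rskShape_eq_growthZ {n : ℕ} (X : Fin n → Fin n → ℕ) (k : ℕ) :
    (rskShape X k : ℤ) = growthZ (extendZ X) n n k := by
  rw [← cnt_tabRow_partialTableau X n le_rfl, cnt_eq_length]
  have : partialTableau X n = rskTableau X := by
    unfold partialTableau rskTableau rskWord
    rw [List.take_of_length_le (by simp)]
    rfl
  rw [this]
  rfl

/-! ## Interlacing and the inverse of the local rule -/

/-- `κ` interlaces with `μ`: `μ_{l+1} ≤ κ_l ≤ μ_l`. -/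
def Interl (κ μ : ℕ → ℤ) : Prop := ∀ l, κ l ≤ μ l ∧ μ (l + 1) ≤ κ l

/-- The lower left shape, recovered from the other three shapes around a cell. -/
def inverseRule (ρ σ ν : ℕ → ℤ) (l : ℕ) : ℤ :=
  max (ρ (l + 1)) (σ (l + 1)) + min (ρ l) (σ l) - ν (l + 1)

lemma localRule_comm (ρ σ κ : ℕ → ℤ) (x : ℤ) : localRule ρ σ κ x = localRule σ ρ κ x := by
  funext l
  cases l <;> simp [localRule, max_comm, min_comm]

lemma interl_localRule {ρ σ κ : ℕ → ℤ} {x : ℤ} (h1 : Interl κ ρ) (h2 : Interl κ σ) (hx : 0 ≤ x) :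
    Interl ρ (localRule ρ σ κ x) := by
  intro l
  have a1 := h1 l
  have a2 := h2 l
  cases l with
  | zero =>
    simp only [localRule]
    omega
  | succ l =>
    have b1 := h1 l
    have b2 := h2 l
    simp only [localRule]
    omega

lemma inverseRule_localRule (ρ σ κ : ℕ → ℤ) (x : ℤ) :
    inverseRule ρ σ (localRule ρ σ κ x) = κ := by
  funext l
  simp [inverseRule, localRule]

lemma localRule_inverseRule (ρ σ ν : ℕ → ℤ) :
    localRule ρ σ (inverseRule ρ σ ν) (ν 0 - max (ρ 0) (σ 0)) = ν := by
  funext l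
  cases l <;> simp [inverseRule, localRule]

lemma interl_inverseRule_left {ρ σ ν : ℕ → ℤ} (h1 : Interl ρ ν) (h2 : Interl σ ν) :
    Interl (inverseRule ρ σ ν) ρ := by
  intro l
  have a1 := h1 l
  have a2 := h2 l
  have b1 := h1 (l + 1)
  have b2 := h2 (l + 1)
  simp only [inverseRule]
  omega

lemma interl_inverseRule_right {ρ σ ν : ℕ → ℤ} (h1 : Interl ρ ν) (h2 : Interl σ ν) :
    Interl (inverseRule ρ σ ν) σ := by
  intro l
  have a1 := h1 l
  have a2 := h2 l
  have b1 := h1 (l + 1)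
  have b2 := h2 (l + 1)
  simp only [inverseRule]
  omega

/-! ## Properties of the growth process -/

lemma interl_growthZ_aux {X : ℕ → ℕ → ℤ} (hX : ∀ i j, 0 ≤ X i j) (i : ℕ)
    (h : ∀ j, Interl (growthZ X i j) (growthZ X i (j + 1))) (j : ℕ) :
    Interl (growthZ X i j) (growthZ X (i + 1) j) := by
  induction j with
  | zero => simp [Interl]
  | succ j ih =>
    rw [growthZ_succ]
    exact interl_localRule (h j) ih (hX i j)

lemma interl_growthZ_right {X : ℕ → ℕ → ℤ} (hX : ∀ i j, 0 ≤ X i j) (i j : ℕ) :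
    Interl (growthZ X i j) (growthZ X i (j + 1)) := by
  induction i generalizing j with
  | zero => simp [Interl]
  | succ i ih =>
    rw [growthZ_succ, localRule_comm]
    exact interl_localRule (interl_growthZ_aux hX i ih j) (ih j) (hX i j)

lemma interl_growthZ_left {X : ℕ → ℕ → ℤ} (hX : ∀ i j, 0 ≤ X i j) (i j : ℕ) :
    Interl (growthZ X i j) (growthZ X (i + 1) j) :=
  interl_growthZ_aux hX i (interl_growthZ_right hX i) j

lemma growthZ_symm {X : ℕ → ℕ → ℤ} (hX : ∀ i j, X i j = X j i) (i j : ℕ) :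
    growthZ X i j = growthZ X j i := by
  induction i generalizing j with
  | zero => simp
  | succ i ihi =>
    induction j with
    | zero => simp
    | succ j ihj =>
      rw [growthZ_succ, growthZ_succ, ihi (j + 1), ihj, ihi j, hX i j, localRule_comm]

lemma growthZ_congr {X Y : ℕ → ℕ → ℤ} {n m : ℕ} (h : ∀ i < n, ∀ j < m, X i j = Y i j) (i j : ℕ)
    (hi : i ≤ n) (hj : j ≤ m) : growthZ X i j = growthZ Y i j := by
  induction i generalizing j with
  | zero => simp
  | succ i ihi =>
    induction j with
    | zero => simp
    | succ j ihj =>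
      rw [growthZ_succ, growthZ_succ, ihi (j + 1) (by omega) hj, ihj (by omega),
        ihi j (by omega) (by omega), h i hi j hj]

/-- A sequence of successively interlacing shapes that starts with the empty shape. -/
def IsChain (n : ℕ) (c : ℕ → ℕ → ℤ) : Prop := c 0 = 0 ∧ ∀ i < n, Interl (c i) (c (i + 1))

lemma IsChain.nonneg {n : ℕ} {c : ℕ → ℕ → ℤ} (h : IsChain n c) (i : ℕ) (hi : i ≤ n) (l : ℕ) :
    0 ≤ c i l := by
  induction i with
  | zero => simp [h.1]
  | succ i ih => exact (ih (by omega)).trans (h.2 i hi l).1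

lemma IsChain.eq_zero {n : ℕ} {c : ℕ → ℕ → ℤ} (h : IsChain n c) (i : ℕ) (hi : i ≤ n) (l : ℕ)
    (hl : i ≤ l) : c i l = 0 := by
  induction i generalizing l with
  | zero => simp [h.1]
  | succ i ih =>
    obtain ⟨l, rfl⟩ : ∃ m, l = m + 1 := ⟨l - 1, by omega⟩
    have h1 := (h.2 i hi l).2
    rw [ih (by omega) l (by omega)] at h1
    exact le_antisymm h1 (h.nonneg _ hi _)

lemma IsChain.antitone {n : ℕ} {c : ℕ → ℕ → ℤ} (h : IsChain n c) (i : ℕ) (hi : i ≤ n) :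
    Antitone (c i) := by
  refine antitone_nat_of_succ_le fun l => ?_
  rcases i with _ | i
  · simp [h.1]
  · exact (h.2 i hi l).2.trans (h.2 i hi l).1

lemma isChain_growthZ {X : ℕ → ℕ → ℤ} (hX : ∀ i j, 0 ≤ X i j) (n m : ℕ) :
    IsChain m fun i => growthZ X i n :=
  ⟨by simp, fun i _ => interl_growthZ_left hX i n⟩

lemma sum_localRule (ρ σ κ : ℕ → ℤ) (x : ℤ) (N : ℕ) :
    ∑ l ∈ Finset.range (N + 1), localRule ρ σ κ x l + ∑ l ∈ Finset.range N, κ l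
      = x + ∑ l ∈ Finset.range N, ρ l + ∑ l ∈ Finset.range N, σ l + max (ρ N) (σ N) := by
  induction N with
  | zero =>
    simp [localRule]
    ring
  | succ N ih =>
    rw [Finset.sum_range_succ _ (N + 1), Finset.sum_range_succ κ N, Finset.sum_range_succ ρ N,
      Finset.sum_range_succ σ N]
    have h1 := max_add_min (ρ N) (σ N)
    have h2 : localRule ρ σ κ x (N + 1) = max (ρ (N + 1)) (σ (N + 1)) + min (ρ N) (σ N) - κ N := rfl
    linarith

lemma sum_growthZ {X : ℕ → ℕ → ℤ} (hX : ∀ i j, 0 ≤ X i j) (i j N : ℕ) (hN : i ≤ N) :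
    ∑ l ∈ Finset.range N, growthZ X i j l
      = ∑ i' ∈ Finset.range i, ∑ j' ∈ Finset.range j, X i' j' := by
  induction i generalizing j N with
  | zero => simp
  | succ i ihi =>
    induction j with
    | zero => simp
    | succ j ihj =>
      obtain ⟨N, rfl⟩ : ∃ m, N = m + 1 := ⟨N - 1, by omega⟩
      have h := sum_localRule (growthZ X i (j + 1)) (growthZ X (i + 1) j) (growthZ X i j) (X i j) N
      rw [← growthZ_succ] at h
      have h1 := ihi (j + 1) N (by omega)
      have h2 := ihi j N (by omega)
      rw [Finset.sum_range_succ] at ihj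
      have h3 := (isChain_growthZ hX (j + 1) i).eq_zero i le_rfl N (by omega)
      have h4 := (isChain_growthZ hX j (i + 1)).nonneg (i + 1) le_rfl N
      rw [h3, max_eq_right h4] at h
      rw [Finset.sum_range_succ] at ihj
      rw [Finset.sum_range_succ _ i, Finset.sum_range_succ (fun j' => X i j')]
      linarith

lemma alternating_sum_localRule (ρ κ : ℕ → ℤ) (x : ℤ) (N : ℕ) :
    ∑ l ∈ Finset.range (N + 1), (-1) ^ l * localRule ρ ρ κ x l
      = x + ∑ l ∈ Finset.range N, (-1) ^ l * κ l + (-1) ^ N * ρ N := by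
  induction N with
  | zero =>
    simp [localRule]
    ring
  | succ N ih =>
    rw [Finset.sum_range_succ _ (N + 1), ih, Finset.sum_range_succ _ N]
    simp only [localRule, max_self, min_self]
    ring

lemma alternating_sum_growthZ {X : ℕ → ℕ → ℤ} (hX : ∀ i j, 0 ≤ X i j) (hs : ∀ i j, X i j = X j i)
    (i N : ℕ) (hN : i ≤ N) :
    ∑ l ∈ Finset.range N, (-1) ^ l * growthZ X i i l = ∑ i' ∈ Finset.range i, X i' i' := by
  induction i generalizing N with
  | zero => simp
  | succ i ih =>
    obtain ⟨N, rfl⟩ : ∃ m, N = m + 1 := ⟨N - 1, by omega⟩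
    have h3 := (isChain_growthZ hX (i + 1) i).eq_zero i le_rfl N (by omega)
    rw [growthZ_succ, growthZ_symm hs (i + 1) i, alternating_sum_localRule, ih N (by omega), h3,
      Finset.sum_range_succ]
    ring

/-! ## Symmetric matrices and chains -/

lemma exists_column (m : ℕ) : ∀ (ν : ℕ → ℕ → ℤ) (σ : ℕ → ℤ), IsChain m ν → Interl σ (ν m) →
    ∃ (τ : ℕ → ℕ → ℤ) (x : ℕ → ℤ), IsChain m τ ∧ τ m = σ ∧ (∀ i, 0 ≤ x i) ∧
      ∀ i < m, ν (i + 1) = localRule (ν i) (τ (i + 1)) (τ i) (x i) := by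
  induction m with
  | zero =>
    intro ν σ hν hσ
    refine ⟨0, 0, ⟨rfl, by simp⟩, ?_, by simp, by simp⟩
    funext l
    have := hσ l
    simp only [hν.1, Pi.zero_apply] at this ⊢
    omega
  | succ m ih =>
    intro ν σ hν hσ
    have hm : Interl (ν m) (ν (m + 1)) := hν.2 m (by omega)
    obtain ⟨τ, x, h1, h2, h3, h4⟩ := ih ν (inverseRule (ν m) σ (ν (m + 1)))
      ⟨hν.1, fun i hi => hν.2 i (by omega)⟩ (interl_inverseRule_left hm hσ)
    refine ⟨fun i => if i ≤ m then τ i else σ,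
      fun i => if i < m then x i else ν (m + 1) 0 - max (ν m 0) (σ 0),
      ⟨by simpa using h1.1, fun i hi => ?_⟩, by simp, fun i => ?_, fun i hi => ?_⟩
    · rcases Nat.lt_succ_iff_lt_or_eq.1 hi with h | rfl
      · simp only [h.le, Nat.succ_le_of_lt h, if_true]
        exact h1.2 i h
      · simp only [le_refl, if_true, if_neg (show ¬ i + 1 ≤ i by omega), h2]
        exact interl_inverseRule_right hm hσ
    · have a1 := (hm 0).1
      have a2 := (hσ 0).1
      simp only
      split_ifs
      · exact h3 i
      · omega
    · rcases Nat.lt_succ_iff_lt_or_eq.1 hi with h | rfl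
      · simp only [h.le, h, Nat.succ_le_of_lt h, if_true]
        exact h4 i h
      · simp only [le_refl, lt_irrefl, if_true, if_false, if_neg (show ¬ i + 1 ≤ i by omega), h2]
        exact (localRule_inverseRule _ _ _).symm

lemma exists_symm_of_isChain (n : ℕ) : ∀ c : ℕ → ℕ → ℤ, IsChain n c →
    ∃ X : ℕ → ℕ → ℤ, (∀ i j, 0 ≤ X i j) ∧ (∀ i j, X i j = X j i) ∧
      ∀ i ≤ n, growthZ X i n = c i := by
  induction n with
  | zero =>
    intro c hc
    refine ⟨0, by simp, by simp, fun i hi => ?_⟩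
    obtain rfl : i = 0 := by omega
    simp [hc.1]
  | succ n ih =>
    intro c hc
    have hn : Interl (c n) (c (n + 1)) := hc.2 n (by omega)
    obtain ⟨τ, x, h1, h2, h3, h4⟩ := exists_column n c (inverseRule (c n) (c n) (c (n + 1)))
      ⟨hc.1, fun i hi => hc.2 i (by omega)⟩ (interl_inverseRule_left hn hn)
    obtain ⟨X, g1, g2, g3⟩ := ih τ h1
    let Y : ℕ → ℕ → ℤ := fun i j =>
      if i < n then (if j < n then X i j else x i)
      else if j < n then x j else c (n + 1) 0 - max (c n 0) (c n 0)
    have Ys : ∀ i j, Y i j = Y j i := by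
      intro i j
      simp only [Y]
      split_ifs <;> first | exact g2 i j | rfl
    have Yn : ∀ i ≤ n, growthZ Y i n = τ i := fun i hi => by
      rw [← g3 i hi]
      exact growthZ_congr (fun a ha b hb => by simp [Y, ha, hb]) i n hi le_rfl
    have Yc : ∀ i ≤ n, growthZ Y i (n + 1) = c i := by
      intro i hi
      induction i with
      | zero => simp [hc.1]
      | succ i ihi =>
        rw [growthZ_succ, ihi (by omega), Yn _ hi, Yn _ (by omega), h4 i hi]
        congr 1
        simp [Y, show i < n from hi]
    refine ⟨Y, fun i j => ?_, Ys, fun i hi => ?_⟩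
    · have := (hn 0).1
      simp only [Y]
      split_ifs
      exacts [g1 i j, h3 i, h3 j, by omega]
    · rcases Nat.le_succ_iff.1 hi with h | rfl
      · exact Yc i h
      · rw [growthZ_succ, growthZ_symm Ys (n + 1) n, Yc n le_rfl, Yn n le_rfl, h2]
        simp only [Y, lt_irrefl, if_false]
        exact localRule_inverseRule _ _ _

lemma eq_of_growthZ_eq (n : ℕ) : ∀ X Y : ℕ → ℕ → ℤ, (∀ i j, X i j = X j i) →
    (∀ i j, Y i j = Y j i) → (∀ i ≤ n, growthZ X i n = growthZ Y i n) →
    ∀ i < n, ∀ j < n, X i j = Y i j := by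
  induction n with
  | zero => intro X Y _ _ _ i hi; omega
  | succ n ih =>
    intro X Y hX hY h
    have inv : ∀ (Z : ℕ → ℕ → ℤ) (i j : ℕ), growthZ Z i j
        = inverseRule (growthZ Z i (j + 1)) (growthZ Z (i + 1) j) (growthZ Z (i + 1) (j + 1)) := by
      intro Z i j
      rw [growthZ_succ, inverseRule_localRule]
    have entry : ∀ (Z : ℕ → ℕ → ℤ) (i j : ℕ), Z i j
        = growthZ Z (i + 1) (j + 1) 0 - max (growthZ Z i (j + 1) 0) (growthZ Z (i + 1) j 0) := by
      intro Z i j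
      rw [growthZ_succ]
      simp [localRule]
    have hlow : growthZ X (n + 1) n = growthZ Y (n + 1) n := by
      rw [growthZ_symm hX, growthZ_symm hY, h n (by omega)]
    have hcol : ∀ k ≤ n, growthZ X (n - k) n = growthZ Y (n - k) n := by
      intro k hk
      induction k with
      | zero =>
        rw [Nat.sub_zero, inv X, inv Y, hlow, h n (by omega), h (n + 1) le_rfl]
      | succ k ihk =>
        have e : n - (k + 1) + 1 = n - k := by omega
        rw [inv X, inv Y, e, ihk (by omega), h _ (by omega), h _ (by omega)]
    have hcol' : ∀ i ≤ n, growthZ X i n = growthZ Y i n := fun i hi => by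
      have := hcol (n - i) (by omega)
      rwa [Nat.sub_sub_self hi] at this
    have hlast : ∀ i ≤ n, X i n = Y i n := fun i hi => by
      rw [entry X, entry Y, h (i + 1) (by omega), h i (by omega)]
      rcases hi.lt_or_eq with hi | rfl
      · rw [hcol' (i + 1) hi]
      · rw [hlow]
    intro i hi j hj
    rcases Nat.lt_succ_iff_lt_or_eq.1 hj with hj | rfl
    · rcases Nat.lt_succ_iff_lt_or_eq.1 hi with hi | rfl
      · exact ih X Y hX hY hcol' i hi j hj
      · rw [hX, hY, hlast j hj.le]
    · exact hlast i (by omega)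

/-- Symmetric matrices of natural numbers. -/
abbrev SymMat (n : ℕ) : Type := {M : Fin n → Fin n → ℕ // ∀ i j, M i j = M j i}

/-- Chains of interlacing shapes of length `n`. -/
abbrev Chain (n : ℕ) : Type :=
  {c : Fin (n + 1) → ℕ → ℤ // c 0 = 0 ∧ ∀ i : Fin n, Interl (c i.castSucc) (c i.succ)}

/-- The extension of a chain, constant after the last shape. -/
def Chain.extend {n : ℕ} (c : Chain n) (i : ℕ) : ℕ → ℤ := c.1 (Fin.ofNat (n + 1) i)

lemma Chain.extend_apply {n : ℕ} (c : Chain n) (i : Fin (n + 1)) : c.extend i = c.1 i := by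
  simp [Chain.extend]

lemma Chain.isChain {n : ℕ} (c : Chain n) : IsChain n c.extend := by
  refine ⟨?_, fun i hi => ?_⟩
  · have := c.extend_apply 0
    simpa [c.2.1] using this
  · have h := c.2.2 ⟨i, hi⟩
    rw [← c.extend_apply, ← c.extend_apply] at h
    exact h

lemma extendZ_nonneg {n : ℕ} (M : Fin n → Fin n → ℕ) (i j : ℕ) : 0 ≤ extendZ M i j := by
  unfold extendZ
  split_ifs <;> simp

lemma extendZ_symm {n : ℕ} (M : SymMat n) (i j : ℕ) : extendZ M.1 i j = extendZ M.1 j i := by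
  unfold extendZ
  by_cases h : i < n ∧ j < n
  · rw [dif_pos h, dif_pos h.symm, M.2]
  · rw [dif_neg h, dif_neg fun h' => h h'.symm]

@[simp] lemma extendZ_apply {n : ℕ} (M : Fin n → Fin n → ℕ) (i j : Fin n) :
    extendZ M i j = M i j := by
  simp [extendZ]

/-- The chain of shapes along the last column of the growth diagram of a symmetric matrix. -/
def SymMat.chain {n : ℕ} (M : SymMat n) : Chain n :=
  ⟨fun i => growthZ (extendZ M.1) i n, by simp,
    fun i => interl_growthZ_left (extendZ_nonneg M.1) i n⟩

lemma bijective_chain (n : ℕ) : Function.Bijective (SymMat.chain (n := n)) := by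
  constructor
  · intro M M' h
    have h' := congrArg Subtype.val h
    have := eq_of_growthZ_eq n _ _ (extendZ_symm M) (extendZ_symm M') fun i hi =>
      congrFun h' ⟨i, by omega⟩
    refine Subtype.ext (funext fun i => funext fun j => ?_)
    have := this i i.2 j j.2
    rw [extendZ_apply, extendZ_apply] at this
    exact_mod_cast this
  · intro c
    obtain ⟨X, h1, h2, h3⟩ := exists_symm_of_isChain n _ c.isChain
    refine ⟨⟨fun i j => (X i j).toNat, fun i j => congrArg Int.toNat (h2 i j)⟩, Subtype.ext (funext fun i => ?_)⟩
    rw [← c.extend_apply, ← h3 i (by omega)]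
    refine growthZ_congr (n := n) (m := n) (fun a ha b hb => ?_) i n (by omega) le_rfl
    simp [extendZ, ha, hb, h1]

/-! ## Summation over chains -/

open scoped Classical in
/-- Sum over the chains of length `n` with last shape `μ` of the product of `u ^ |κ|` over all
shapes `κ` of the chain but the last. -/
noncomputable def chainSum (n : ℕ) (u : ℝ) (μ : ℕ → ℤ) : ENNReal :=
  ∑' c : Chain n, if c.1 (Fin.last n) = μ then
    ∏ i : Fin n, ENNReal.ofReal (u ^ (∑ l ∈ Finset.range i, c.1 i.castSucc l)) else 0

/-- A chain is a shorter chain together with its last shape. -/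
def chainSuccEquiv (n : ℕ) :
    Chain (n + 1) ≃ {p : (ℕ → ℤ) × Chain n // Interl (p.2.1 (Fin.last n)) p.1} where
  toFun c := ⟨(c.1 (Fin.last _), ⟨fun i => c.1 i.castSucc, c.2.1, fun i => c.2.2 i.castSucc⟩),
    c.2.2 (Fin.last n)⟩
  invFun p := ⟨Fin.snoc (α := fun _ => ℕ → ℤ) p.1.2.1 p.1.1, by
    refine ⟨?_, fun i => ?_⟩
    · change Fin.snoc (α := fun _ => ℕ → ℤ) p.1.2.1 p.1.1 (Fin.castSucc (0 : Fin (n + 1))) = 0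
      rw [Fin.snoc_castSucc]
      exact p.1.2.2.1
    · refine Fin.lastCases ?_ (fun i => ?_) i
      · rw [Fin.snoc_castSucc, Fin.succ_last, Fin.snoc_last]
        exact p.2
      · rw [Fin.snoc_castSucc, ← Fin.castSucc_succ, Fin.snoc_castSucc]
        exact p.1.2.2.2 i⟩
  left_inv c := Subtype.ext (funext fun i => by
    refine Fin.lastCases ?_ (fun i => ?_) i <;> simp)
  right_inv p := by
    refine Subtype.ext (Prod.ext ?_ (Subtype.ext (funext fun i => ?_))) <;> simp

open scoped Classical in
lemma chainSum_succ (n : ℕ) (u : ℝ) (μ : ℕ → ℤ) :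
    chainSum (n + 1) u μ = ∑' κ : ℕ → ℤ, if Interl κ μ then
      ENNReal.ofReal (u ^ (∑ l ∈ Finset.range n, κ l)) * chainSum n u κ else 0 := by
  let F : Chain n → ENNReal := fun c => (∏ i : Fin n,
    ENNReal.ofReal (u ^ (∑ l ∈ Finset.range i, c.1 i.castSucc l)))
      * ENNReal.ofReal (u ^ (∑ l ∈ Finset.range n, c.1 (Fin.last n) l))
  have h1 : chainSum (n + 1) u μ
      = ∑' c : Chain n, if Interl (c.1 (Fin.last n)) μ then F c else 0 := by
    calc chainSum (n + 1) u μ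
        = ∑' p : {p : (ℕ → ℤ) × Chain n // Interl (p.2.1 (Fin.last n)) p.1},
            (if p.1.1 = μ then F p.1.2 else 0) := by
          rw [chainSum, ← (chainSuccEquiv n).tsum_eq]
          refine tsum_congr fun c => ?_
          simp only [chainSuccEquiv, Equiv.coe_fn_mk, F, Fin.prod_univ_castSucc]
          rfl
      _ = ∑' p : (ℕ → ℤ) × Chain n, if Interl (p.2.1 (Fin.last n)) p.1 then
            (if p.1 = μ then F p.2 else 0) else 0 := by
          refine (tsum_subtype {p : (ℕ → ℤ) × Chain n | Interl (p.2.1 (Fin.last n)) p.1}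
            (fun p => if p.1 = μ then F p.2 else 0)).trans (tsum_congr fun p => ?_)
          simp [Set.indicator_apply]
      _ = _ := by
          rw [ENNReal.tsum_prod (f := fun ν (c : Chain n) => if Interl (c.1 (Fin.last n)) ν then
            (if ν = μ then F c else 0) else 0), tsum_eq_single μ]
          · simp
          · intro ν hν
            simp [hν]
  rw [h1]
  have h2 : ∀ κ : ℕ → ℤ, (if Interl κ μ then
      ENNReal.ofReal (u ^ (∑ l ∈ Finset.range n, κ l)) * chainSum n u κ else 0)
      = ∑' c : Chain n, if c.1 (Fin.last n) = κ then (if Interl κ μ then F c else 0) else 0 := by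
    intro κ
    split_ifs with h
    · rw [chainSum, ← ENNReal.tsum_mul_left]
      refine tsum_congr fun c => ?_
      split_ifs with h'
      · rw [← h', mul_comm]
      · simp
    · simp
  simp_rw [h2]
  rw [ENNReal.tsum_comm]
  refine tsum_congr fun c => ?_
  rw [tsum_eq_single (c.1 (Fin.last n))]
  · simp
  · intro κ hκ
    rw [if_neg (Ne.symm hκ)]

/-- Partitions with at most `n` parts. -/
def IsPart (n : ℕ) (μ : ℕ → ℤ) : Prop := Antitone μ ∧ ∀ l, n ≤ l → μ l = 0

lemma IsPart.nonneg {n : ℕ} {μ : ℕ → ℤ} (h : IsPart n μ) (l : ℕ) : 0 ≤ μ l := by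
  rw [← h.2 (max n l) (le_max_left _ _)]
  exact h.1 (le_max_right _ _)

lemma Chain.isPart_last {n : ℕ} (c : Chain n) : IsPart n (c.1 (Fin.last n)) := by
  rw [← c.extend_apply]
  exact ⟨c.isChain.antitone n le_rfl, fun l hl => c.isChain.eq_zero n le_rfl l hl⟩

lemma chainSum_eq_zero {n : ℕ} {u : ℝ} {μ : ℕ → ℤ} (h : ¬ IsPart n μ) : chainSum n u μ = 0 := by
  rw [chainSum, ENNReal.tsum_eq_zero]
  intro c
  rw [if_neg]
  rintro rfl
  exact h c.isPart_last

/-- Extension of a vector by zero. -/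
def extendVec {n : ℕ} (k : Fin n → ℤ) (l : ℕ) : ℤ := if h : l < n then k ⟨l, h⟩ else 0

@[simp] lemma extendVec_apply {n : ℕ} (k : Fin n → ℤ) (i : Fin n) : extendVec k i = k i := by
  simp [extendVec]

lemma sum_range_extendVec {n : ℕ} (k : Fin n → ℤ) :
    ∑ l ∈ Finset.range n, extendVec k l = ∑ i, k i := by
  rw [← Fin.sum_univ_eq_sum_range]
  simp

/-- The recursive form of `chainSum`. -/
noncomputable def gtSum (u : ℝ) : ℕ → (ℕ → ℤ) → ℝ
  | 0, _ => 1
  | n + 1, μ => ∑ k ∈ Fintype.piFinset fun i : Fin n => Finset.Icc (μ (i + 1)) (μ i),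
      u ^ (∑ i, k i) * gtSum u n (extendVec k)

lemma gtSum_nonneg {u : ℝ} (hu : 0 < u) (n : ℕ) (μ : ℕ → ℤ) : 0 ≤ gtSum u n μ := by
  induction n generalizing μ with
  | zero => simp [gtSum]
  | succ n ih =>
    rw [gtSum]
    exact Finset.sum_nonneg fun k _ => mul_nonneg (zpow_nonneg hu.le _) (ih _)

lemma interl_extendVec {n : ℕ} {μ : ℕ → ℤ} (hμ : IsPart (n + 1) μ) {k : Fin n → ℤ}
    (hk : ∀ i : Fin n, μ (i + 1) ≤ k i ∧ k i ≤ μ i) : Interl (extendVec k) μ := by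
  intro l
  unfold extendVec
  split_ifs with h
  · exact (hk ⟨l, h⟩).symm
  · rw [hμ.2 (l + 1) (by omega)]
    exact ⟨hμ.nonneg l, le_rfl⟩

lemma isPart_extendVec {n : ℕ} {μ : ℕ → ℤ} (hμ : IsPart (n + 1) μ) {k : Fin n → ℤ}
    (hk : ∀ i : Fin n, μ (i + 1) ≤ k i ∧ k i ≤ μ i) : IsPart n (extendVec k) := by
  have h := interl_extendVec hμ hk
  refine ⟨antitone_nat_of_succ_le fun l => ((h (l + 1)).1).trans (h l).2, fun l hl => ?_⟩
  rw [extendVec, dif_neg (by omega)]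

lemma chainSum_eq_gtSum {u : ℝ} (hu : 0 < u) (n : ℕ) (μ : ℕ → ℤ) (hμ : IsPart n μ) :
    chainSum n u μ = ENNReal.ofReal (gtSum u n μ) := by
  classical
  induction n generalizing μ with
  | zero =>
    have hμ0 : μ = 0 := funext fun l => hμ.2 l (by omega)
    rw [chainSum, tsum_eq_single ⟨0, rfl, fun i => i.elim0⟩]
    · simp [hμ0, gtSum]
    · intro c hc
      refine absurd (Subtype.ext (funext fun i => ?_)) hc
      rw [Fin.fin_one_eq_zero i, c.2.1]
      rfl
  | succ n ih =>
    have hinj : Function.Injective (extendVec (n := n)) := fun k k' h => funext fun i => by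
      simpa using congrFun h i
    rw [chainSum_succ, tsum_eq_sum (s := (Fintype.piFinset fun i : Fin n =>
      Finset.Icc (μ (i + 1)) (μ i)).image extendVec), Finset.sum_image fun a _ b _ h => hinj h, gtSum,
      ENNReal.ofReal_sum_of_nonneg fun k _ => mul_nonneg (zpow_nonneg hu.le _) (gtSum_nonneg hu _ _)]
    · refine Finset.sum_congr rfl fun k hk => ?_
      simp only [Fintype.mem_piFinset, Finset.mem_Icc] at hk
      rw [if_pos (interl_extendVec hμ hk), sum_range_extendVec, ih _ (isPart_extendVec hμ hk),
        ENNReal.ofReal_mul (zpow_nonneg hu.le _)]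
    · intro κ hκ
      split_ifs with h
      · rw [chainSum_eq_zero, mul_zero]
        intro hp
        refine hκ (Finset.mem_image.2 ⟨fun i => κ i, ?_, funext fun l => ?_⟩)
        · simp only [Fintype.mem_piFinset, Finset.mem_Icc]
          exact fun i => (h i).symm
        · unfold extendVec
          split_ifs with hl
          · rfl
          · exact (hp.2 l (by omega)).symm
      · rfl

/-! ## The product formula -/

lemma det_pow_succ_sub {R : Type*} [CommRing R] (n : ℕ) (y : Fin (n + 1) → R) :
    Matrix.det (Matrix.of fun i j : Fin n =>
      y i.succ ^ ((j : ℕ) + 1) - y i.castSucc ^ ((j : ℕ) + 1)) = (Matrix.vandermonde y).det := by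
  rw [Matrix.det_eq_of_forall_row_eq_smul_add_pred (A := Matrix.vandermonde y)
    (B := Matrix.of (Fin.cons (fun j : Fin (n + 1) => y 0 ^ (j : ℕ)) fun (i : Fin n) j =>
      y i.succ ^ (j : ℕ) - y i.castSucc ^ (j : ℕ))) (fun _ => 1) (by simp [Matrix.vandermonde])
      (by simp [Matrix.vandermonde]), Matrix.det_succ_column_zero, Fin.sum_univ_succ]
  simp only [Matrix.of_apply, Fin.cons_succ, Fin.val_zero, pow_zero, sub_self, mul_zero, zero_mul,
    Finset.sum_const_zero, add_zero, Fin.cons_zero, one_mul]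
  congr 1

lemma sum_Icc_zpow {v : ℝ} (hv : v ≠ 0) (hv1 : v ≠ 1) (a b : ℤ) (hab : a ≤ b + 1) :
    ∑ k ∈ Finset.Icc a b, v ^ k = (v ^ (b + 1) - v ^ a) / (v - 1) := by
  obtain ⟨m, hm⟩ := Int.eq_ofNat_of_zero_le (sub_nonneg.2 hab)
  have h1 : v - 1 ≠ 0 := sub_ne_zero.2 hv1
  induction m generalizing b with
  | zero =>
    have : b + 1 = a := by simpa [sub_eq_zero] using hm
    rw [Finset.Icc_eq_empty (by omega), this]
    simp
  | succ m ih =>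
    have e : Finset.Icc a b = insert b (Finset.Icc a (b - 1)) := by
      ext x
      simp only [Finset.mem_Icc, Finset.mem_insert]
      push_cast at hm
      omega
    rw [e, Finset.sum_insert (by simp), ih (b - 1) (by push_cast at hm; omega)
      (by push_cast at hm ⊢; omega), sub_add_cancel, zpow_add₀ hv]
    field_simp
    ring

lemma gtSum_succ_eq {u : ℝ} (hu : 0 < u) (hu1 : u ≠ 1) (n : ℕ) (K : ℝ)
    (hK : ∀ κ : ℕ → ℤ, IsPart n κ → gtSum u n κ = K *
      (Matrix.vandermonde fun i : Fin n => u ^ (κ i + (n - 1 - (i : ℕ) : ℤ))).det)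
    (μ : ℕ → ℤ) (hμ : IsPart (n + 1) μ) :
    gtSum u (n + 1) μ = K * (u ^ (∑ i ∈ Finset.range n, i))⁻¹
      * (∏ p ∈ Finset.Icc 1 n, (1 - u ^ p))⁻¹ *
      (Matrix.vandermonde fun i : Fin (n + 1) => u ^ (μ i + (n - (i : ℕ) : ℤ))).det := by
  have hup : ∀ p : ℕ, 1 ≤ p → u ^ p ≠ 1 := fun p hp h =>
    hu1 ((pow_eq_one_iff_of_nonneg hu.le (by omega)).1 h)
  have hpow : ∏ i : Fin n, u ^ ((n - 1 - (i : ℕ) : ℤ)) = u ^ (∑ i ∈ Finset.range n, i) := by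
    rw [Fin.prod_univ_eq_prod_range (fun i => u ^ ((n - 1 - (i : ℕ) : ℤ))) n,
      ← Finset.prod_range_reflect, ← Finset.prod_pow_eq_pow_sum]
    refine Finset.prod_congr rfl fun i hi => ?_
    rw [Finset.mem_range] at hi
    rw [← zpow_natCast]
    congr 1
    omega
  set y : Fin (n + 1) → ℝ := fun i => u ^ (μ i + (n - (i : ℕ) : ℤ)) with hy
  have hterm : ∀ k : Fin n → ℤ, u ^ (∑ i, k i) *
      (Matrix.vandermonde fun i : Fin n => u ^ (k i + (n - 1 - (i : ℕ) : ℤ))).det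
      = (u ^ (∑ i ∈ Finset.range n, i))⁻¹ * Matrix.det (Matrix.of fun i j : Fin n =>
        (u ^ ((j : ℕ) + 1)) ^ (k i + (n - 1 - (i : ℕ) : ℤ))) := by
    intro k
    have h1 : u ^ (∑ i, k i) = (u ^ (∑ i ∈ Finset.range n, i))⁻¹
        * ∏ i : Fin n, u ^ (k i + (n - 1 - (i : ℕ) : ℤ)) := by
      have h2 : ∏ i : Fin n, u ^ (k i) = u ^ (∑ i, k i) := by
        classical
        induction (Finset.univ : Finset (Fin n)) using Finset.induction_on with
        | empty => simp
        | insert a s ha ih => rw [Finset.prod_insert ha, Finset.sum_insert ha, zpow_add₀ hu.ne', ih]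
      simp_rw [zpow_add₀ hu.ne' (k _)]
      rw [Finset.prod_mul_distrib, hpow, h2]
      field_simp
    rw [h1, mul_assoc, ← Matrix.det_mul_column]
    congr 2
    ext i j
    simp only [Matrix.of_apply, Matrix.vandermonde_apply]
    rw [← pow_succ', ← zpow_natCast, ← zpow_natCast u, ← zpow_mul, ← zpow_mul, mul_comm]
  have hsum : gtSum u (n + 1) μ = K * (u ^ (∑ i ∈ Finset.range n, i))⁻¹ *
      ∑ k ∈ Fintype.piFinset fun i : Fin n => Finset.Icc (μ (i + 1)) (μ i),
        Matrix.det (Matrix.of fun i j : Fin n =>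
          (u ^ ((j : ℕ) + 1)) ^ (k i + (n - 1 - (i : ℕ) : ℤ))) := by
    rw [gtSum, Finset.mul_sum]
    refine Finset.sum_congr rfl fun k hk => ?_
    simp only [Fintype.mem_piFinset, Finset.mem_Icc] at hk
    rw [hK _ (isPart_extendVec hμ hk), mul_left_comm]
    simp only [extendVec_apply]
    rw [hterm]
    ring
  have hdet : ∑ k ∈ Fintype.piFinset fun i : Fin n => Finset.Icc (μ (i + 1)) (μ i),
        Matrix.det (Matrix.of fun i j : Fin n =>
          (u ^ ((j : ℕ) + 1)) ^ (k i + (n - 1 - (i : ℕ) : ℤ)))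
      = Matrix.det (Matrix.of fun i j : Fin n => (u ^ ((j : ℕ) + 1) - 1)⁻¹ *
        (y i.castSucc ^ ((j : ℕ) + 1) - y i.succ ^ ((j : ℕ) + 1))) := by
    have h := (Matrix.detRowAlternating (R := ℝ) (n := Fin n)).toMultilinearMap.map_sum_finset
      (fun (i : Fin n) (k : ℤ) (j : Fin n) => (u ^ ((j : ℕ) + 1)) ^ (k + (n - 1 - (i : ℕ) : ℤ)))
      (fun i : Fin n => Finset.Icc (μ (i + 1)) (μ i))
    refine Eq.trans h.symm ?_
    change Matrix.det _ = _
    congr 1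
    ext i j
    have hne : u ^ ((j : ℕ) + 1) ≠ 0 := (pow_pos hu _).ne'
    have e1 := hμ.1 (Nat.le_succ (i : ℕ))
    simp only [Finset.sum_apply, Matrix.of_apply, zpow_add₀ hne]
    rw [← Finset.sum_mul, sum_Icc_zpow hne (hup _ (by omega)) _ _ (by
      simp only [Nat.succ_eq_add_one] at e1; omega)]
    have e2 : ∀ i : Fin (n + 1), y i ^ ((j : ℕ) + 1)
        = (u ^ ((j : ℕ) + 1)) ^ (μ i + (n - (i : ℕ) : ℤ)) := fun i => by
      rw [hy, ← zpow_natCast, ← zpow_natCast u, ← zpow_mul, ← zpow_mul, mul_comm]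
    rw [e2, e2, div_eq_inv_mul, mul_assoc, sub_mul, ← zpow_add₀ hne, ← zpow_add₀ hne]
    simp only [Fin.val_castSucc, Fin.val_succ]
    have a1 : μ i + 1 + (n - 1 - (i : ℕ) : ℤ) = μ i + (n - (i : ℕ) : ℤ) := by ring
    have a2 : μ (i + 1) + (n - 1 - (i : ℕ) : ℤ) = μ (i + 1) + (n - ((i + 1 : ℕ) : ℤ)) := by
      push_cast
      ring
    rw [a1, a2]
  have hneg : Matrix.det (Matrix.of fun i j : Fin n => (u ^ ((j : ℕ) + 1) - 1)⁻¹ *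
        (y i.castSucc ^ ((j : ℕ) + 1) - y i.succ ^ ((j : ℕ) + 1)))
      = (∏ p ∈ Finset.Icc 1 n, (1 - u ^ p))⁻¹ * (Matrix.vandermonde y).det := by
    rw [← det_pow_succ_sub, ← Finset.prod_inv_distrib, ← Finset.Ico_add_one_right_eq_Icc,
      Finset.prod_Ico_eq_prod_range, Nat.add_sub_cancel, ← Fin.prod_univ_eq_prod_range
        (fun p => (1 - u ^ (1 + p))⁻¹), ← Matrix.det_mul_row]
    congr 1
    ext i j
    simp only [Matrix.of_apply]
    rw [add_comm 1 (j : ℕ), ← neg_sub (u ^ _) 1, inv_neg]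
    ring
  rw [hsum, hdet, hneg]
  ring

lemma qPoch_ne_zero {t : ℝ} (ht : 0 < t) (ht1 : t ≠ 1) (l : ℕ) : qPoch t l ≠ 0 := by
  refine Finset.prod_ne_zero_iff.2 fun m hm => ?_
  rw [Finset.mem_Icc] at hm
  exact sub_ne_zero.2 fun h => ht1 ((pow_eq_one_iff_of_nonneg ht.le (by omega)).1 h.symm)

lemma gtSum_eq {t : ℝ} (ht : 0 < t) (ht1 : t ≠ 1) (n : ℕ) (μ : ℕ → ℤ) (hμ : IsPart n μ) :
    gtSum t⁻¹ n μ = (-1) ^ (∑ m ∈ Finset.range n, m) * t ^ (∑ m ∈ Finset.range n, m ^ 2)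
      / (∏ l ∈ Finset.range n, qPoch t l) *
      (Matrix.vandermonde fun i : Fin n => t⁻¹ ^ (μ i + (n - 1 - (i : ℕ) : ℤ))).det := by
  induction n generalizing μ with
  | zero => simp [gtSum]
  | succ n ih =>
    rw [gtSum_succ_eq (inv_pos.2 ht) (inv_ne_one.2 ht1) n _ ih μ hμ]
    have e : ∀ i : Fin (n + 1), μ i + (((n + 1 : ℕ) : ℤ) - 1 - (i : ℕ))
        = μ i + ((n : ℤ) - (i : ℕ)) := fun i => by push_cast; ring
    simp only [e]
    congr 1
    have hq : ∏ p ∈ Finset.Icc 1 n, (1 - t⁻¹ ^ p)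
        = (-1) ^ n * (t ^ (∑ p ∈ Finset.range n, (p + 1)))⁻¹ * qPoch t n := by
      have : ∏ p ∈ Finset.Icc 1 n, (1 - t⁻¹ ^ p)
          = ∏ p ∈ Finset.Icc 1 n, ((-1) * (t ^ p)⁻¹ * (1 - t ^ p)) :=
        Finset.prod_congr rfl fun p _ => by
          have := (pow_pos ht p).ne'
          rw [inv_pow]
          field_simp
          ring
      rw [this, Finset.prod_mul_distrib, Finset.prod_mul_distrib, qPoch, Finset.prod_const,
        Nat.card_Icc, Nat.add_sub_cancel, Finset.prod_inv_distrib, Finset.prod_pow_eq_pow_sum,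
        ← Finset.Ico_add_one_right_eq_Icc, Finset.sum_Ico_eq_sum_range, Nat.add_sub_cancel]
      simp only [add_comm 1]
    have hsq : ∑ i ∈ Finset.range n, i + ∑ p ∈ Finset.range n, (p + 1) = n ^ 2 := by
      rw [Finset.sum_add_distrib, ← add_assoc, ← mul_two, Finset.sum_range_id_mul_two]
      rcases n with _ | n
      · rfl
      · simp
        ring
    have hm : ((-1 : ℝ) ^ n)⁻¹ = (-1) ^ n := by
      rw [← inv_pow]
      norm_num
    have := qPoch_ne_zero ht ht1 n
    rw [hq, Finset.sum_range_succ (fun m => m), Finset.sum_range_succ (fun m => m ^ 2),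
      Finset.prod_range_succ, pow_add, pow_add, ← hsq, pow_add, inv_pow, inv_inv, mul_inv, mul_inv,
      inv_inv, hm]
    field_simp

/-! ## Reindexing of products -/

lemma prod_Icc_one_eq_prod_fin {R : Type*} [CommMonoid R] (n : ℕ) (f : ℕ → R) :
    ∏ i ∈ Finset.Icc 1 n, f i = ∏ i : Fin n, f (i + 1) := by
  rw [← Finset.Ico_add_one_right_eq_Icc, Finset.prod_Ico_eq_prod_range, Nat.add_sub_cancel,
    ← Fin.prod_univ_eq_prod_range (fun i => f (1 + i))]
  simp only [add_comm 1]

lemma prod_Icc_succ_eq_prod_Ioi {R : Type*} [CommMonoid R] (n : ℕ) (i : Fin n) (f : ℕ → R) :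
    ∏ j ∈ Finset.Icc ((i : ℕ) + 1 + 1) n, f j = ∏ j ∈ Finset.Ioi i, f (j + 1) := by
  symm
  refine Finset.prod_bij (fun j _ => (j : ℕ) + 1) (fun j hj => ?_) (fun a _ b _ h => ?_)
    (fun b hb => ?_) (fun _ _ => rfl)
  · rw [Finset.mem_Ioi, Fin.lt_def] at hj
    rw [Finset.mem_Icc]
    omega
  · exact Fin.ext (by simpa using h)
  · rw [Finset.mem_Icc] at hb
    refine ⟨⟨b - 1, by omega⟩, ?_, by simp only; omega⟩
    rw [Finset.mem_Ioi, Fin.lt_def]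
    simp only
    omega

lemma prod_Icc_Icc_eq_prod_Ioi {R : Type*} [CommMonoid R] (n : ℕ) (f : ℕ → ℕ → R) :
    ∏ i ∈ Finset.Icc 1 n, ∏ j ∈ Finset.Icc (i + 1) n, f i j
      = ∏ i : Fin n, ∏ j ∈ Finset.Ioi i, f (i + 1) (j + 1) := by
  rw [prod_Icc_one_eq_prod_fin]
  exact Finset.prod_congr rfl fun i _ => prod_Icc_succ_eq_prod_Ioi n i (f (i + 1))

lemma prod_fin_fin_eq {R : Type*} [CommMonoid R] {n : ℕ} (f : Fin n → Fin n → R) :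
    ∏ i, ∏ j, f i j = (∏ i, f i i) * ∏ i, ∏ j ∈ Finset.Ioi i, f i j * f j i := by
  rw [Finset.prod_prod_Ioi_mul_eq_prod_prod_off_diag, ← Finset.prod_mul_distrib]
  refine Finset.prod_congr rfl fun i _ => ?_
  rw [← Finset.prod_mul_prod_compl {i}, Finset.prod_singleton]

lemma prod_le_subtype_eq {R : Type*} [CommMonoid R] {n : ℕ} (f : Fin n → Fin n → R) :
    ∏ p : {p : Fin n × Fin n // p.1 ≤ p.2}, f p.1.1 p.1.2
      = (∏ i, f i i) * ∏ i, ∏ j ∈ Finset.Ioi i, f i j := by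
  rw [← Finset.prod_mul_distrib,
    ← Finset.prod_subtype (Finset.univ.filter fun p : Fin n × Fin n => p.1 ≤ p.2)
      (by simp) (fun p => f p.1 p.2), Finset.prod_filter, ← Finset.univ_product_univ,
    Finset.prod_product]
  refine Finset.prod_congr rfl fun i _ => ?_
  rw [← Finset.prod_filter]
  have : Finset.univ.filter (fun j : Fin n => i ≤ j) = insert i (Finset.Ioi i) := by
    ext j
    simp [le_iff_eq_or_lt]
  simp only [this]
  rw [Finset.prod_insert (by simp)]

/-! ## The weight of a symmetric matrix -/

/-- The normalization of the product of the geometric distributions. -/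
noncomputable def geomConst (n : ℕ) (z α t : ℝ) : ℝ :=
  (∏ i : Fin n, (1 - α * z * t ^ (i : ℕ)))
    * ∏ i : Fin n, ∏ j ∈ Finset.Ioi i, (1 - z ^ 2 * t ^ ((i : ℕ) + (j : ℕ)))

/-- The unnormalized probability of a matrix with independent geometric entries on and above the
diagonal. -/
noncomputable def geomWeight {n : ℕ} (z α t : ℝ) (M : Fin n → Fin n → ℕ) : ℝ :=
  (∏ i : Fin n, (α * z * t ^ (i : ℕ)) ^ M i i)
    * ∏ i : Fin n, ∏ j ∈ Finset.Ioi i, (z ^ 2 * t ^ ((i : ℕ) + (j : ℕ))) ^ M i j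

lemma IsSymmGeometric.measureReal_eq {Ω : Type*} [MeasurableSpace Ω] {P : Measure Ω}
    {n : ℕ} {z α t : ℝ} {X : Fin n → Fin n → Ω → ℕ}
    (h : IsSymmGeometric P z α t X) (M : SymMat n) :
    P.real {ω | ∀ i j, X i j ω = M.1 i j} = geomConst n z α t * geomWeight z α t M.1 := by
  have h1 : {ω | ∀ i j, X i j ω = M.1 i j} = ⋂ p ∈ (Finset.univ :
      Finset {p : Fin n × Fin n // p.1 ≤ p.2}), X p.1.1 p.1.2 ⁻¹' {M.1 p.1.1 p.1.2} := by
    ext ω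
    simp only [Set.mem_ofPred_eq, Finset.mem_univ, Set.iInter_true, Set.mem_iInter,
      Set.mem_preimage, Set.mem_singleton_iff, Subtype.forall, Prod.forall]
    refine ⟨fun H i j _ => H i j, fun H i j => ?_⟩
    rcases le_total i j with hij | hij
    · exact H i j hij
    · rw [h.symm, M.2, H j i hij]
  rw [measureReal_def, h1, h.indep.measure_inter_preimage_eq_mul _ fun _ _ => MeasurableSet.of_discrete,
    ENNReal.toReal_prod, prod_le_subtype_eq fun i j => (P (X i j ⁻¹' {M.1 i j})).toReal]
  have hd : ∀ i, (P (X i i ⁻¹' {M.1 i i})).toReal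
      = (1 - α * z * t ^ (i : ℕ)) * (α * z * t ^ (i : ℕ)) ^ M.1 i i := fun i => h.diag i _
  have ho : ∀ i : Fin n, ∏ j ∈ Finset.Ioi i, (P (X i j ⁻¹' {M.1 i j})).toReal
      = ∏ j ∈ Finset.Ioi i, ((1 - z ^ 2 * t ^ ((i : ℕ) + (j : ℕ)))
        * (z ^ 2 * t ^ ((i : ℕ) + (j : ℕ))) ^ M.1 i j) := fun i =>
    Finset.prod_congr rfl fun j hj => h.offDiag i j (Finset.mem_Ioi.1 hj) _
  simp only [hd, ho, Finset.prod_mul_distrib, geomConst, geomWeight]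
  ring

lemma zpow_finset_sum {ι : Type*} (s : Finset ι) (f : ι → ℤ) {a : ℝ} (ha : a ≠ 0) :
    a ^ (∑ i ∈ s, f i) = ∏ i ∈ s, a ^ f i := by
  classical
  induction s using Finset.induction_on with
  | empty => simp
  | insert a s h ih => rw [Finset.prod_insert h, Finset.sum_insert h, zpow_add₀ ha, ih]

lemma prod_zpow_sub {z t : ℝ} (hz : 0 < z) (ht : 0 < t) (s : ℕ → ℤ) (hs : s 0 = 0) (n : ℕ) :
    ∏ i ∈ Finset.range n, (z * t ^ i) ^ (s (i + 1) - s i)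
      = z ^ s n * t ^ ((n - 1 : ℤ) * s n) * ∏ i ∈ Finset.range n, t⁻¹ ^ s i := by
  induction n with
  | zero => simp [hs]
  | succ n ih =>
    have e : (z * t ^ n) ^ (s (n + 1) - s n) * (z ^ s n * t ^ ((n - 1 : ℤ) * s n))
        = z ^ s (n + 1) * t ^ ((((n + 1 : ℕ) : ℤ) - 1) * s (n + 1)) * t⁻¹ ^ s n := by
      rw [mul_zpow, ← zpow_natCast t n, ← zpow_mul, inv_zpow', mul_mul_mul_comm,
        ← zpow_add₀ hz.ne', ← zpow_add₀ ht.ne', mul_assoc (z ^ _), ← zpow_add₀ ht.ne']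
      congr 2
      · ring
      · push_cast
        ring
    rw [Finset.prod_range_succ, ih, Finset.prod_range_succ, mul_right_comm, mul_comm (z ^ s n * _),
      e]
    ring

lemma geomWeight_eq {n : ℕ} {z α t : ℝ} (hz : 0 < z) (hα : 0 < α) (ht : 0 < t) (M : SymMat n) :
    geomWeight z α t M.1
      = z ^ (∑ l ∈ Finset.range n, M.chain.1 (Fin.last n) l)
        * t ^ ((n - 1 : ℤ) * ∑ l ∈ Finset.range n, M.chain.1 (Fin.last n) l)
        * α ^ (∑ l ∈ Finset.range n, (-1) ^ l * M.chain.1 (Fin.last n) l)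
        * ∏ i : Fin n, t⁻¹ ^ (∑ l ∈ Finset.range i, M.chain.1 i.castSucc l) := by
  have hnn := extendZ_nonneg M.1
  have hs := extendZ_symm M
  have h1 : geomWeight z α t M.1 = (∏ i : Fin n, α ^ M.1 i i)
      * ∏ i : Fin n, ∏ j : Fin n, (z * t ^ (i : ℕ)) ^ M.1 i j := by
    rw [prod_fin_fin_eq, ← mul_assoc, ← Finset.prod_mul_distrib, geomWeight]
    congr 1
    · exact Finset.prod_congr rfl fun i _ => by rw [mul_assoc, mul_pow]
    · refine Finset.prod_congr rfl fun i _ => Finset.prod_congr rfl fun j _ => ?_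
      rw [M.2 j i, ← mul_pow]
      ring
  have h2 : ∑ l ∈ Finset.range n, (-1) ^ l * M.chain.1 (Fin.last n) l = ∑ i : Fin n, (M.1 i i : ℤ) := by
    change ∑ l ∈ Finset.range n, (-1) ^ l * growthZ (extendZ M.1) n n l = _
    rw [alternating_sum_growthZ hnn hs n n le_rfl, ← Fin.sum_univ_eq_sum_range (fun i =>
      extendZ M.1 i i)]
    simp
  let s : ℕ → ℤ := fun i => ∑ i' ∈ Finset.range i, ∑ j' ∈ Finset.range n, extendZ M.1 i' j'
  have h3 : ∀ i : ℕ, ∑ l ∈ Finset.range i, growthZ (extendZ M.1) i n l = s i := fun i =>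
    sum_growthZ hnn i n i le_rfl
  have h4 : ∑ l ∈ Finset.range n, M.chain.1 (Fin.last n) l = s n := h3 n
  have h5 : ∀ i : Fin n, ∑ l ∈ Finset.range i, M.chain.1 i.castSucc l = s i := fun i => h3 i
  have h6 : ∀ i : Fin n, s (i + 1) - s i = ∑ j, (M.1 i j : ℤ) := fun i => by
    simp only [s]
    rw [Finset.sum_range_succ, add_sub_cancel_left, ← Fin.sum_univ_eq_sum_range (fun j =>
      extendZ M.1 i j)]
    simp
  rw [h1, h2, h4]
  simp only [h5]
  rw [Fin.prod_univ_eq_prod_range (fun i => t⁻¹ ^ s i), mul_right_comm,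
    ← prod_zpow_sub hz ht s (by simp [s]) n, zpow_finset_sum _ _ hα.ne', mul_comm,
    ← Fin.prod_univ_eq_prod_range (fun i => (z * t ^ i) ^ (s (i + 1) - s i))]
  congr 1
  · refine Finset.prod_congr rfl fun i _ => ?_
    rw [h6, zpow_finset_sum _ _ (by positivity)]
    simp

/-! ## The distribution of the shape -/

lemma sum_range_alternating_reflect (n : ℕ) :
    ∑ j ∈ Finset.range n, (-1 : ℤ) ^ j * ((n - 1 - j : ℕ) : ℤ) = ((n / 2 : ℕ) : ℤ) := by
  induction n with
  | zero => simp
  | succ n ih =>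
    rw [Finset.sum_range_succ']
    have : ∑ k ∈ Finset.range n, (-1 : ℤ) ^ (k + 1) * ((n + 1 - 1 - (k + 1) : ℕ) : ℤ)
        = -∑ j ∈ Finset.range n, (-1 : ℤ) ^ j * ((n - 1 - j : ℕ) : ℤ) := by
      rw [← Finset.sum_neg_distrib]
      refine Finset.sum_congr rfl fun k _ => ?_
      rw [show n + 1 - 1 - (k + 1) = n - 1 - k by omega, pow_succ]
      ring
    rw [this, ih]
    simp only [pow_zero, one_mul]
    omega

lemma prod_Ioi_vandermonde_inv {n : ℕ} {t : ℝ} (ht : 0 < t) (h : Fin n → ℕ) :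
    ∏ i : Fin n, ∏ j ∈ Finset.Ioi i, (t⁻¹ ^ h j - t⁻¹ ^ h i)
      = (-1) ^ (∑ m ∈ Finset.range n, m) * (t ^ ((n - 1) * ∑ i, h i))⁻¹
        * ∏ i : Fin n, ∏ j ∈ Finset.Ioi i, (t ^ h j - t ^ h i) := by
  have h1 : ∀ i j : Fin n, t⁻¹ ^ h j - t⁻¹ ^ h i
      = (-1) * (t⁻¹ ^ h i * t⁻¹ ^ h j) * (t ^ h j - t ^ h i) := fun i j => by
    have h1 := (pow_pos ht (h i)).ne'
    have h2 := (pow_pos ht (h j)).ne'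
    rw [inv_pow, inv_pow]
    field_simp
    ring
  simp only [h1, Finset.prod_mul_distrib]
  rw [← Finset.prod_mul_distrib (f := fun i : Fin n => ∏ j ∈ Finset.Ioi i, t⁻¹ ^ h i)]
  simp_rw [← Finset.prod_mul_distrib (f := fun _ => t⁻¹ ^ h _)]
  rw [Finset.prod_prod_Ioi_mul_eq_prod_prod_off_diag (fun _ j => t⁻¹ ^ h j)]
  congr 2
  · simp only [Finset.prod_const, Fin.card_Ioi]
    rw [Finset.prod_pow_eq_pow_sum, Fin.sum_univ_eq_sum_range (fun i => n - 1 - i),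
      Finset.sum_range_reflect (fun i => i)]
  · simp only [Finset.prod_const, Finset.card_compl, Finset.card_singleton, Fintype.card_fin]
    rw [← inv_pow, mul_comm, pow_mul, Finset.prod_pow, Finset.prod_pow_eq_pow_sum]

lemma sum_Icc_mul_add_sum_sq (n : ℕ) :
    ∑ j ∈ Finset.Icc 1 n, (j - 1) * (n - j) + ∑ m ∈ Finset.range n, m ^ 2
      = (n - 1) * ∑ m ∈ Finset.range n, m := by
  rw [← Finset.Ico_add_one_right_eq_Icc, Finset.sum_Ico_eq_sum_range, Nat.add_sub_cancel,
    ← Finset.sum_add_distrib, Finset.mul_sum]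
  refine Finset.sum_congr rfl fun m hm => ?_
  rw [Finset.mem_range] at hm
  obtain ⟨k, rfl⟩ := Nat.exists_eq_add_of_lt hm
  rw [show 1 + m - 1 = m by omega, show m + k + 1 - (1 + m) = k by omega,
    show m + k + 1 - 1 = m + k by omega]
  ring

lemma discreteProb_add_delta {n : ℕ} {z α t : ℝ} (hz : 0 < z) (hα : 0 < α) (ht : 0 < t)
    (ht1 : t ≠ 1) (μ : Fin n → ℕ) (hμ : IsPart n (extendVec fun i => (μ i : ℤ))) :
    discreteProb n z α t (fun j => μ j + (n - 1 - (j : ℕ)))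
      = geomConst n z α t * (z ^ (∑ i, (μ i : ℤ)) * t ^ ((n - 1 : ℤ) * ∑ i, (μ i : ℤ))
        * α ^ (∑ i : Fin n, (-1 : ℤ) ^ (i : ℕ) * (μ i : ℤ)))
        * gtSum t⁻¹ n (extendVec fun i => (μ i : ℤ)) := by
  set h : Fin n → ℕ := fun j => μ j + (n - 1 - (j : ℕ)) with hh
  rcases Nat.eq_zero_or_pos n with rfl | hn
  · simp [discreteProb, discreteConst, geomConst, gtSum]
  have e1 : ∀ i : Fin n, (extendVec fun i => (μ i : ℤ)) i + (n - 1 - (i : ℕ) : ℤ) = (h i : ℤ) := by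
    intro i
    rw [extendVec_apply]
    simp only [hh]
    omega
  have e2 : ∑ j ∈ Finset.Icc 1 n, (n - j) = ∑ m ∈ Finset.range n, m := by
    rw [← Finset.Ico_add_one_right_eq_Icc, Finset.sum_Ico_eq_sum_range, Nat.add_sub_cancel,
      ← Finset.sum_range_reflect (fun i => i)]
    exact Finset.sum_congr rfl fun m _ => by omega
  have e3 : ∑ i, h i = ∑ i, μ i + ∑ m ∈ Finset.range n, m := by
    rw [← Finset.sum_range_reflect (fun i => i), ← Fin.sum_univ_eq_sum_range
      (fun i => n - 1 - i), ← Finset.sum_add_distrib]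
  have e4 : ∏ l ∈ Finset.Icc 1 (n - 1), qPoch t l = ∏ l ∈ Finset.range n, qPoch t l := by
    obtain ⟨n, rfl⟩ : ∃ m, n = m + 1 := ⟨n - 1, by omega⟩
    rw [Finset.prod_range_succ', ← Finset.Ico_add_one_right_eq_Icc, Finset.prod_Ico_eq_prod_range]
    simp [qPoch, add_comm 1]
  have e5 : ∑ j : Fin n, (-1 : ℤ) ^ (j : ℕ) * (h j : ℤ)
      = ∑ j : Fin n, (-1 : ℤ) ^ (j : ℕ) * (μ j : ℤ) + ((n / 2 : ℕ) : ℤ) := by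
    rw [← sum_range_alternating_reflect, ← Fin.sum_univ_eq_sum_range
      (fun j => (-1 : ℤ) ^ j * ((n - 1 - j : ℕ) : ℤ)), ← Finset.sum_add_distrib]
    refine Finset.sum_congr rfl fun j _ => ?_
    simp only [hh]
    push_cast
    ring
  have e6 : (t ^ (∑ j ∈ Finset.Icc 1 n, (j - 1) * (n - j)))⁻¹
      = t ^ (∑ m ∈ Finset.range n, m ^ 2) * t ^ ((n - 1) * ∑ i, μ i)
        * (t ^ ((n - 1) * ∑ i, h i))⁻¹ := by
    rw [e3, mul_add, ← sum_Icc_mul_add_sum_sq, pow_add, pow_add]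
    have h1 := fun k : ℕ => (pow_pos ht k).ne'
    field_simp [h1]
  have e7 : (n - 1 : ℤ) * ∑ i, (μ i : ℤ) = (((n - 1) * ∑ i, μ i : ℕ) : ℤ) := by
    rw [Nat.cast_mul, Nat.cast_sub hn]
    push_cast
    ring
  have e8 : ((-1 : ℝ) ^ (∑ m ∈ Finset.range n, m)) * (-1) ^ (∑ m ∈ Finset.range n, m) = 1 := by
    rw [← mul_pow]
    norm_num
  have e9 : ∑ i, (μ i : ℤ) = ((∑ i, μ i : ℕ) : ℤ) := by push_cast; rfl
  rw [gtSum_eq ht ht1 n _ hμ, Matrix.det_vandermonde]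
  simp only [e1, zpow_natCast]
  rw [prod_Ioi_vandermonde_inv ht h, discreteProb, discreteConst, e2, e4, e5, e6, e7, e9,
    zpow_natCast, zpow_natCast, zpow_add₀ hα.ne', zpow_natCast, e3, pow_add z,
    prod_Icc_one_eq_prod_fin, prod_Icc_Icc_eq_prod_Ioi]
  have e10 : ∀ i j : Fin n, (i : ℕ) + 1 + ((j : ℕ) + 1) - 2 = i + j := fun i j => by omega
  simp only [Nat.add_sub_cancel, e10]
  rw [geomConst]
  have hz' := fun k : ℕ => (pow_pos hz k).ne'
  have hα' := fun k : ℕ => (pow_pos hα k).ne'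
  generalize (∏ i : Fin n, ∏ j ∈ Finset.Ioi i, (t ^ h j - t ^ h i)) = V
  generalize (∏ i : Fin n, (1 - α * z * t ^ (i : ℕ))) = A
  generalize (∏ i : Fin n, ∏ j ∈ Finset.Ioi i, (1 - z ^ 2 * t ^ ((i : ℕ) + (j : ℕ)))) = B
  generalize (∏ l ∈ Finset.range n, qPoch t l) = Q
  generalize (-1 : ℝ) ^ (∑ m ∈ Finset.range n, m) = ε at e8
  generalize (t ^ ((n - 1) * (∑ i, μ i + ∑ m ∈ Finset.range n, m)))⁻¹ = T
  generalize α ^ (∑ j : Fin n, (-1 : ℤ) ^ (j : ℕ) * (μ j : ℤ)) = D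
  have hz1 := hz' (∑ m ∈ Finset.range n, m)
  have hα1 := hα' (n / 2)
  field_simp
  linear_combination (-1 : ℝ) * (A * B) * V * T * D / Q * e8

lemma hasRSKShape_iff {n : ℕ} (M : SymMat n) (μ : Fin n → ℕ) :
    HasRSKShape M.1 μ ↔ M.chain.1 (Fin.last n) = extendVec fun i => (μ i : ℤ) := by
  change _ ↔ growthZ (extendZ M.1) n n = _
  rw [HasRSKShape, funext_iff]
  refine forall_congr' fun k => ?_
  rw [← rskShape_eq_growthZ, extendVec]
  split_ifs <;> norm_cast

lemma isPart_extendVec_natCast {n : ℕ} {μ : Fin n → ℕ} (hμ : Antitone μ) :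
    IsPart n (extendVec fun i => (μ i : ℤ)) := by
  refine ⟨fun a b hab => ?_, fun l hl => by rw [extendVec, dif_neg (by omega)]⟩
  unfold extendVec
  split_ifs with h1 h2
  · exact Int.ofNat_le.2 (hμ (show (⟨a, h2⟩ : Fin n) ≤ ⟨b, h1⟩ from hab))
  · omega
  · simp
  · rfl

/-- A random symmetric matrix as a random element of `SymMat n`. -/
def IsSymmGeometric.toSymMat {Ω : Type*} [MeasurableSpace Ω] {P : Measure Ω} {n : ℕ} {z α t : ℝ}
    {X : Fin n → Fin n → Ω → ℕ} (h : IsSymmGeometric P z α t X) (ω : Ω) : SymMat n :=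
  ⟨fun i j => X i j ω, fun i j => h.symm i j ω⟩

lemma IsSymmGeometric.measure_setOf {Ω : Type*} [MeasurableSpace Ω] {P : Measure Ω}
    [IsProbabilityMeasure P] {n : ℕ} {z α t : ℝ} {X : Fin n → Fin n → Ω → ℕ}
    (h : IsSymmGeometric P z α t X) (s : Set (SymMat n)) [DecidablePred (· ∈ s)] :
    P {ω | h.toSymMat ω ∈ s} = ∑' M : SymMat n, if M ∈ s then
      ENNReal.ofReal (geomConst n z α t * geomWeight z α t M.1) else 0 := by
  have hM : ∀ M : SymMat n, {ω | h.toSymMat ω = M} = {ω | ∀ i j, X i j ω = M.1 i j} := fun M => by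
    ext ω
    simp [IsSymmGeometric.toSymMat, Subtype.ext_iff, funext_iff]
  have h1 : {ω | h.toSymMat ω ∈ s} = ⋃ M : SymMat n, {ω | h.toSymMat ω = M ∧ M ∈ s} := by
    ext ω
    simp
  rw [h1, measure_iUnion]
  · refine tsum_congr fun M => ?_
    by_cases hs : M ∈ s
    · simp only [hs, and_true, if_true]
      rw [hM, ← h.measureReal_eq M, ofReal_measureReal]
    · simp [hs]
  · intro M M' hne
    refine Set.disjoint_left.2 fun ω h1 h2 => hne ?_
    exact h1.1.symm.trans h2.1
  · intro M
    by_cases hs : M ∈ s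
    · simp only [hs, and_true, hM]
      rw [Set.ofPred_forall]
      refine MeasurableSet.iInter fun i => ?_
      rw [Set.ofPred_forall]
      exact MeasurableSet.iInter fun j => h.measurable i j (MeasurableSet.singleton _)
    · simp [hs]

/-- The distribution of the RSK shape of a symmetric geometric matrix. -/
theorem IsSymmGeometric.measure_hasRSKShape {Ω : Type*} [MeasurableSpace Ω] {P : Measure Ω}
    [IsProbabilityMeasure P] {n : ℕ} {z α t : ℝ} {X : Fin n → Fin n → Ω → ℕ}
    (h : IsSymmGeometric P z α t X) (hz : 0 < z) (hα : 0 < α) (ht : 0 < t) (ht1 : t ≠ 1)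
    (hoff : ∀ i j : Fin n, i < j → z ^ 2 * t ^ ((i : ℕ) + (j : ℕ)) < 1)
    (hdiag : ∀ i : Fin n, α * z * t ^ (i : ℕ) < 1) (μ : Fin n → ℕ) (hμ : Antitone μ) :
    P {ω | HasRSKShape (fun i j => X i j ω) μ}
      = ENNReal.ofReal (discreteProb n z α t fun j => μ j + (n - 1 - (j : ℕ))) := by
  classical
  have hC : 0 ≤ geomConst n z α t :=
    mul_nonneg (Finset.prod_nonneg fun i _ => (sub_pos.2 (hdiag i)).le)
      (Finset.prod_nonneg fun i _ => Finset.prod_nonneg fun j hj =>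
        (sub_pos.2 (hoff i j (Finset.mem_Ioi.1 hj))).le)
  set κ : ℕ → ℤ := extendVec fun i => (μ i : ℤ) with hκ
  have hpart : IsPart n κ := isPart_extendVec_natCast hμ
  have h1 : {ω | HasRSKShape (fun i j => X i j ω) μ}
      = {ω | h.toSymMat ω ∈ {M : SymMat n | M.chain.1 (Fin.last n) = κ}} := by
    ext ω
    exact hasRSKShape_iff (h.toSymMat ω) μ
  have hκ1 : ∑ l ∈ Finset.range n, κ l = ∑ i, (μ i : ℤ) := sum_range_extendVec _
  have hκ2 : ∑ l ∈ Finset.range n, (-1) ^ l * κ l = ∑ i : Fin n, (-1 : ℤ) ^ (i : ℕ) * (μ i : ℤ) := by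
    rw [← Fin.sum_univ_eq_sum_range (fun l => (-1) ^ l * κ l)]
    simp [hκ]
  have hW : 0 ≤ geomConst n z α t * (z ^ (∑ i, (μ i : ℤ)) * t ^ ((n - 1 : ℤ) * ∑ i, (μ i : ℤ))
      * α ^ (∑ i : Fin n, (-1 : ℤ) ^ (i : ℕ) * (μ i : ℤ))) := by positivity
  rw [h1, h.measure_setOf, discreteProb_add_delta hz hα ht ht1 μ hpart, ENNReal.ofReal_mul hW,
    ← chainSum_eq_gtSum (inv_pos.2 ht) n κ hpart, chainSum, ← ENNReal.tsum_mul_left,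
    ← (Equiv.ofBijective _ (bijective_chain n)).tsum_eq]
  refine tsum_congr fun M => ?_
  simp only [Equiv.ofBijective_apply, Set.mem_ofPred_eq]
  split_ifs with hM
  · rw [geomWeight_eq hz hα ht, hM, hκ1, hκ2, ← mul_assoc, ENNReal.ofReal_mul hW,
      ENNReal.ofReal_prod_of_nonneg fun i _ => zpow_nonneg (inv_nonneg.2 ht.le) _]
  · simp

lemma discreteProb_nonneg {n : ℕ} {z α t : ℝ} (hz : 0 < z) (hα : 0 < α) (ht : 0 < t)
    (ht1 : t ≠ 1) (hoff : ∀ i j : Fin n, i < j → z ^ 2 * t ^ ((i : ℕ) + (j : ℕ)) < 1)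
    (hdiag : ∀ i : Fin n, α * z * t ^ (i : ℕ) < 1) (μ : Fin n → ℕ) (hμ : Antitone μ) :
    0 ≤ discreteProb n z α t fun j => μ j + (n - 1 - (j : ℕ)) := by
  have hC : 0 ≤ geomConst n z α t :=
    mul_nonneg (Finset.prod_nonneg fun i _ => (sub_pos.2 (hdiag i)).le)
      (Finset.prod_nonneg fun i _ => Finset.prod_nonneg fun j hj =>
        (sub_pos.2 (hoff i j (Finset.mem_Ioi.1 hj))).le)
  rw [discreteProb_add_delta hz hα ht ht1 μ (isPart_extendVec_natCast hμ)]
  have := gtSum_nonneg (inv_pos.2 ht) n (extendVec fun i => (μ i : ℤ))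
  positivity

/-! ## The limit of the discrete probability -/

/-- The limiting density without its normalization. -/
noncomputable def limitWeight (n : ℕ) (a a₁ : ℝ) (x : Fin n → ℝ) : ℝ :=
  Real.exp (-a * ∑ j, x j) * Real.exp (-a₁ * ∑ j : Fin n, (-1 : ℝ) ^ (j : ℕ) * x j)
    * ∏ i : Fin n, ∏ j ∈ Finset.Ioi i, (Real.exp (-x j) - Real.exp (-x i))

lemma limitDensity_eq (n : ℕ) (a a₁ : ℝ) (x : Fin n → ℝ) :
    limitDensity n a a₁ x = limitConst n a a₁ * limitWeight n a a₁ x := by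
  rw [limitDensity, limitWeight, mul_assoc, mul_assoc, mul_assoc]

lemma continuous_limitWeight (n : ℕ) (a a₁ : ℝ) : Continuous (limitWeight n a a₁) := by
  unfold limitWeight
  fun_prop

lemma discreteProb_exp (n : ℕ) (a a₁ : ℝ) (L : ℝ) (h : Fin n → ℕ) :
    discreteProb n (Real.exp (-a / L)) (Real.exp (-a₁ / L)) (Real.exp (-1 / L)) h
      = discreteConst n (Real.exp (-a / L)) (Real.exp (-a₁ / L)) (Real.exp (-1 / L))
        * limitWeight n a a₁ fun j => (h j : ℝ) / L := by
  rw [discreteProb, limitWeight, ← mul_assoc, ← mul_assoc]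
  congr 1
  · congr 1
    · congr 1
      rw [← Real.exp_nat_mul]
      congr 1
      rw [← Finset.sum_div]
      push_cast
      ring
    · rw [← Real.rpow_intCast, ← Real.exp_mul]
      congr 1
      push_cast
      simp_rw [mul_div_assoc']
      rw [← Finset.sum_div]
      ring
  · refine Finset.prod_congr rfl fun i _ => Finset.prod_congr rfl fun j _ => ?_
    rw [← Real.exp_nat_mul, ← Real.exp_nat_mul]
    congr 2 <;> ring

lemma tendsto_mul_one_sub_exp (c : ℝ) {L : ℕ → ℝ} (hL : Tendsto L atTop atTop) :
    Tendsto (fun N => L N * (1 - Real.exp (-c / L N))) atTop (𝓝 c) := by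
  have h1 : HasDerivAt (fun s : ℝ => 1 - Real.exp (-c * s)) c 0 := by
    have h := (((hasDerivAt_id (0 : ℝ)).const_mul (-c)).exp).const_sub 1
    simpa using h
  have h2 : Tendsto (fun N => (L N)⁻¹) atTop (𝓝[≠] 0) := by
    refine tendsto_nhdsWithin_iff.2 ⟨tendsto_inv_atTop_zero.comp hL, ?_⟩
    filter_upwards [hL.eventually_gt_atTop 0] with N hN
    exact inv_ne_zero hN.ne'
  refine (h1.tendsto_slope_zero.comp h2).congr fun N => ?_
  simp [div_eq_mul_inv]

lemma tendsto_exp_neg_div (c : ℝ) {L : ℕ → ℝ} (hL : Tendsto L atTop atTop) :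
    Tendsto (fun N => Real.exp (-c / L N)) atTop (𝓝 1) := by
  rw [← Real.exp_zero]
  exact (Real.continuous_exp.tendsto 0).comp (tendsto_const_nhds.div_atTop hL)

lemma Gamma_add_nat (s : ℝ) (hs : 0 < s) (k : ℕ) :
    Real.Gamma (s + k) = Real.Gamma s * ∏ j ∈ Finset.range k, (s + j) := by
  induction k with
  | zero => simp
  | succ k ih =>
    rw [Finset.prod_range_succ, ← mul_assoc, ← ih, Nat.cast_succ, ← add_assoc,
      Real.Gamma_add_one (by positivity), mul_comm]

lemma limitConst_eq (n : ℕ) (hn : 1 ≤ n) (a a₁ : ℝ) (h0 : 0 < a + a₁) (h1 : 2 ≤ n → 0 < 2 * a + 1) :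
    limitConst n a a₁ = (∏ i ∈ Finset.Icc 1 n, (a₁ + a + ((i - 1 : ℕ) : ℝ)))
      * (∏ i ∈ Finset.Icc 1 n, ∏ j ∈ Finset.Icc (i + 1) n, (2 * a + ((i + j - 2 : ℕ) : ℝ)))
      / ∏ l ∈ Finset.Icc 1 (n - 1), ∏ m ∈ Finset.Icc 1 l, (m : ℝ) := by
  have e1 : Real.Gamma (a + a₁ + n) / Real.Gamma (a + a₁)
      = ∏ i ∈ Finset.Icc 1 n, (a₁ + a + ((i - 1 : ℕ) : ℝ)) := by
    rw [Gamma_add_nat _ h0, mul_div_cancel_left₀ _ (Real.Gamma_pos_of_pos h0).ne',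
      ← Finset.Ico_add_one_right_eq_Icc, Finset.prod_Ico_eq_prod_range, Nat.add_sub_cancel]
    refine Finset.prod_congr rfl fun i _ => ?_
    rw [Nat.add_sub_cancel_left, add_comm a]
  have e2 : ∀ l : ℕ, (l.factorial : ℝ) = ∏ m ∈ Finset.Icc 1 l, (m : ℝ) := fun l => by
    rw [← Finset.Ico_add_one_right_eq_Icc, ← Finset.prod_Ico_id_eq_factorial]
    push_cast
    rfl
  have e3 : ∏ i ∈ Finset.Icc 1 (n - 1),
      Real.Gamma (2 * a + i + n - 1) / Real.Gamma (2 * a + 2 * i - 1)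
      = ∏ i ∈ Finset.Icc 1 n, ∏ j ∈ Finset.Icc (i + 1) n, (2 * a + ((i + j - 2 : ℕ) : ℝ)) := by
    have e4 : Finset.Icc 1 n = insert n (Finset.Icc 1 (n - 1)) := by
      ext x
      simp only [Finset.mem_Icc, Finset.mem_insert]
      omega
    rw [e4, Finset.prod_insert (by simp; omega), Finset.Icc_eq_empty (by omega : ¬ n + 1 ≤ n),
      Finset.prod_empty, one_mul]
    refine Finset.prod_congr rfl fun i hi => ?_
    rw [Finset.mem_Icc] at hi
    have hi1 : (1 : ℝ) ≤ i := by exact_mod_cast hi.1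
    have hpos : 0 < 2 * a + 2 * i - 1 := by linarith [h1 (by omega)]
    have e5 : 2 * a + i + n - 1 = (2 * a + 2 * i - 1) + ((n - i : ℕ) : ℝ) := by
      rw [Nat.cast_sub (by omega)]
      ring
    rw [e5, Gamma_add_nat _ hpos, mul_div_cancel_left₀ _ (Real.Gamma_pos_of_pos hpos).ne',
      ← Finset.Ico_add_one_right_eq_Icc, Finset.prod_Ico_eq_prod_range,
      show n + 1 - (i + 1) = n - i by omega]
    refine Finset.prod_congr rfl fun j _ => ?_
    rw [show i + (i + 1 + j) - 2 = (2 * i + j) - 1 by omega, Nat.cast_sub (by omega)]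
    push_cast
    ring
  rw [limitConst, e1, e3]
  simp only [e2]
  ring

lemma sum_Icc_sub_eq (n : ℕ) :
    ∑ i ∈ Finset.Icc 1 n, (n - i) = ∑ l ∈ Finset.Icc 1 (n - 1), l := by
  rcases n with _ | n
  · rfl
  · rw [← Finset.Ico_add_one_right_eq_Icc, ← Finset.Ico_add_one_right_eq_Icc,
      Finset.sum_Ico_eq_sum_range, Finset.sum_Ico_eq_sum_range, Nat.add_sub_cancel,
      Nat.add_sub_cancel, Finset.sum_range_succ, Nat.add_sub_cancel, ← Finset.sum_range_reflect]
    rw [show n + 1 - (1 + n) = 0 by omega, add_zero]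
    refine Finset.sum_congr rfl fun i hi => ?_
    rw [Finset.mem_range] at hi
    omega

lemma mul_discreteConst_eq (n : ℕ) (z α t L : ℝ) (hL : 0 < L) :
    L ^ n * discreteConst n z α t = (z ^ (∑ j ∈ Finset.Icc 1 n, (n - j)))⁻¹ * (α ^ (n / 2))⁻¹
      * (t ^ (∑ j ∈ Finset.Icc 1 n, (j - 1) * (n - j)))⁻¹
      * ((∏ i ∈ Finset.Icc 1 n, L * (1 - α * z * t ^ (i - 1)))
        * (∏ i ∈ Finset.Icc 1 n, ∏ j ∈ Finset.Icc (i + 1) n, L * (1 - z ^ 2 * t ^ (i + j - 2)))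
        / ∏ l ∈ Finset.Icc 1 (n - 1), ∏ m ∈ Finset.Icc 1 l, L * (1 - t ^ m)) := by
  simp only [discreteConst, qPoch, Finset.prod_mul_distrib, Finset.prod_const, Nat.card_Icc,
    Finset.prod_pow_eq_pow_sum, Nat.add_sub_cancel]
  have e : ∑ i ∈ Finset.Icc 1 n, (n + 1 - (i + 1)) = ∑ l ∈ Finset.Icc 1 (n - 1), l := by
    rw [← sum_Icc_sub_eq]
    exact Finset.sum_congr rfl fun i _ => by omega
  rw [e]
  have hpow : L ^ (∑ l ∈ Finset.Icc 1 (n - 1), l) ≠ 0 := (pow_pos hL _).ne'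
  rw [Finset.prod_pow_eq_pow_sum (Finset.Icc 1 (n - 1)) (fun x => x) L, div_eq_mul_inv,
    div_eq_mul_inv, mul_inv]
  generalize (∏ l ∈ Finset.Icc 1 (n - 1), ∏ m ∈ Finset.Icc 1 l, (1 - t ^ m))⁻¹ = D
  generalize (∏ i ∈ Finset.Icc 1 n, (1 - α * z * t ^ (i - 1))) = A
  generalize (∏ i ∈ Finset.Icc 1 n, ∏ j ∈ Finset.Icc (i + 1) n, (1 - z ^ 2 * t ^ (i + j - 2))) = B
  generalize L ^ (∑ l ∈ Finset.Icc 1 (n - 1), l) = S at hpow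
  generalize (z ^ (∑ j ∈ Finset.Icc 1 n, (n - j)))⁻¹ * (α ^ (n / 2))⁻¹ = Z
  linear_combination (-(L ^ n * Z * (t ^ (∑ j ∈ Finset.Icc 1 n, (j - 1) * (n - j)))⁻¹ * D * A * B))
    * mul_inv_cancel₀ hpow

lemma tendsto_mul_discreteConst (n : ℕ) (hn : 1 ≤ n) (a a₁ : ℝ) (h0 : 0 < a + a₁)
    (h1 : 2 ≤ n → 0 < 2 * a + 1) {L : ℕ → ℝ} (hL : ∀ N, 0 < L N) (hL' : Tendsto L atTop atTop) :
    Tendsto (fun N => L N ^ n * discreteConst n (Real.exp (-a / L N)) (Real.exp (-a₁ / L N))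
      (Real.exp (-1 / L N))) atTop (𝓝 (limitConst n a a₁)) := by
  rw [limitConst_eq n hn a a₁ h0 h1, ← one_mul (_ / _)]
  have hone : ∀ (c : ℝ) (k : ℕ), Tendsto (fun N => (Real.exp (-c / L N) ^ k)⁻¹) atTop (𝓝 1) :=
    fun c k => by
      simpa using ((tendsto_exp_neg_div c hL').pow k).inv₀ (by simp)
  have hlin : ∀ c : ℝ, ∀ f : ℕ → ℝ, (∀ N, f N = Real.exp (-c / L N)) →
      Tendsto (fun N => L N * (1 - f N)) atTop (𝓝 c) := fun c f hf => by
    simp only [hf]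
    exact tendsto_mul_one_sub_exp c hL'
  simp only [mul_discreteConst_eq n _ _ _ _ (hL _)]
  refine Tendsto.mul ?_ (Tendsto.div (Tendsto.mul ?_ ?_) ?_ ?_)
  · simpa using ((hone a _).mul (hone a₁ _)).mul (hone 1 _)
  · refine tendsto_finsetProd _ fun i _ => hlin _ _ fun N => ?_
    rw [← Real.exp_nat_mul, ← Real.exp_add, ← Real.exp_add]
    congr 1
    ring
  · refine tendsto_finsetProd _ fun i _ => tendsto_finsetProd _ fun j _ => hlin _ _ fun N => ?_
    rw [← Real.exp_nat_mul, ← Real.exp_nat_mul, ← Real.exp_add]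
    congr 1
    push_cast
    ring
  · refine tendsto_finsetProd _ fun i _ => tendsto_finsetProd _ fun j _ => hlin _ _ fun N => ?_
    rw [← Real.exp_nat_mul]
    congr 1
    ring
  · refine Finset.prod_ne_zero_iff.2 fun l _ => Finset.prod_ne_zero_iff.2 fun m hm => ?_
    rw [Finset.mem_Icc] at hm
    exact_mod_cast (by omega : m ≠ 0)

/-- The rescaled discrete probability tends to the limiting density. -/
theorem tendsto_mul_discreteProb (n : ℕ) (hn : 1 ≤ n) (a a₁ : ℝ) (h0 : 0 < a + a₁)
    (h1 : 2 ≤ n → 0 < 2 * a + 1) {L : ℕ → ℝ} (hL : ∀ N, 0 < L N) (hL' : Tendsto L atTop atTop)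
    (x : Fin n → ℝ) (h : ℕ → Fin n → ℕ)
    (hx : ∀ j, Tendsto (fun N => (h N j : ℝ) / L N) atTop (𝓝 (x j))) :
    Tendsto (fun N => L N ^ n * discreteProb n (Real.exp (-a / L N)) (Real.exp (-a₁ / L N))
      (Real.exp (-1 / L N)) (h N)) atTop (𝓝 (limitDensity n a a₁ x)) := by
  simp only [discreteProb_exp, limitDensity_eq, ← mul_assoc]
  exact (tendsto_mul_discreteConst n hn a a₁ h0 h1 hL hL').mul
    (((continuous_limitWeight n a a₁).tendsto x).comp (tendsto_pi_nhds.2 hx))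

lemma limitConst_pos (n : ℕ) (hn : 1 ≤ n) (a a₁ : ℝ) (h0 : 0 < a + a₁)
    (h1 : 2 ≤ n → 0 < 2 * a + 1) : 0 < limitConst n a a₁ := by
  rw [limitConst_eq n hn a a₁ h0 h1]
  refine div_pos (mul_pos (Finset.prod_pos fun i _ => ?_) (Finset.prod_pos fun i hi =>
    Finset.prod_pos fun j hj => ?_)) (Finset.prod_pos fun l _ => Finset.prod_pos fun m hm => ?_)
  · have : (0 : ℝ) ≤ ((i - 1 : ℕ) : ℝ) := Nat.cast_nonneg _
    linarith
  · rw [Finset.mem_Icc] at hi hj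
    have : (1 : ℝ) ≤ ((i + j - 2 : ℕ) : ℝ) := by
      rw [Nat.one_le_cast]
      omega
    linarith [h1 (by omega)]
  · rw [Finset.mem_Icc] at hm
    exact_mod_cast (by omega : 0 < m)

lemma limitWeight_pos {n : ℕ} (a a₁ : ℝ) {x : Fin n → ℝ} (hx : StrictAnti x) :
    0 < limitWeight n a a₁ x := by
  refine mul_pos (by positivity) (Finset.prod_pos fun i _ => Finset.prod_pos fun j hj => ?_)
  rw [Finset.mem_Ioi] at hj
  rw [sub_pos, Real.exp_lt_exp, neg_lt_neg_iff]
  exact hx hj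

/-! ## An exponential bound for the density -/

lemma abel_nonneg (b x : ℕ → ℝ) (n : ℕ) (hb : ∀ k ≤ n, 0 ≤ ∑ j ∈ Finset.range k, b j)
    (hx : Antitone x) (hx0 : ∀ j, 0 ≤ x j) : 0 ≤ ∑ j ∈ Finset.range n, b j * x j := by
  have key : ∀ k ≤ n, (∑ j ∈ Finset.range k, b j) * x k ≤ ∑ j ∈ Finset.range k, b j * x j := by
    intro k
    induction k with
    | zero => simp
    | succ k ih =>
      intro hk
      rw [Finset.sum_range_succ (fun j => b j * x j)]
      calc (∑ j ∈ Finset.range (k + 1), b j) * x (k + 1)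
          ≤ (∑ j ∈ Finset.range (k + 1), b j) * x k :=
            mul_le_mul_of_nonneg_left (hx (Nat.le_succ k)) (hb _ hk)
        _ = (∑ j ∈ Finset.range k, b j) * x k + b k * x k := by
            rw [Finset.sum_range_succ, add_mul]
        _ ≤ _ := by linarith [ih (by omega)]
  exact (mul_nonneg (hb n le_rfl) (hx0 n)).trans (key n le_rfl)

lemma partial_sum_ge (n : ℕ) (a a₁ m : ℝ) (h0 : m ≤ a + a₁) (h1 : 2 ≤ n → m ≤ 2 * a + 1)
    (hm : 0 ≤ m) : ∀ k, k + 1 ≤ n → m ≤ ∑ j ∈ Finset.range (k + 1), (a + (-1) ^ j * a₁ + j) := by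
  intro k
  induction k using Nat.twoStepInduction with
  | zero => intro _; simpa using h0
  | one =>
    intro h
    have := h1 h
    simp [Finset.sum_range_succ]
    linarith
  | more k ih _ =>
    intro h
    rw [Finset.sum_range_succ, Finset.sum_range_succ]
    have e1 := ih (by omega)
    have e2 := h1 (by omega)
    have e3 : (0 : ℝ) ≤ k := Nat.cast_nonneg k
    rw [pow_succ (-1 : ℝ) (k + 1)]
    push_cast
    linarith

lemma limitWeight_le {n : ℕ} (hn : 1 ≤ n) (a a₁ : ℝ) (h0 : 0 < a + a₁)
    (h1 : 2 ≤ n → 0 < 2 * a + 1) : ∃ ε : ℝ, 0 < ε ∧ ∀ x : Fin n → ℝ, Antitone x → (∀ j, 0 ≤ x j) →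
      limitWeight n a a₁ x ≤ Real.exp (-ε * ∑ j, x j) := by
  obtain ⟨m, hm, hm0, hm1⟩ : ∃ m : ℝ, 0 < m ∧ m ≤ a + a₁ ∧ (2 ≤ n → m ≤ 2 * a + 1) := by
    by_cases h2 : 2 ≤ n
    · exact ⟨min (a + a₁) (2 * a + 1), lt_min h0 (h1 h2), min_le_left _ _, fun _ => min_le_right _ _⟩
    · exact ⟨a + a₁, h0, le_rfl, fun h => absurd h h2⟩
  have hn0 : (0 : ℝ) < n := by exact_mod_cast hn
  refine ⟨m / n, div_pos hm hn0, fun x hx hx0 => ?_⟩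
  let y : ℕ → ℝ := fun l => if h : l < n then x ⟨l, h⟩ else 0
  have hy : ∀ i : Fin n, y i = x i := fun i => by simp [y]
  have hy0 : ∀ l, 0 ≤ y l := fun l => by
    simp only [y]
    split_ifs
    exacts [hx0 _, le_rfl]
  have hya : Antitone y := fun k l hkl => by
    simp only [y]
    split_ifs with h1 h2
    · exact hx (by simpa using hkl)
    · omega
    · exact hx0 _
    · exact le_rfl
  have habel := abel_nonneg (fun j => (a + (-1) ^ j * a₁ + j) - m / n) y n (fun k hk => by
    rw [Finset.sum_sub_distrib, Finset.sum_const, Finset.card_range, nsmul_eq_mul, sub_nonneg]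
    rcases k with _ | k
    · simp
    · refine le_trans ?_ (partial_sum_ge n a a₁ m hm0 hm1 hm.le k hk)
      rw [mul_div_assoc', div_le_iff₀ hn0, mul_comm]
      exact mul_le_mul_of_nonneg_left (by exact_mod_cast hk) hm.le) hya hy0
  rw [← Fin.sum_univ_eq_sum_range (fun j => ((a + (-1) ^ j * a₁ + j) - m / n) * y j)] at habel
  simp only [hy] at habel
  have hprod : ∏ i : Fin n, ∏ j ∈ Finset.Ioi i, (Real.exp (-x j) - Real.exp (-x i))
      ≤ Real.exp (-∑ j : Fin n, (j : ℕ) * x j) := by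
    calc ∏ i : Fin n, ∏ j ∈ Finset.Ioi i, (Real.exp (-x j) - Real.exp (-x i))
        ≤ ∏ i : Fin n, ∏ j ∈ Finset.Ioi i, Real.exp (-x j) := by
          have hnn : ∀ i : Fin n, ∀ j ∈ Finset.Ioi i, 0 ≤ Real.exp (-x j) - Real.exp (-x i) :=
            fun i j hj => by
              rw [sub_nonneg, Real.exp_le_exp, neg_le_neg_iff]
              exact hx (Finset.mem_Ioi.1 hj).le
          refine Finset.prod_le_prod (fun i _ => Finset.prod_nonneg (hnn i)) fun i _ =>
            Finset.prod_le_prod (hnn i) fun j _ => ?_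
          linarith [Real.exp_pos (-x i)]
      _ = ∏ j : Fin n, ∏ i ∈ Finset.Iio j, Real.exp (-x j) := by
          refine Finset.prod_comm' fun i j => ?_
          simp
      _ = _ := by
          simp only [Finset.prod_const, Fin.card_Iio, ← Real.exp_nat_mul]
          rw [← Real.exp_sum, ← Finset.sum_neg_distrib]
          simp
  calc limitWeight n a a₁ x
      ≤ Real.exp (-a * ∑ j, x j) * Real.exp (-a₁ * ∑ j : Fin n, (-1 : ℝ) ^ (j : ℕ) * x j)
        * Real.exp (-∑ j : Fin n, (j : ℕ) * x j) :=
        mul_le_mul_of_nonneg_left hprod (by positivity)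
    _ ≤ _ := by
        rw [← Real.exp_add, ← Real.exp_add, Real.exp_le_exp]
        have : ∑ i : Fin n, ((a + (-1) ^ (i : ℕ) * a₁ + (i : ℕ)) - m / n) * x i
            = a * ∑ j, x j + a₁ * ∑ j : Fin n, (-1 : ℝ) ^ (j : ℕ) * x j
              + ∑ j : Fin n, (j : ℕ) * x j - m / n * ∑ j, x j := by
          rw [Finset.mul_sum, Finset.mul_sum, Finset.mul_sum, ← Finset.sum_add_distrib,
            ← Finset.sum_add_distrib, ← Finset.sum_sub_distrib]
          exact Finset.sum_congr rfl fun i _ => by ring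
        linarith

/-! ## Continuity and homogeneity of the growth process -/

lemma continuous_growth {E : Type*} [TopologicalSpace E] {X : E → ℕ → ℕ → ℝ}
    (hX : ∀ i j, Continuous fun e => X e i j) (i j l : ℕ) :
    Continuous fun e => growth (X e) i j l := by
  induction i generalizing j l with
  | zero => simp [continuous_const]
  | succ i ihi =>
    induction j generalizing l with
    | zero => simp [continuous_const]
    | succ j ihj =>
      cases l with
      | zero =>
        simp only [growth]
        exact ((ihi _ _).max (ihj _)).add (hX i j)
      | succ l =>
        simp only [growth]
        exact (((ihi _ _).max (ihj _)).add ((ihi _ _).min (ihj _))).sub (ihi _ _)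

lemma continuous_continuousShape (n : ℕ) :
    Continuous (continuousShape : (Fin n → Fin n → ℝ) → Fin n → ℝ) := by
  refine continuous_pi fun l => ?_
  unfold continuousShape
  refine continuous_growth (fun i j => ?_) n n l
  split_ifs
  · fun_prop
  · exact continuous_const

lemma growth_mul_const {c : ℝ} (hc : 0 ≤ c) (X : ℕ → ℕ → ℝ) (i j l : ℕ) :
    growth (fun i j => X i j * c) i j l = growth X i j l * c := by
  induction i generalizing j l with
  | zero => simp
  | succ i ihi =>
    induction j generalizing l with
    | zero => simp
    | succ j ihj =>
      cases l with
      | zero => simp only [growth, ihi, ihj, max_mul_of_nonneg _ _ hc, add_mul]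
      | succ l =>
        simp only [growth, ihi, ihj, max_mul_of_nonneg _ _ hc, min_mul_of_nonneg _ _ hc, add_mul,
          sub_mul]

lemma continuousShape_mul_const {n : ℕ} {c : ℝ} (hc : 0 ≤ c) (X : Fin n → Fin n → ℝ) (l : Fin n) :
    continuousShape (fun i j => X i j * c) l = continuousShape X l * c := by
  rw [continuousShape, continuousShape, ← growth_mul_const hc]
  congr 1
  funext i j
  split_ifs <;> simp

lemma continuousShape_natCast_div {n : ℕ} (X : Fin n → Fin n → ℕ) {L : ℝ} (hL : 0 < L) :
    continuousShape (fun i j => (X i j : ℝ) / L) = fun l : Fin n => (rskShape X l : ℝ) / L := by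
  funext l
  simp only [div_eq_mul_inv]
  rw [continuousShape_mul_const (inv_pos.2 hL).le (fun i j => (X i j : ℝ)),
    continuousShape_natCast, ← rskShape_eq_growthZ]
  simp

/-! ## Discretization of exponential variables -/

lemma measureReal_expMeasure_Ici {r : ℝ} (hr : 0 < r) {x : ℝ} (hx : 0 ≤ x) :
    (expMeasure r).real (Set.Ici x) = Real.exp (-(r * x)) := by
  have := isProbabilityMeasure_expMeasure hr
  have hx0 : expMeasure r {x} = 0 :=
    (withDensity_absolutelyContinuous volume (gammaPDF 1 r)) (by simp)
  have h1 : (expMeasure r).real (Set.Iio x) = (expMeasure r).real (Set.Iic x) :=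
    measureReal_congr (Iio_ae_eq_Iic' hx0)
  have h2 := cdf_expMeasure_eq hr x
  rw [if_pos hx, cdf_eq_real] at h2
  rw [← Set.compl_Iio, probReal_compl_eq_one_sub measurableSet_Iio, h1, h2]
  ring

lemma measureReal_floor_eq {Ω : Type*} [MeasurableSpace Ω] {P : Measure Ω} [IsProbabilityMeasure P]
    {Y : Ω → ℝ} (hY : Measurable Y) {r : ℝ} (hr : 0 < r) (h : P.map Y = expMeasure r)
    {L : ℝ} (hL : 0 < L) (k : ℕ) :
    P.real {ω | ⌊L * Y ω⌋₊ = k} = (1 - Real.exp (-r / L)) * Real.exp (-r / L) ^ k := by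
  have hge : ∀ k : ℕ, P.real {ω | k ≤ ⌊L * Y ω⌋₊} = Real.exp (-r / L) ^ k := by
    intro k
    rcases Nat.eq_zero_or_pos k with rfl | hk
    · simp
    · have : {ω | k ≤ ⌊L * Y ω⌋₊} = Y ⁻¹' Set.Ici (k / L) := by
        ext ω
        simp only [Set.mem_ofPred_eq, Set.mem_preimage, Set.mem_Ici]
        rw [Nat.le_floor_iff' hk.ne', div_le_iff₀' hL]
      rw [this, ← map_measureReal_apply hY measurableSet_Ici, h,
        measureReal_expMeasure_Ici hr (by positivity), ← Real.exp_nat_mul]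
      congr 1
      ring
  have hmeas : ∀ k : ℕ, MeasurableSet {ω | k ≤ ⌊L * Y ω⌋₊} := fun k =>
    measurableSet_le measurable_const (Nat.measurable_floor.comp (hY.const_mul L))
  have hsub : {ω | k + 1 ≤ ⌊L * Y ω⌋₊} ⊆ {ω | k ≤ ⌊L * Y ω⌋₊} := fun ω hω =>
    (Nat.le_succ k).trans hω
  have : {ω | ⌊L * Y ω⌋₊ = k} = {ω | k ≤ ⌊L * Y ω⌋₊} \ {ω | k + 1 ≤ ⌊L * Y ω⌋₊} := by
    ext ω
    simp only [Set.mem_ofPred_eq, Set.mem_sdiff]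
    omega
  rw [this, measureReal_sdiff hsub (hmeas _), hge, hge, pow_succ]
  ring

lemma rate_pos {n : ℕ} {a : ℝ} (h1 : 2 ≤ n → 0 < 2 * a + 1) {i j : Fin n} (hij : i < j) :
    0 < ((i : ℕ) : ℝ) + (j : ℕ) + 2 * a := by
  have h2 : (1 : ℝ) ≤ ((i : ℕ) : ℝ) + (j : ℕ) := by
    rw [Fin.lt_def] at hij
    exact_mod_cast (by omega : 1 ≤ (i : ℕ) + j)
  have h3 : 2 ≤ n := by
    have := j.2
    rw [Fin.lt_def] at hij
    omega
  linarith [h1 h3]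

lemma rate_pos_diag {n : ℕ} {a a₁ : ℝ} (h0 : 0 < a + a₁) (i : Fin n) :
    0 < ((i : ℕ) : ℝ) + a + a₁ := by
  have : (0 : ℝ) ≤ ((i : ℕ) : ℝ) := Nat.cast_nonneg _
  linarith

lemma exp_offDiag (a L : ℝ) (i j : ℕ) : Real.exp (-a / L) ^ 2 * Real.exp (-1 / L) ^ (i + j)
    = Real.exp (-((i : ℝ) + j + 2 * a) / L) := by
  rw [← Real.exp_nat_mul, ← Real.exp_nat_mul, ← Real.exp_add]
  congr 1
  push_cast
  ring

lemma exp_diag (a a₁ L : ℝ) (i : ℕ) :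
    Real.exp (-a₁ / L) * Real.exp (-a / L) * Real.exp (-1 / L) ^ i
      = Real.exp (-((i : ℝ) + a + a₁) / L) := by
  rw [← Real.exp_nat_mul, ← Real.exp_add, ← Real.exp_add]
  congr 1
  ring

/-- The discretization of a symmetric exponential matrix is a symmetric geometric matrix. -/
lemma IsSymmExponential.floor {Ω : Type*} [MeasurableSpace Ω] {P : Measure Ω}
    [IsProbabilityMeasure P] {n : ℕ} {a a₁ : ℝ} {Y : Fin n → Fin n → Ω → ℝ}
    (h : IsSymmExponential P a a₁ Y) (h0 : 0 < a + a₁) (h1 : 2 ≤ n → 0 < 2 * a + 1)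
    {L : ℝ} (hL : 0 < L) :
    IsSymmGeometric P (Real.exp (-a / L)) (Real.exp (-a₁ / L)) (Real.exp (-1 / L))
      (fun i j ω => ⌊L * Y i j ω⌋₊) where
  measurable i j := Nat.measurable_floor.comp ((h.measurable i j).const_mul L)
  symm i j ω := by rw [h.symm]
  indep := h.indep.comp (fun _ y => ⌊L * y⌋₊) fun _ =>
    Nat.measurable_floor.comp (measurable_id.const_mul L)
  offDiag i j hij k := by
    rw [measureReal_floor_eq (h.measurable i j) (rate_pos h1 hij) (h.offDiag i j hij) hL,
      exp_offDiag]
  diag i k := by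
    rw [measureReal_floor_eq (h.measurable i i) (rate_pos_diag h0 i) (h.diag i) hL, exp_diag]

lemma ae_nonneg_of_map_eq_expMeasure {Ω : Type*} [MeasurableSpace Ω] {P : Measure Ω}
    [IsProbabilityMeasure P] {Y : Ω → ℝ} (hY : Measurable Y) {r : ℝ} (hr : 0 < r)
    (h : P.map Y = expMeasure r) : ∀ᵐ ω ∂P, 0 ≤ Y ω := by
  have h1 : P.real (Y ⁻¹' Set.Ici 0) = 1 := by
    rw [← map_measureReal_apply hY measurableSet_Ici, h, measureReal_expMeasure_Ici hr le_rfl]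
    simp
  have h2 : P (Y ⁻¹' Set.Ici 0) = 1 := by
    rw [← ofReal_measureReal, h1, ENNReal.ofReal_one]
  exact (prob_compl_eq_zero_iff (hY measurableSet_Ici)).2 h2

lemma IsSymmExponential.ae_nonneg {Ω : Type*} [MeasurableSpace Ω] {P : Measure Ω}
    [IsProbabilityMeasure P] {n : ℕ} {a a₁ : ℝ} {Y : Fin n → Fin n → Ω → ℝ}
    (h : IsSymmExponential P a a₁ Y) (h0 : 0 < a + a₁) (h1 : 2 ≤ n → 0 < 2 * a + 1) :
    ∀ᵐ ω ∂P, ∀ i j, 0 ≤ Y i j ω := by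
  refine ae_all_iff.2 fun i => ae_all_iff.2 fun j => ?_
  rcases lt_trichotomy i j with hij | rfl | hij
  · exact ae_nonneg_of_map_eq_expMeasure (h.measurable i j) (rate_pos h1 hij) (h.offDiag i j hij)
  · exact ae_nonneg_of_map_eq_expMeasure (h.measurable i i) (rate_pos_diag h0 i) (h.diag i)
  · filter_upwards [ae_nonneg_of_map_eq_expMeasure (h.measurable j i) (rate_pos h1 hij)
      (h.offDiag j i hij)] with ω hω
    rwa [h.symm]

lemma tendsto_floor_mul_div {L : ℕ → ℝ} (hL' : Tendsto L atTop atTop) {y : ℝ} (hy : 0 ≤ y) :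
    Tendsto (fun N => (⌊L N * y⌋₊ : ℝ) / L N) atTop (𝓝 y) := by
  have := (tendsto_nat_floor_mul_div_atTop hy).comp hL'
  refine this.congr fun N => ?_
  simp only [Function.comp_apply]
  rw [mul_comm]

/-- Almost sure convergence of the discretized matrices. -/
lemma IsSymmExponential.ae_tendsto_floor {Ω : Type*} [MeasurableSpace Ω] {P : Measure Ω}
    [IsProbabilityMeasure P] {n : ℕ} {a a₁ : ℝ} {Y : Fin n → Fin n → Ω → ℝ}
    (h : IsSymmExponential P a a₁ Y) (h0 : 0 < a + a₁) (h1 : 2 ≤ n → 0 < 2 * a + 1)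
    {L : ℕ → ℝ} (hL' : Tendsto L atTop atTop) :
    ∀ᵐ ω ∂P, Tendsto (fun N (i j : Fin n) => (⌊L N * Y i j ω⌋₊ : ℝ) / L N) atTop
      (𝓝 fun i j => Y i j ω) := by
  filter_upwards [h.ae_nonneg h0 h1] with ω hω
  exact tendsto_pi_nhds.2 fun i => tendsto_pi_nhds.2 fun j => tendsto_floor_mul_div hL' (hω i j)

/-! ## Convergence in distribution of the rescaled matrix -/

lemma IsSymmGeometric.measurable_matrix {Ω : Type*} [MeasurableSpace Ω] {P : Measure Ω}
    {n : ℕ} {z α t : ℝ} {X : Fin n → Fin n → Ω → ℕ}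
    (h : IsSymmGeometric P z α t X) : Measurable fun ω i j => X i j ω :=
  measurable_pi_lambda _ fun i => measurable_pi_lambda _ fun j => h.measurable i j

/-- The law of a symmetric geometric matrix depends on the parameters only. -/
lemma IsSymmGeometric.map_eq {Ω Ω' : Type*} [MeasurableSpace Ω] [MeasurableSpace Ω']
    {P : Measure Ω} {P' : Measure Ω'} [IsProbabilityMeasure P] [IsProbabilityMeasure P'] {n : ℕ}
    {z α t : ℝ} {X : Fin n → Fin n → Ω → ℕ} {X' : Fin n → Fin n → Ω' → ℕ}
    (h : IsSymmGeometric P z α t X) (h' : IsSymmGeometric P' z α t X') :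
    P.map (fun ω i j => X i j ω) = P'.map (fun ω i j => X' i j ω) := by
  refine Measure.ext_of_singleton fun M => ?_
  rw [Measure.map_apply h.measurable_matrix (measurableSet_singleton M),
    Measure.map_apply h'.measurable_matrix (measurableSet_singleton M)]
  by_cases hM : ∀ i j, M i j = M j i
  · have e : (fun ω i j => X i j ω) ⁻¹' {M} = {ω | ∀ i j, X i j ω = M i j} := by
      ext ω
      simp [funext_iff]
    have e' : (fun ω i j => X' i j ω) ⁻¹' {M} = {ω | ∀ i j, X' i j ω = M i j} := by
      ext ω
      simp [funext_iff]
    rw [e, e', ← ofReal_measureReal, ← ofReal_measureReal (μ := P'),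
      h.measureReal_eq ⟨M, hM⟩, h'.measureReal_eq ⟨M, hM⟩]
  · have e : (fun ω i j => X i j ω) ⁻¹' {M} = ∅ := by
      refine Set.eq_empty_of_forall_notMem fun ω hω => hM fun i j => ?_
      rw [← show (fun i j => X i j ω) = M from hω]
      exact h.symm i j ω
    have e' : (fun ω i j => X' i j ω) ⁻¹' {M} = ∅ := by
      refine Set.eq_empty_of_forall_notMem fun ω hω => hM fun i j => ?_
      rw [← show (fun i j => X' i j ω) = M from hω]
      exact h'.symm i j ω
    rw [e, e', measure_empty, measure_empty]

lemma measurable_natCast_div (n : ℕ) (L : ℝ) :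
    Measurable fun (M : Fin n → Fin n → ℕ) (i j : Fin n) => (M i j : ℝ) / L :=
  measurable_pi_lambda _ fun i => measurable_pi_lambda _ fun j =>
    (measurable_from_top.comp ((measurable_pi_apply j).comp (measurable_pi_apply i))).div_const L

/-- The rescaled geometric matrix converges in distribution to the exponential matrix. -/
theorem tendstoInDistribution_matrix {n : ℕ} {a a₁ : ℝ} (h0 : 0 < a + a₁)
    (h1 : 2 ≤ n → 0 < 2 * a + 1) {L : ℕ → ℝ} (hL : ∀ N, 0 < L N) (hL' : Tendsto L atTop atTop)
    {Ω : ℕ → Type*} [∀ N, MeasurableSpace (Ω N)] {P : ∀ N, Measure (Ω N)}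
    [∀ N, IsProbabilityMeasure (P N)] {X : ∀ N, Fin n → Fin n → Ω N → ℕ}
    (hX : ∀ N, IsSymmGeometric (P N) (Real.exp (-a / L N)) (Real.exp (-a₁ / L N))
      (Real.exp (-1 / L N)) (X N))
    {Ω' : Type*} [MeasurableSpace Ω'] {P' : Measure Ω'} [IsProbabilityMeasure P']
    {Y : Fin n → Fin n → Ω' → ℝ} (hY : IsSymmExponential P' a a₁ Y) :
    TendstoInDistribution (fun N ω (i j : Fin n) => (X N i j ω : ℝ) / L N) atTop
      (fun ω (i j : Fin n) => Y i j ω) P P' := by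
  have hmeas : ∀ N, Measurable fun ω (i j : Fin n) => (X N i j ω : ℝ) / L N := fun N =>
    (measurable_natCast_div n (L N)).comp (hX N).measurable_matrix
  have hmeas' : ∀ N, Measurable fun ω (i j : Fin n) => (⌊L N * Y i j ω⌋₊ : ℝ) / L N := fun N =>
    (measurable_natCast_div n (L N)).comp (hY.floor h0 h1 (hL N)).measurable_matrix
  have hYm : Measurable fun ω (i j : Fin n) => Y i j ω :=
    measurable_pi_lambda _ fun i => measurable_pi_lambda _ fun j => hY.measurable i j
  have key : TendstoInDistribution (fun N ω (i j : Fin n) => (⌊L N * Y i j ω⌋₊ : ℝ) / L N) atTop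
      (fun ω (i j : Fin n) => Y i j ω) (fun _ => P') P' :=
    tendstoInDistribution_of_ae_tendsto (fun N => (hmeas' N).aemeasurable) hYm.aemeasurable
      (hY.ae_tendsto_floor h0 h1 hL')
  refine ⟨fun N => (hmeas N).aemeasurable, hYm.aemeasurable, ?_⟩
  refine key.tendsto.congr fun N => Subtype.ext (Eq.symm ?_)
  change (P N).map _ = P'.map _
  have := congrArg (Measure.map fun (M : Fin n → Fin n → ℕ) (i j : Fin n) => (M i j : ℝ) / L N)
    ((hX N).map_eq (hY.floor h0 h1 (hL N)))
  rwa [Measure.map_map (measurable_natCast_div n (L N)) (hX N).measurable_matrix,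
    Measure.map_map (measurable_natCast_div n (L N))
      (hY.floor h0 h1 (hL N)).measurable_matrix] at this

/-! ## Existence of symmetric exponential matrices -/

lemma exists_isSymmExponential (n : ℕ) {a a₁ : ℝ} (h0 : 0 < a + a₁) (h1 : 2 ≤ n → 0 < 2 * a + 1) :
    ∃ (Ω : Type) (_ : MeasurableSpace Ω) (P : Measure Ω) (_ : IsProbabilityMeasure P)
      (Y : Fin n → Fin n → Ω → ℝ), IsSymmExponential P a a₁ Y := by
  let ι := {p : Fin n × Fin n // p.1 ≤ p.2}
  let r : ι → ℝ := fun p => if p.1.1 = p.1.2 then ((p.1.1 : ℕ) : ℝ) + a + a₁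
    else ((p.1.1 : ℕ) : ℝ) + (p.1.2 : ℕ) + 2 * a
  have hr : ∀ p, 0 < r p := fun p => by
    simp only [r]
    split_ifs with h
    · exact rate_pos_diag h0 _
    · exact rate_pos h1 (lt_of_le_of_ne p.2 h)
  have hprob : ∀ p, IsProbabilityMeasure (expMeasure (r p)) := fun p =>
    isProbabilityMeasure_expMeasure (hr p)
  have hle : ∀ i j : Fin n, min i j ≤ max i j := fun i j => min_le_max
  refine ⟨ι → ℝ, inferInstance, Measure.pi fun p => expMeasure (r p), inferInstance,
    fun i j ω => ω ⟨(min i j, max i j), hle i j⟩, ?_⟩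
  have hmap : ∀ p : ι, (Measure.pi fun p => expMeasure (r p)).map (fun ω => ω p)
      = expMeasure (r p) := fun p => (measurePreserving_eval _ p).map_eq
  refine ⟨fun i j => measurable_pi_apply _, fun i j ω => ?_, ?_, fun i j hij => ?_, fun i => ?_⟩
  · simp only [min_comm i j, max_comm i j]
  · have h := iIndepFun_pi (μ := fun p => expMeasure (r p)) (X := fun (_ : ι) (y : ℝ) => y)
      fun _ => aemeasurable_id
    convert h using 3 with p
    refine congrArg _ (Subtype.ext (Prod.ext ?_ ?_))
    · exact min_eq_left p.2
    · exact max_eq_right p.2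
  · rw [hmap]
    simp [r, min_eq_left hij.le, max_eq_right hij.le, hij.ne]
  · rw [hmap]
    simp [r]

/-! ## Riemann sums over the positive orthant -/

/-- The open positive orthant. -/
def orthant (n : ℕ) : Set (Fin n → ℝ) := Set.univ.pi fun _ => Set.Ioi 0

/-- The index of the cube of side `1 / L` that contains a point of the positive orthant. -/
noncomputable def cubeIndex {n : ℕ} (L : ℝ) (x : Fin n → ℝ) (j : Fin n) : ℕ := ⌈L * x j⌉₊ - 1

lemma measurable_cubeIndex {n : ℕ} (L : ℝ) : Measurable (cubeIndex (n := n) L) := by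
  refine measurable_pi_lambda _ fun j => (measurable_of_countable fun k : ℕ => k - 1).comp
    (Nat.measurable_ceil.comp ?_)
  fun_prop

lemma ceil_sub_one_eq_iff {L x : ℝ} (hL : 0 < L) (hx : 0 < x) (k : ℕ) :
    ⌈L * x⌉₊ - 1 = k ↔ k / L < x ∧ x ≤ (k + 1) / L := by
  have h1 : 0 < ⌈L * x⌉₊ := Nat.ceil_pos.2 (mul_pos hL hx)
  have h2 : ⌈L * x⌉₊ - 1 = k ↔ ⌈L * x⌉₊ = k + 1 := by omega
  rw [h2, Nat.ceil_eq_iff (by omega), Nat.add_sub_cancel, div_lt_iff₀' hL, le_div_iff₀' hL]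
  push_cast
  rfl

lemma cubeIndex_preimage {n : ℕ} {L : ℝ} (hL : 0 < L) (μ : Fin n → ℕ) :
    cubeIndex L ⁻¹' {μ} ∩ orthant n
      = Set.univ.pi fun j => Set.Ioc ((μ j : ℝ) / L) ((μ j + 1) / L) := by
  ext x
  simp only [Set.mem_inter_iff, Set.mem_preimage, Set.mem_singleton_iff, orthant, Set.mem_pi,
    Set.mem_univ, true_imp_iff, Set.mem_Ioi, Set.mem_Ioc, funext_iff, cubeIndex]
  constructor
  · rintro ⟨h1, h2⟩ j
    exact (ceil_sub_one_eq_iff hL (h2 j) _).1 (h1 j)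
  · intro h
    have hpos : ∀ j, 0 < x j := fun j => lt_of_le_of_lt (by positivity) (h j).1
    exact ⟨fun j => (ceil_sub_one_eq_iff hL (hpos j) _).2 (h j), hpos⟩

lemma lintegral_cubeIndex {n : ℕ} {L : ℝ} (hL : 0 < L) (Ψ : (Fin n → ℕ) → ENNReal) :
    ∫⁻ x in orthant n, ENNReal.ofReal (L ^ n) * Ψ (cubeIndex L x) = ∑' μ, Ψ μ := by
  rw [← lintegral_map (f := fun μ => ENNReal.ofReal (L ^ n) * Ψ μ) (measurable_of_countable _)
    (measurable_cubeIndex L), lintegral_countable']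
  refine tsum_congr fun μ => ?_
  rw [Measure.map_apply (measurable_cubeIndex L) (measurableSet_singleton μ),
    Measure.restrict_apply (measurable_cubeIndex L (measurableSet_singleton μ)),
    cubeIndex_preimage hL, Real.volume_pi_Ioc]
  have : ∀ j : Fin n, ((μ j : ℝ) + 1) / L - μ j / L = L⁻¹ := fun j => by ring
  simp only [this, Finset.prod_const, Finset.card_univ, Fintype.card_fin]
  rw [mul_right_comm, ← ENNReal.ofReal_pow (inv_pos.2 hL).le, ← ENNReal.ofReal_mul (by positivity),
    ← mul_pow, mul_inv_cancel₀ hL.ne', one_pow, ENNReal.ofReal_one, one_mul]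

/-! ## The law of the shape of a geometric matrix -/

lemma isPart_rskShape {n : ℕ} (M : SymMat n) : IsPart n fun k => (rskShape M.1 k : ℤ) := by
  have := M.chain.isPart_last
  convert this using 1
  exact funext fun k => rskShape_eq_growthZ M.1 k

lemma rskShape_eq_iff {n : ℕ} (M : SymMat n) (μ : Fin n → ℕ) :
    (fun l : Fin n => rskShape M.1 l) = μ ↔ HasRSKShape M.1 μ := by
  constructor
  · rintro rfl k
    split_ifs with hk
    · rfl
    · exact Int.ofNat_inj.1 ((isPart_rskShape M).2 k (by omega))
  · intro h
    funext l
    simpa using h l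

lemma antitone_rskShape {n : ℕ} (M : SymMat n) : Antitone fun l : Fin n => rskShape M.1 l :=
  fun a b hab => Int.ofNat_le.1 ((isPart_rskShape M).1 (show (a : ℕ) ≤ b from hab))

open scoped Classical in
lemma IsSymmGeometric.lintegral_rskShape {Ω : Type*} [MeasurableSpace Ω] {P : Measure Ω}
    [IsProbabilityMeasure P] {n : ℕ} {z α t : ℝ} {X : Fin n → Fin n → Ω → ℕ}
    (h : IsSymmGeometric P z α t X) (hz : 0 < z) (hα : 0 < α) (ht : 0 < t) (ht1 : t ≠ 1)
    (hoff : ∀ i j : Fin n, i < j → z ^ 2 * t ^ ((i : ℕ) + (j : ℕ)) < 1)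
    (hdiag : ∀ i : Fin n, α * z * t ^ (i : ℕ) < 1) (f : (Fin n → ℕ) → ENNReal) :
    ∫⁻ ω, f (fun l => rskShape (fun i j => X i j ω) l) ∂P
      = ∑' μ : Fin n → ℕ, if Antitone μ then
        ENNReal.ofReal (discreteProb n z α t fun j => μ j + (n - 1 - (j : ℕ))) * f μ else 0 := by
  have hS : Measurable fun ω => fun l : Fin n => rskShape (fun i j => X i j ω) l :=
    (measurable_of_countable fun (M : Fin n → Fin n → ℕ) (l : Fin n) => rskShape M l).comp
      h.measurable_matrix
  rw [← lintegral_map (measurable_of_countable f) hS, lintegral_countable']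
  refine tsum_congr fun μ => ?_
  rw [Measure.map_apply hS (measurableSet_singleton μ), mul_comm]
  split_ifs with hμ
  · rw [← h.measure_hasRSKShape hz hα ht ht1 hoff hdiag μ hμ]
    congr 2
    ext ω
    exact rskShape_eq_iff (h.toSymMat ω) μ
  · have : (fun ω => fun l : Fin n => rskShape (fun i j => X i j ω) l) ⁻¹' {μ} = ∅ := by
      refine Set.eq_empty_of_forall_notMem fun ω hω => hμ ?_
      rw [← show (fun l : Fin n => rskShape (fun i j => X i j ω) l) = μ from hω]
      exact antitone_rskShape (h.toSymMat ω)
    rw [this, measure_empty, zero_mul]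

/-! ## The density of the continuous shape -/

lemma measurableSet_chamber (n : ℕ) : MeasurableSet (chamber n) := by
  have h : chamber n = {x | ∀ i j : Fin n, i < j → x j < x i} ∩ {x | ∀ j, 0 < x j} := by
    ext x
    exact and_congr ⟨fun h i j => @h i j, fun h i j => h i j⟩ Iff.rfl
  rw [h]
  refine MeasurableSet.inter ?_ ?_
  · simp only [Set.ofPred_forall]
    exact MeasurableSet.iInter fun i => MeasurableSet.iInter fun j => MeasurableSet.iInter fun _ =>
      measurableSet_lt (measurable_pi_apply j) (measurable_pi_apply i)
  · simp only [Set.ofPred_forall]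
    exact MeasurableSet.iInter fun j => measurableSet_lt measurable_const (measurable_pi_apply j)

lemma measurableSet_orthant (n : ℕ) : MeasurableSet (orthant n) :=
  MeasurableSet.univ_pi fun _ => measurableSet_Ioi

lemma continuous_limitDensity (n : ℕ) (a a₁ : ℝ) : Continuous (limitDensity n a a₁) := by
  have : limitDensity n a a₁ = fun x => limitConst n a a₁ * limitWeight n a a₁ x :=
    funext (limitDensity_eq n a a₁)
  rw [this]
  exact continuous_const.mul (continuous_limitWeight n a a₁)

lemma measurable_limitDensity_indicator (n : ℕ) (a a₁ : ℝ) :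
    Measurable ((chamber n).indicator fun x => ENNReal.ofReal (limitDensity n a a₁ x)) :=
  (ENNReal.measurable_ofReal.comp (continuous_limitDensity n a a₁).measurable).indicator
    (measurableSet_chamber n)

lemma lintegral_limitMeasure (n : ℕ) (a a₁ : ℝ) (f : (Fin n → ℝ) → ENNReal) (hf : Measurable f) :
    ∫⁻ x, f x ∂limitMeasure n a a₁ = ∫⁻ x in orthant n,
      (chamber n).indicator (fun x => ENNReal.ofReal (limitDensity n a a₁ x)) x * f x := by
  rw [limitMeasure, lintegral_withDensity_eq_lintegral_mul _
    (measurable_limitDensity_indicator n a a₁) hf, ← lintegral_indicator (measurableSet_orthant n)]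
  refine lintegral_congr fun x => ?_
  by_cases hx : x ∈ orthant n
  · rw [Set.indicator_of_mem hx]
    rfl
  · have : x ∉ chamber n := fun h => hx fun j _ => h.2 j
    rw [Set.indicator_of_notMem hx, Pi.mul_apply, Set.indicator_of_notMem this, zero_mul]

lemma lintegral_exp_bound_ne_top (n : ℕ) {ε : ℝ} (hε : 0 < ε) (C : ENNReal) (hC : C ≠ ⊤) :
    ∫⁻ x in orthant n, ENNReal.ofReal (∏ j, Real.exp (-ε * (x j - 1))) * C ≠ ⊤ := by
  have h1 : Integrable (fun y : ℝ => Real.exp (-ε * (y - 1))) (volume.restrict (Set.Ioi 0)) := by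
    have := (exp_neg_integrableOn_Ioi 0 hε).const_mul (Real.exp ε)
    refine this.congr (Eventually.of_forall fun y => ?_)
    simp only
    rw [← Real.exp_add]
    congr 1
    ring
  have h2 : Integrable (fun x : Fin n → ℝ => ∏ j, Real.exp (-ε * (x j - 1)))
      (volume.restrict (orthant n)) := by
    rw [orthant, volume_pi, Measure.restrict_pi_pi]
    exact Integrable.fintype_prod (f := fun _ y => Real.exp (-ε * (y - 1))) fun _ => h1
  rw [lintegral_mul_const' _ _ hC]
  exact ENNReal.mul_ne_top h2.lintegral_lt_top.ne hC

lemma tendsto_cubeIndex_add {L : ℕ → ℝ} (hL : ∀ N, 0 < L N) (hL' : Tendsto L atTop atTop) {n : ℕ}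
    {x : Fin n → ℝ} (hx : ∀ j, 0 < x j) (c : ℕ) (j : Fin n) :
    Tendsto (fun N => ((cubeIndex (L N) x j + c : ℕ) : ℝ) / L N) atTop (𝓝 (x j)) := by
  have h1 : Tendsto (fun N => (⌈x j * L N⌉₊ : ℝ) / L N + (c - 1) / L N) atTop (𝓝 (x j + 0)) :=
    ((tendsto_nat_ceil_mul_div_atTop (hx j).le).comp hL').add (tendsto_const_nhds.div_atTop hL')
  rw [add_zero] at h1
  refine h1.congr fun N => ?_
  have h2 : 0 < ⌈L N * x j⌉₊ := Nat.ceil_pos.2 (mul_pos (hL N) (hx j))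
  rw [cubeIndex, Nat.cast_add, Nat.cast_sub h2, mul_comm (x j)]
  push_cast
  ring

lemma le_cubeIndex_div {L : ℝ} (hL : 1 ≤ L) {n : ℕ} (x : Fin n → ℝ) (j : Fin n) :
    x j - 1 ≤ (cubeIndex L x j : ℝ) / L := by
  have h0 : 0 < L := by linarith
  rw [le_div_iff₀ h0, cubeIndex]
  have h1 : L * x j ≤ ⌈L * x j⌉₊ := Nat.le_ceil _
  have h2 : (⌈L * x j⌉₊ : ℝ) ≤ ((⌈L * x j⌉₊ - 1 : ℕ) : ℝ) + 1 := by
    exact_mod_cast (by omega : ⌈L * x j⌉₊ ≤ ⌈L * x j⌉₊ - 1 + 1)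
  nlinarith

lemma antitone_cubeIndex {L : ℝ} (hL : 0 < L) {n : ℕ} {x : Fin n → ℝ} (hx : Antitone x) :
    Antitone (cubeIndex L x) := fun _ _ hij =>
  Nat.sub_le_sub_right (Nat.ceil_mono (mul_le_mul_of_nonneg_left (hx hij) hL.le)) 1

lemma limitWeight_eq_zero {n : ℕ} (a a₁ : ℝ) {x : Fin n → ℝ} {i j : Fin n} (hij : i < j)
    (h : x i = x j) : limitWeight n a a₁ x = 0 := by
  rw [limitWeight, Finset.prod_eq_zero (Finset.mem_univ i), mul_zero]
  exact Finset.prod_eq_zero (Finset.mem_Ioi.2 hij) (by rw [h, sub_self])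

open scoped Classical in
lemma tendsto_density_cubeIndex {n : ℕ} (hn : 1 ≤ n) {a a₁ : ℝ} (h0 : 0 < a + a₁)
    (h1 : 2 ≤ n → 0 < 2 * a + 1) {L : ℕ → ℝ} (hL : ∀ N, 0 < L N) (hL' : Tendsto L atTop atTop)
    {x : Fin n → ℝ} (hx : x ∈ orthant n) :
    Tendsto (fun N => if Antitone (cubeIndex (L N) x) then ENNReal.ofReal (L N ^ n *
      discreteProb n (Real.exp (-a / L N)) (Real.exp (-a₁ / L N)) (Real.exp (-1 / L N))
        fun j => cubeIndex (L N) x j + (n - 1 - (j : ℕ))) else 0) atTop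
      (𝓝 ((chamber n).indicator (fun x => ENNReal.ofReal (limitDensity n a a₁ x)) x)) := by
  have hx0 : ∀ j, 0 < x j := fun j => hx j (Set.mem_univ j)
  have hlim := ENNReal.tendsto_ofReal (tendsto_mul_discreteProb n hn a a₁ h0 h1 hL hL' x
    (fun N j => cubeIndex (L N) x j + (n - 1 - (j : ℕ)))
    fun j => tendsto_cubeIndex_add hL hL' hx0 _ j)
  by_cases hanti : StrictAnti x
  · rw [Set.indicator_of_mem (show x ∈ chamber n from ⟨hanti, hx0⟩)]
    refine hlim.congr fun N => ?_
    rw [if_pos (antitone_cubeIndex (hL N) hanti.antitone)]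
  · rw [Set.indicator_of_notMem fun h : x ∈ chamber n => hanti h.1]
    obtain ⟨i, j, hij, hle⟩ : ∃ i j : Fin n, i < j ∧ x i ≤ x j := by
      by_contra! hcon
      exact hanti fun i j hij => hcon i j hij
    rcases hle.lt_or_eq with hlt | heq
    · have ht1 := tendsto_cubeIndex_add hL hL' hx0 0 i
      have ht2 := tendsto_cubeIndex_add hL hL' hx0 0 j
      refine tendsto_const_nhds.congr' ?_
      filter_upwards [ht1.eventually_lt ht2 hlt] with N hN
      rw [if_neg]
      intro hA
      rw [div_lt_div_iff_of_pos_right (hL N), Nat.cast_lt] at hN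
      exact absurd (hA hij.le) (by omega)
    · rw [limitDensity_eq, limitWeight_eq_zero a a₁ hij heq, mul_zero, ENNReal.ofReal_zero] at hlim
      refine tendsto_of_tendsto_of_tendsto_of_le_of_le tendsto_const_nhds hlim
        (fun _ => zero_le) fun N => ?_
      simp only
      split_ifs
      exacts [le_rfl, zero_le]

lemma mul_discreteProb_le {n : ℕ} {a a₁ ε K L : ℝ} (hε : 0 < ε)
    (hw : ∀ x : Fin n → ℝ, Antitone x → (∀ j, 0 ≤ x j) →
      limitWeight n a a₁ x ≤ Real.exp (-ε * ∑ j, x j)) (hL : 1 ≤ L)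
    (hK0 : 0 ≤ L ^ n * discreteConst n (Real.exp (-a / L)) (Real.exp (-a₁ / L)) (Real.exp (-1 / L)))
    (hK : L ^ n * discreteConst n (Real.exp (-a / L)) (Real.exp (-a₁ / L)) (Real.exp (-1 / L)) ≤ K)
    (x : Fin n → ℝ) (hx : Antitone (cubeIndex L x)) :
    L ^ n * discreteProb n (Real.exp (-a / L)) (Real.exp (-a₁ / L)) (Real.exp (-1 / L))
      (fun j => cubeIndex L x j + (n - 1 - (j : ℕ))) ≤ (∏ j, Real.exp (-ε * (x j - 1))) * K := by
  have hL0 : 0 < L := by linarith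
  rw [discreteProb_exp, ← mul_assoc, mul_comm _ K]
  refine mul_le_mul hK ((hw _ ?_ fun j => by positivity).trans ?_) ?_ (hK0.trans hK)
  · intro i j hij
    have := hx hij
    rw [Fin.le_def] at hij
    refine div_le_div_of_nonneg_right ?_ hL0.le
    exact_mod_cast (by omega : cubeIndex L x j + (n - 1 - (j : ℕ))
      ≤ cubeIndex L x i + (n - 1 - (i : ℕ)))
  · rw [← Real.exp_sum, Real.exp_le_exp, ← Finset.mul_sum, neg_mul, neg_mul, neg_le_neg_iff]
    refine mul_le_mul_of_nonneg_left (Finset.sum_le_sum fun j _ => ?_) hε.le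
    refine (le_cubeIndex_div hL x j).trans (div_le_div_of_nonneg_right ?_ hL0.le)
    exact_mod_cast Nat.le_add_right _ _
  · refine mul_nonneg (by positivity) (Finset.prod_nonneg fun i _ => Finset.prod_nonneg fun j hj => ?_)
    rw [sub_nonneg, Real.exp_le_exp, neg_le_neg_iff]
    refine div_le_div_of_nonneg_right ?_ hL0.le
    have hij := (Finset.mem_Ioi.1 hj).le
    have := hx hij
    rw [Fin.le_def] at hij
    exact_mod_cast (by omega : cubeIndex L x j + (n - 1 - (j : ℕ))
      ≤ cubeIndex L x i + (n - 1 - (i : ℕ)))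

lemma IsSymmExponential.lintegral_continuousShape {Ω : Type*} [MeasurableSpace Ω] {P : Measure Ω}
    [IsProbabilityMeasure P] {n : ℕ} (hn : 1 ≤ n) {a a₁ : ℝ} {Y : Fin n → Fin n → Ω → ℝ}
    (h : IsSymmExponential P a a₁ Y) (h0 : 0 < a + a₁) (h1 : 2 ≤ n → 0 < 2 * a + 1)
    (φ : BoundedContinuousFunction (Fin n → ℝ) NNReal) :
    ∫⁻ ω, φ (continuousShape fun i j => Y i j ω) ∂P = ∫⁻ x, φ x ∂limitMeasure n a a₁ := by
  classical
  let L : ℕ → ℝ := fun N => N + 1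
  have hL1 : ∀ N, 1 ≤ L N := fun N => by simp [L]
  have hL : ∀ N, 0 < L N := fun N => by linarith [hL1 N]
  have hL' : Tendsto L atTop atTop := tendsto_atTop_add_const_right _ _ tendsto_natCast_atTop_atTop
  have hφ : Measurable fun x => (φ x : ENNReal) :=
    measurable_coe_nnreal_ennreal.comp φ.continuous.measurable
  obtain ⟨C, hC⟩ : ∃ C : NNReal, ∀ x, (φ x : ENNReal) ≤ C := ⟨nndist φ 0, fun x => by
    have := BoundedContinuousFunction.NNReal.upper_bound φ x
    exact_mod_cast this⟩
  have hgeo := fun N => h.floor h0 h1 (hL N)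
  have ht1 : ∀ N, Real.exp (-1 / L N) ≠ 1 := fun N => by
    rw [Ne, Real.exp_eq_one_iff]
    exact (div_neg_of_neg_of_pos (by norm_num) (hL N)).ne
  have hoff : ∀ N, ∀ i j : Fin n, i < j →
      Real.exp (-a / L N) ^ 2 * Real.exp (-1 / L N) ^ ((i : ℕ) + (j : ℕ)) < 1 := fun N i j hij => by
    rw [exp_offDiag, Real.exp_lt_one_iff]
    exact div_neg_of_neg_of_pos (neg_neg_of_pos (rate_pos h1 hij)) (hL N)
  have hdiag : ∀ N, ∀ i : Fin n,
      Real.exp (-a₁ / L N) * Real.exp (-a / L N) * Real.exp (-1 / L N) ^ (i : ℕ) < 1 := fun N i => by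
    rw [exp_diag, Real.exp_lt_one_iff]
    exact div_neg_of_neg_of_pos (neg_neg_of_pos (rate_pos_diag h0 i)) (hL N)
  let F : ℕ → (Fin n → ℝ) → ENNReal := fun N x =>
    (if Antitone (cubeIndex (L N) x) then ENNReal.ofReal (L N ^ n *
      discreteProb n (Real.exp (-a / L N)) (Real.exp (-a₁ / L N)) (Real.exp (-1 / L N))
        fun j => cubeIndex (L N) x j + (n - 1 - (j : ℕ))) else 0)
      * φ fun j => (cubeIndex (L N) x j : ℝ) / L N
  have hF : ∀ N, ∫⁻ ω, φ (continuousShape fun i j => (⌊L N * Y i j ω⌋₊ : ℝ) / L N) ∂P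
      = ∫⁻ x in orthant n, F N x := by
    intro N
    have e1 := (hgeo N).lintegral_rskShape (Real.exp_pos _) (Real.exp_pos _) (Real.exp_pos _)
      (ht1 N) (hoff N) (hdiag N) fun μ => φ fun j => (μ j : ℝ) / L N
    rw [← lintegral_cubeIndex (hL N)] at e1
    refine Eq.trans ?_ (e1.trans ?_)
    · refine lintegral_congr fun ω => ?_
      rw [continuousShape_natCast_div (fun i j => ⌊L N * Y i j ω⌋₊) (hL N)]
    · refine lintegral_congr fun x => ?_
      simp only [F]
      split_ifs
      · rw [← mul_assoc, ENNReal.ofReal_mul (pow_pos (hL N) n).le]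
      · simp
  have hlimL : Tendsto (fun N => ∫⁻ ω, φ (continuousShape fun i j => (⌊L N * Y i j ω⌋₊ : ℝ) / L N) ∂P)
      atTop (𝓝 (∫⁻ ω, φ (continuousShape fun i j => Y i j ω) ∂P)) := by
    refine tendsto_lintegral_of_dominated_convergence (fun _ => (C : ENNReal)) (fun N => ?_)
      (fun N => Eventually.of_forall fun ω => hC _) (by simp) ?_
    · exact hφ.comp ((continuous_continuousShape n).measurable.comp
        ((measurable_natCast_div n (L N)).comp (hgeo N).measurable_matrix))
    · filter_upwards [h.ae_tendsto_floor h0 h1 hL'] with ω hω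
      refine ENNReal.tendsto_coe.2 ?_
      exact (φ.continuous.tendsto _).comp (((continuous_continuousShape n).tendsto _).comp hω)
  obtain ⟨ε, hε, hw⟩ := limitWeight_le hn a a₁ h0 h1
  have hcpos := limitConst_pos n hn a a₁ h0 h1
  have hconst := tendsto_mul_discreteConst n hn a a₁ h0 h1 hL hL'
  have hlimR : Tendsto (fun N => ∫⁻ x in orthant n, F N x) atTop
      (𝓝 (∫⁻ x, φ x ∂limitMeasure n a a₁)) := by
    rw [lintegral_limitMeasure n a a₁ _ hφ]
    refine tendsto_lintegral_filter_of_dominated_convergence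
      (fun x => ENNReal.ofReal (∏ j, Real.exp (-ε * (x j - 1)))
        * (ENNReal.ofReal (limitConst n a a₁ + 1) * C)) (Eventually.of_forall fun N => ?_) ?_ ?_ ?_
    · exact (measurable_of_countable fun μ : Fin n → ℕ => (if Antitone μ then ENNReal.ofReal (L N ^ n *
        discreteProb n (Real.exp (-a / L N)) (Real.exp (-a₁ / L N)) (Real.exp (-1 / L N))
        fun j => μ j + (n - 1 - (j : ℕ))) else 0) * (φ fun j => (μ j : ℝ) / L N : ENNReal)).comp
        (measurable_cubeIndex (L N))
    · filter_upwards [hconst.eventually_const_lt hcpos,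
        hconst.eventually_lt_const (lt_add_one (limitConst n a a₁))] with N hN1 hN2
      refine Eventually.of_forall fun x => ?_
      simp only [F]
      rw [← mul_assoc]
      refine mul_le_mul' ?_ (hC _)
      split_ifs with hA
      · rw [← ENNReal.ofReal_mul (by positivity)]
        exact ENNReal.ofReal_le_ofReal
          (mul_discreteProb_le hε hw (hL1 N) hN1.le hN2.le x hA)
      · exact zero_le
    · exact lintegral_exp_bound_ne_top n hε _
        (ENNReal.mul_ne_top ENNReal.ofReal_ne_top ENNReal.coe_ne_top)
    · refine (ae_restrict_iff' (measurableSet_orthant n)).2 (Eventually.of_forall fun x hx => ?_)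
      refine ENNReal.Tendsto.mul (tendsto_density_cubeIndex hn h0 h1 hL hL' hx)
        (Or.inr ENNReal.coe_ne_top) ?_ (Or.inr ?_)
      · refine ENNReal.tendsto_coe.2 ((φ.continuous.tendsto _).comp (tendsto_pi_nhds.2 fun j => ?_))
        exact tendsto_cubeIndex_add hL hL' (fun j => hx j (Set.mem_univ j)) 0 j
      · rw [Set.indicator_apply]
        split_ifs
        exacts [ENNReal.ofReal_ne_top, ENNReal.zero_ne_top]
  simp only [hF] at hlimL
  exact tendsto_nhds_unique hlimL hlimR

/-- The continuous RSK shape of a symmetric exponential matrix has the limiting density. -/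
theorem IsSymmExponential.map_continuousShape {Ω : Type*} [MeasurableSpace Ω] {P : Measure Ω}
    [IsProbabilityMeasure P] {n : ℕ} (hn : 1 ≤ n) {a a₁ : ℝ} {Y : Fin n → Fin n → Ω → ℝ}
    (h : IsSymmExponential P a a₁ Y) (h0 : 0 < a + a₁) (h1 : 2 ≤ n → 0 < 2 * a + 1) :
    P.map (fun ω => continuousShape fun i j => Y i j ω) = limitMeasure n a a₁ := by
  have hm : Measurable fun ω => continuousShape fun i j => Y i j ω :=
    (continuous_continuousShape n).measurable.comp
      (measurable_pi_lambda _ fun i => measurable_pi_lambda _ fun j => h.measurable i j)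
  have : IsFiniteMeasure (P.map fun ω => continuousShape fun i j => Y i j ω) :=
    Measure.isFiniteMeasure_map _ _
  refine ext_of_forall_lintegral_eq_of_IsFiniteMeasure fun φ => ?_
  have hφ : Measurable fun x => (φ x : ENNReal) :=
    measurable_coe_nnreal_ennreal.comp φ.continuous.measurable
  rw [lintegral_map hφ hm, h.lintegral_continuousShape hn h0 h1]

theorem isProbabilityMeasure_limitMeasure {n : ℕ} (hn : 1 ≤ n) {a a₁ : ℝ} (h0 : 0 < a + a₁)
    (h1 : 2 ≤ n → 0 < 2 * a + 1) : IsProbabilityMeasure (limitMeasure n a a₁) := by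
  obtain ⟨Ω, _, P, _, Y, hY⟩ := exists_isSymmExponential n h0 h1
  rw [← hY.map_continuousShape hn h0 h1]
  refine Measure.isProbabilityMeasure_map (Measurable.aemeasurable ?_)
  exact (continuous_continuousShape n).measurable.comp
    (measurable_pi_lambda _ fun i => measurable_pi_lambda _ fun j => hY.measurable i j)

/-! ## The exponential change of variables -/

/-- The exponential change of variables. -/
noncomputable def expNeg (N : ℕ) (x : Fin N → ℝ) (j : Fin N) : ℝ := Real.exp (-x j)

lemma injective_expNeg (N : ℕ) : Function.Injective (expNeg N) := fun _ _ h => funext fun j =>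
  neg_injective (Real.exp_injective (congrFun h j))

lemma measurable_expNeg_rev (N : ℕ) :
    Measurable fun (x : Fin N → ℝ) (j : Fin N) => Real.exp (-x (Fin.rev j)) := by
  fun_prop

lemma lintegral_image_expNeg (N : ℕ) {s : Set (Fin N → ℝ)} (hs : MeasurableSet s)
    (g : (Fin N → ℝ) → ENNReal) :
    ∫⁻ y in expNeg N '' s, g y = ∫⁻ x in s, ENNReal.ofReal (∏ j, Real.exp (-x j)) * g (expNeg N x) := by
  let f' : (Fin N → ℝ) → (Fin N → ℝ) →L[ℝ] (Fin N → ℝ) := fun x =>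
    ContinuousLinearMap.pi fun j =>
      (ContinuousLinearMap.toSpanSingleton ℝ (-Real.exp (-x j))).comp (ContinuousLinearMap.proj j)
  have hf' : ∀ x, HasFDerivAt (expNeg N) (f' x) x := fun x => by
    refine hasFDerivAt_pi.2 fun j => ?_
    have h1 : HasDerivAt (fun y : ℝ => Real.exp (-y)) (-Real.exp (-x j)) (x j) := by
      simpa using (hasDerivAt_neg (x j)).exp
    exact HasFDerivAt.comp (g := fun y : ℝ => Real.exp (-y)) (f := fun x : Fin N → ℝ => x j) x
      h1.hasFDerivAt (hasFDerivAt_apply j x)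
  rw [lintegral_image_eq_lintegral_abs_det_fderiv_mul volume hs
    (fun x _ => (hf' x).hasFDerivWithinAt) (injective_expNeg N).injOn]
  refine lintegral_congr fun x => ?_
  congr 2
  simp only [f']
  rw [ContinuousLinearMap.det_pi, Finset.abs_prod]
  refine Finset.prod_congr rfl fun j _ => ?_
  rw [ContinuousLinearMap.det, LinearMap.det_ring]
  simp

lemma lintegral_comp_rev (N : ℕ) (g : (Fin N → ℝ) → ENNReal) :
    ∫⁻ y, g y = ∫⁻ y : Fin N → ℝ, g fun j => y (Fin.rev j) := by
  have h := volume_measurePreserving_piCongrLeft (fun _ : Fin N => ℝ) Fin.revPerm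
  rw [← h.lintegral_comp_emb (MeasurableEquiv.measurableEmbedding _)]
  refine lintegral_congr fun y => congrArg g (funext fun j => ?_)
  have := Equiv.piCongrLeft_apply_apply (fun _ : Fin N => ℝ) Fin.revPerm y (Fin.rev j)
  rw [Fin.revPerm_apply, Fin.rev_rev] at this
  exact this

lemma expNeg_rev_mem_unitChamber_iff {N : ℕ} {x : Fin N → ℝ} :
    (fun j => Real.exp (-x (Fin.rev j))) ∈ unitChamber N ↔ x ∈ chamber N := by
  constructor
  · rintro ⟨h1, h2⟩
    refine ⟨fun i j hij => ?_, fun j => ?_⟩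
    · have := h1 (Fin.rev_lt_rev.2 hij)
      simp only [Fin.rev_rev] at this
      rwa [Real.exp_lt_exp, neg_lt_neg_iff] at this
    · have := (h2 (Fin.rev j)).2
      simp only [Fin.rev_rev] at this
      rwa [Real.exp_lt_one_iff, neg_lt_zero] at this
  · rintro ⟨h1, h2⟩
    refine ⟨fun i j hij => ?_, fun j => ⟨Real.exp_pos _, ?_⟩⟩
    · simp only
      rw [Real.exp_lt_exp, neg_lt_neg_iff]
      exact h1 (Fin.rev_lt_rev.2 hij)
    · rw [Real.exp_lt_one_iff, neg_lt_zero]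
      exact h2 _

lemma mem_image_expNeg_of_rev_mem {N : ℕ} {y : Fin N → ℝ}
    (hy : (fun j => y (Fin.rev j)) ∈ unitChamber N) : y ∈ expNeg N '' chamber N := by
  have hpos : ∀ j, 0 < y j := fun j => by
    have := (hy.2 (Fin.rev j)).1
    simpa only [Fin.rev_rev] using this
  have he : ∀ j, Real.exp (- -Real.log (y j)) = y j := fun j => by
    rw [neg_neg, Real.exp_log (hpos j)]
  refine ⟨fun j => -Real.log (y j), expNeg_rev_mem_unitChamber_iff.1 ?_, funext he⟩
  simpa only [he] using hy

lemma sum_alternating_range (G : ℕ → ℝ) (n : ℕ) :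
    ∑ j ∈ Finset.range (2 * n), (-1 : ℝ) ^ j * G j
      = ∑ l ∈ Finset.range n, (G (2 * l) - G (2 * l + 1)) := by
  induction n with
  | zero => simp
  | succ n ih =>
    rw [Finset.sum_range_succ _ n, ← ih, Nat.mul_succ, Finset.sum_range_succ, Finset.sum_range_succ,
      pow_succ, pow_mul]
    norm_num
    ring

lemma sum_alternating_fin (n : ℕ) (g : Fin (2 * n) → ℝ) :
    ∑ j : Fin (2 * n), (-1 : ℝ) ^ (j : ℕ) * g j
      = ∑ l : Fin n, (g ⟨2 * l, by omega⟩ - g ⟨2 * l + 1, by omega⟩) := by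
  have h := sum_alternating_range (fun j => if h : j < 2 * n then g ⟨j, h⟩ else 0) n
  rw [← Fin.sum_univ_eq_sum_range (fun j => (-1 : ℝ) ^ j * if h : j < 2 * n then g ⟨j, h⟩ else 0),
    ← Fin.sum_univ_eq_sum_range (fun l => (if h : 2 * l < 2 * n then g ⟨2 * l, h⟩ else 0)
      - if h : 2 * l + 1 < 2 * n then g ⟨2 * l + 1, h⟩ else 0)] at h
  refine (Finset.sum_congr rfl fun j _ => ?_).trans (h.trans (Finset.sum_congr rfl fun l _ => ?_))
  · simp
  · rw [dif_pos (by omega), dif_pos (by omega)]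

lemma sum_alternating_rev (n : ℕ) (x : Fin (2 * n) → ℝ) :
    ∑ j : Fin (2 * n), (-1 : ℝ) ^ (j : ℕ) * x (Fin.rev j)
      = -∑ j : Fin (2 * n), (-1 : ℝ) ^ (j : ℕ) * x j := by
  rw [← Equiv.sum_comp Fin.revPerm, ← Finset.sum_neg_distrib]
  refine Finset.sum_congr rfl fun j _ => ?_
  rw [Fin.revPerm_apply, Fin.rev_rev, Fin.val_rev]
  have : (-1 : ℝ) ^ (2 * n - (j + 1)) * (-1) ^ ((j : ℕ) + 1) = 1 := by
    rw [← pow_add, Nat.sub_add_cancel (by omega), pow_mul]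
    norm_num
  have h2 : (-1 : ℝ) ^ (j : ℕ) * (-1) ^ (j : ℕ) = 1 := by
    rw [← mul_pow]
    norm_num
  rw [pow_succ] at this
  linear_combination (-(-1 : ℝ) ^ (j : ℕ) * x j) * this - (-1 : ℝ) ^ (2 * n - (j + 1)) * x j * h2

lemma prod_Ioi_rev {R : Type*} [CommMonoid R] {N : ℕ} (f : Fin N → Fin N → R) :
    ∏ i, ∏ j ∈ Finset.Ioi i, f (Fin.rev j) (Fin.rev i) = ∏ i, ∏ j ∈ Finset.Ioi i, f i j := by
  rw [Finset.prod_sigma', Finset.prod_sigma']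
  refine Finset.prod_bij' (fun p _ => ⟨Fin.rev p.2, Fin.rev p.1⟩)
    (fun p _ => ⟨Fin.rev p.2, Fin.rev p.1⟩) ?_ ?_ ?_ ?_ ?_ <;> simp [Fin.rev_lt_rev]

lemma limitDensity_eq_jacobiWeight (n : ℕ) (a A : ℝ) (x : Fin (2 * n) → ℝ) :
    limitDensity (2 * n) ((a + 1) / 2) (-A / 2) x
      = (∏ j, Real.exp (-x j)) * (limitConst (2 * n) ((a + 1) / 2) (-A / 2)
        * jacobiWeight n a A fun j => Real.exp (-x (Fin.rev j))) := by
  have e1 : ∏ j : Fin (2 * n), Real.exp (-x (Fin.rev j)) ^ ((a - 1) / 2)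
      = Real.exp (-((a - 1) / 2) * ∑ j, x j) := by
    rw [← Equiv.sum_comp Fin.revPerm, Finset.mul_sum, Real.exp_sum]
    refine Finset.prod_congr rfl fun j _ => ?_
    rw [← Real.exp_mul, Fin.revPerm_apply]
    congr 1
    ring
  have e2 : ∏ l : Fin n, (Real.exp (-x (Fin.rev ⟨2 * l + 1, by omega⟩))
      / Real.exp (-x (Fin.rev ⟨2 * l, by omega⟩))) ^ (-A / 2)
      = Real.exp (-(-A / 2) * ∑ j : Fin (2 * n), (-1 : ℝ) ^ (j : ℕ) * x j) := by
    rw [neg_mul, ← mul_neg, ← sum_alternating_rev, sum_alternating_fin n fun j => x (Fin.rev j),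
      Finset.mul_sum, Real.exp_sum]
    refine Finset.prod_congr rfl fun l _ => ?_
    rw [← Real.exp_sub, ← Real.exp_mul]
    congr 1
    ring
  have e3 : Real.exp (-((a + 1) / 2) * ∑ j, x j)
      = (∏ j, Real.exp (-x j)) * Real.exp (-((a - 1) / 2) * ∑ j, x j) := by
    rw [← Real.exp_sum, ← Real.exp_add, Finset.sum_neg_distrib]
    congr 1
    ring
  rw [jacobiWeight, e1, e2, prod_Ioi_rev fun i j => Real.exp (-x j) - Real.exp (-x i),
    limitDensity, e3]
  ring

/-- The limiting density corresponds to the Jacobi weight under the exponential change of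
variables. -/
theorem map_limitMeasure_eq_jacobiMeasure (n : ℕ) (a A : ℝ) :
    (limitMeasure (2 * n) ((a + 1) / 2) (-A / 2)).map
        (fun x (j : Fin (2 * n)) => Real.exp (-x (Fin.rev j)))
      = jacobiMeasure n a A (limitConst (2 * n) ((a + 1) / 2) (-A / 2))⁻¹ := by
  classical
  have hΦ := measurable_expNeg_rev (2 * n)
  refine Measure.ext fun s hs => ?_
  let H : (Fin (2 * n) → ℝ) → ENNReal := s.indicator ((unitChamber (2 * n)).indicator fun y =>
    ENNReal.ofReal (limitConst (2 * n) ((a + 1) / 2) (-A / 2) * jacobiWeight n a A y))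
  rw [Measure.map_apply hΦ hs, limitMeasure, withDensity_apply _ (hΦ hs), jacobiMeasure,
    withDensity_apply _ hs, inv_inv, ← lintegral_indicator hs, ← lintegral_indicator (hΦ hs)]
  calc _ = ∫⁻ x in chamber (2 * n), ENNReal.ofReal (∏ j, Real.exp (-x j))
        * H fun j => expNeg (2 * n) x (Fin.rev j) := by
        rw [← lintegral_indicator (measurableSet_chamber _)]
        refine lintegral_congr fun x => ?_
        by_cases hx : x ∈ chamber (2 * n)
        · have hx' := expNeg_rev_mem_unitChamber_iff.2 hx
          simp only [Set.indicator_apply, hx, if_true, H, expNeg, hx', Set.mem_preimage]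
          split_ifs
          · rw [limitDensity_eq_jacobiWeight, ENNReal.ofReal_mul (by positivity)]
          · rw [mul_zero]
        · simp only [Set.indicator_apply, hx, if_false, ite_self]
    _ = ∫⁻ y in expNeg (2 * n) '' chamber (2 * n), H fun j => y (Fin.rev j) :=
        (lintegral_image_expNeg (2 * n) (measurableSet_chamber _)
          fun y => H fun j => y (Fin.rev j)).symm
    _ = ∫⁻ y : Fin (2 * n) → ℝ, H fun j => y (Fin.rev j) := by
        refine setLIntegral_eq_of_support_subset ?_
        intro y hy
        refine mem_image_expNeg_of_rev_mem (by_contra fun hy' => hy ?_)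
        simp only [H, Set.indicator_apply, hy', if_false, ite_self]
    _ = ∫⁻ y, H y := (lintegral_comp_rev (2 * n) H).symm

end JacobiRSK

theorem mainTheorem6 (n : ℕ) (hn : 1 ≤ n) :
    -- The distribution of the RSK shape of a symmetric geometric matrix.
    (∀ (z α t : ℝ), 0 < z → 0 < α → 0 < t → t ≠ 1 →
      (∀ i j : Fin n, i < j → z ^ 2 * t ^ ((i : ℕ) + (j : ℕ)) < 1) →
      (∀ i : Fin n, α * z * t ^ (i : ℕ) < 1) →
      ∀ (Ω : Type*) [MeasurableSpace Ω] (P : Measure Ω) [IsProbabilityMeasure P]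
        (X : Fin n → Fin n → Ω → ℕ), JacobiRSK.IsSymmGeometric P z α t X →
      ∀ μ : Fin n → ℕ, Antitone μ →
        P.real {ω | JacobiRSK.HasRSKShape (fun i j => X i j ω) μ}
          = JacobiRSK.discreteProb n z α t (fun j => μ j + (n - 1 - (j : ℕ)))) ∧
    -- The scaled (Jacobi) limit.
    (∀ (a a₁ : ℝ), 0 < a + a₁ → (2 ≤ n → 0 < 2 * a + 1) →
      -- the rescaled geometric matrix tends to the exponential matrix
      (∀ (L : ℕ → ℝ), (∀ N, 0 < L N) → Tendsto L atTop atTop →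
        ∀ (Ω : ℕ → Type*) [∀ N, MeasurableSpace (Ω N)] (P : ∀ N, Measure (Ω N))
          [∀ N, IsProbabilityMeasure (P N)] (X : ∀ N, Fin n → Fin n → Ω N → ℕ),
        (∀ N, JacobiRSK.IsSymmGeometric (P N) (Real.exp (-a / L N)) (Real.exp (-a₁ / L N))
          (Real.exp (-1 / L N)) (X N)) →
        ∀ (Ω' : Type*) [MeasurableSpace Ω'] (P' : Measure Ω') [IsProbabilityMeasure P']
          (Y : Fin n → Fin n → Ω' → ℝ), JacobiRSK.IsSymmExponential P' a a₁ Y →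
        TendstoInDistribution (fun N ω (i j : Fin n) => (X N i j ω : ℝ) / L N) atTop
          (fun ω (i j : Fin n) => Y i j ω) P P') ∧
      -- the discrete probability multiplied by `L ^ n` tends to the density
      (∀ (L : ℕ → ℝ), (∀ N, 0 < L N) → Tendsto L atTop atTop →
        ∀ x ∈ JacobiRSK.chamber n, ∀ h : ℕ → Fin n → ℕ,
        (∀ j, Tendsto (fun N => (h N j : ℝ) / L N) atTop (𝓝 (x j))) →
        Tendsto (fun N => L N ^ n * JacobiRSK.discreteProb n (Real.exp (-a / L N))
            (Real.exp (-a₁ / L N)) (Real.exp (-1 / L N)) (h N))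
          atTop (𝓝 (JacobiRSK.limitDensity n a a₁ x))) ∧
      -- the limit is a probability density
      (∀ x ∈ JacobiRSK.chamber n, 0 < JacobiRSK.limitDensity n a a₁ x) ∧
      IsProbabilityMeasure (JacobiRSK.limitMeasure n a a₁) ∧
      -- it is the density of the continuous RSK shape of the exponential matrix
      (∀ (Ω' : Type*) [MeasurableSpace Ω'] (P' : Measure Ω') [IsProbabilityMeasure P']
          (Y : Fin n → Fin n → Ω' → ℝ), JacobiRSK.IsSymmExponential P' a a₁ Y →
        P'.map (fun ω => JacobiRSK.continuousShape (fun i j => Y i j ω))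
          = JacobiRSK.limitMeasure n a a₁)) ∧
    -- Equivalence, for `2 * n` coordinates, with the parameter-dependent Jacobi ensemble.
    (∀ (a A : ℝ), -2 < a → A < a + 1 →
      ∃ C : ℝ, 0 < C ∧
        (JacobiRSK.limitMeasure (2 * n) ((a + 1) / 2) (-A / 2)).map
            (fun x (j : Fin (2 * n)) => Real.exp (-x (Fin.rev j)))
          = JacobiRSK.jacobiMeasure n a A C) := by
  refine ⟨?_, ?_, ?_⟩
  · intro z α t hz hα ht ht1 hoff hdiag Ω _ P _ X hX μ hμ
    rw [measureReal_def, hX.measure_hasRSKShape hz hα ht ht1 hoff hdiag μ hμ, ENNReal.toReal_ofReal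
      (JacobiRSK.discreteProb_nonneg hz hα ht ht1 hoff hdiag μ hμ)]
  · intro a a₁ h0 h1
    refine ⟨?_, ?_, ?_, JacobiRSK.isProbabilityMeasure_limitMeasure hn h0 h1, ?_⟩
    · intro L hL hL' Ω _ P _ X hX Ω' _ P' _ Y hY
      exact JacobiRSK.tendstoInDistribution_matrix h0 h1 hL hL' hX hY
    · intro L hL hL' x _ h hx
      exact JacobiRSK.tendsto_mul_discreteProb n hn a a₁ h0 h1 hL hL' x h hx
    · intro x hx
      rw [JacobiRSK.limitDensity_eq]
      exact mul_pos (JacobiRSK.limitConst_pos n hn a a₁ h0 h1)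
        (JacobiRSK.limitWeight_pos a a₁ hx.1)
    · intro Ω' _ P' _ Y hY
      exact hY.map_continuousShape hn h0 h1
  · intro a A ha hA
    exact ⟨_, inv_pos.2 (JacobiRSK.limitConst_pos (2 * n) (by omega) ((a + 1) / 2) (-A / 2)
      (by linarith) fun _ => by linarith), JacobiRSK.map_limitMeasure_eq_jacobiMeasure n a A⟩
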